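/- Call a smooth density $f(a,b,c)$ ($a=u_{xx}$, $b=u_{xy}$, $c=u_{yy}$) of a Lagrangian $\int f(u_{xx},u_{xy},u_{yy})\,dx\,dy$ integrable if it satisfies the integrability conditions $$(f_{ab}f_{cc}-f_{ac}f_{bc})_a=(f_{bc}f_{aa}-f_{ab}f_{ac})_c,\quad (f_{aa}f_{cc}-f_{ac}^2)_a=(f_{aa}f_{bb}-f_{ab}^2)_c,\quad (f_{aa}f_{cc}-f_{ac}^2)_c=(f_{cc}f_{bb}-f_{bc}^2)_a,$$ $$(f_{bb}f_{cc}-f_{bc}^2)_b=2(f_{ab}f_{cc}-f_{ac}f_{bc})_c,\quad (f_{bb}f_{aa}-f_{ab}^2)_b=2(f_{bc}f_{aa}-f_{ac}f_{ab})_a .$$ Call $f$ degenerate if a linear change of the independent variables $(x,y)\to(\tilde x,\tilde y)$ brings it to a density that depends on $u_{\tilde x\tilde x},u_{\tilde x\tilde y}$ only. For a function $h(c)$ let $(\ast)_h$ be the system $$g_c=\tfrac14(g_{bb}-hg),\qquad v=-(\ln g)_{bb},\qquad v_b^2=4v^3+4hv^2+8h'v+\tfrac83h'' ,$$ where $(\ln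 g)_b$ means $g_b/g$. Put $g_2[h]=\frac43h^2-8h'$, $g_3[h]=-\frac8{27}h^3+\frac83hh'-\frac83h''$. The Chazy equation is $h'''=2hh''-3h'^2$. **1. Reduction.** Let $\mathbb K=\mathbb R$ or $\mathbb C$, let $B,C\subset\mathbb K$ be non-empty connected open sets, and let $g(b,c)$ be a smooth (holomorphic if $\mathbb K=\mathbb C$) nowhere vanishing function on $B\times C$. Then $f=e^ag(b,c)$ is integrable on $\mathbb K\times B\times C$ if and only if there is a smooth solution $h(c)$ of the Chazy equation on $C$ such that $g$ satisfies $(\ast)_h$ on $B\times C$. **2. Rational and trigonometric cases.** With $g$ as in 1, $g$ satisfies $(\ast)_h$ with $h=0$ if and only if $g=e^{2\mu b+\mu^2c}\,(K(b+\mu c)+L)$ for some constants $\mu,K,L\in\mathbb K$, and it satisfies $(\ast)_h$ with $h=1$ if and only if $g=e^{2\mu b+\mu^2c}\,(Ke^{b+\mu c}+Le^{-(b+\mu c)})$ for some constants $\mu,K,L\in\mathbb K$. In both cases the density $f=e^ag$ is degenerate. **3. Types of solutions of the Chazy equation.** Let $\Delta(c)=(2\pi)^{12}q\prod_{n\ge1}(1-q^n)^{24}$,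 $q=e^{2\pi ic}$, and $h_{\rm ell}=\frac12\Delta'/\Delta$ on the upper half-plane $\mathbb H$. For $\alpha\delta-\beta\gamma=1$ (complex coefficients), $h(c)\mapsto(\gamma c+\delta)^{-2}\,h\!\left(\frac{\alpha c+\beta}{\gamma c+\delta}\right)-\frac{6\gamma}{\gamma c+\delta}$ takes holomorphic solutions of the Chazy equation to solutions. The functions $0$, $1$ and $h_{\rm ell}$ are solutions, and near each point of its domain every holomorphic solution is a transform of this kind of exactly one of these three. **4. Elliptic case.** On $\mathbb H$ one has $h_{\rm ell}=\pi i\left(1-24\sum_{n\ge1}\sigma_1(n)q^n\right)$, and for $c\in\mathbb H$ the numbers $g_2[h_{\rm ell}](c)$, $g_3[h_{\rm ell}](c)$ are the invariants of a lattice. Let $\sigma(z;g_2,g_3)$ be the Weierstrass sigma function and $S(z,c)=\sigma\big(z;g_2[h_{\rm ell}](c),g_3[h_{\rm ell}](c)\big)\,e^{z^2h_{\rm ell}(c)/6}$. The density $e^aS(b,c)$ is integrable on $\mathbb C\times\mathbb C\times\mathbb H$. If $B\subset\mathbb C$ and $C\subset\mathbb H$ are non-empty, open and connected and $g$ is holomorphic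 and nowhere zero on $B\times C$, then $g$ satisfies $(\ast)_{h_{\rm ell}}$ if and only if $g(b,c)=K\,e^{2\mu b+\mu^2c}\,S(b+\mu c+\nu,c)$ for some $\mu,\nu,K\in\mathbb C$. **5. Elliptic case, theta function.** For $c>0$ let $H(c)=-1+24\sum_{n\ge1}\sigma_1(n)e^{-2nc}$, let $\theta_1(z,\tau)=2\sum_{n\ge0}(-1)^ne^{\pi i\tau(n+1/2)^2}\sin((2n+1)z)$, and let $\Theta(z,c)=[\Delta(ic/\pi)]^{-1/8}\,\theta_1(z,ic/\pi)$ with the positive eighth root. Then for $c>0$: $H(c)=\frac i\pi h_{\rm ell}(ic/\pi)$; $H$ solves the Chazy equation; $\Delta(ic/\pi)$ is real and positive; $\Theta(b,c)$ is real for real $b$; and for all $z\in\mathbb C$ $$\Theta(z,c)=\frac1{\sqrt{2\pi^3}}\;\sigma\big(z;g_2[H](c),g_3[H](c)\big)\,e^{z^2H(c)/6}.$$ The real density $e^a\Theta(b,c)$ is integrable on $\mathbb R\times\mathbb R\times(0,\infty)$. If $B\subset\mathbb R$ and $C\subset(0,\infty)$ are non-empty open intervals and $g$ is real, smooth and nowhere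 zero on $B\times C$, then $g$ satisfies $(\ast)_H$ if and only if $g(b,c)=K\,e^{2\mu b+\mu^2c}\,\Theta(b+\mu c+\nu,c)$ for some $\mu,\nu,K\in\mathbb C$. -/

import Mathlib

open scoped ContDiff

noncomputable section

namespace SecondOrderLagrangian

/-! ### Partial derivatives and the integrability conditions -/

section General

variable {𝕜 : Type*} [RCLike 𝕜]

/-- `∂F/∂a` for a function `F(a, b, c)`. -/
def dA (F : 𝕜 → 𝕜 → 𝕜 → 𝕜) (a b c : 𝕜) : 𝕜 := deriv (fun t => F t b c) a

/-- `∂F/∂b` for a function `F(a, b, c)`. -/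
def dB (F : 𝕜 → 𝕜 → 𝕜 → 𝕜) (a b c : 𝕜) : 𝕜 := deriv (fun t => F a t c) b

/-- `∂F/∂c` for a function `F(a, b, c)`. -/
def dC (F : 𝕜 → 𝕜 → 𝕜 → 𝕜) (a b c : 𝕜) : 𝕜 := deriv (fun t => F a b t) c

/-- The integrability conditions of the Lagrangian `∫ f(u_xx, u_xy, u_yy) dx dy`, imposed on the
density `f(a, b, c)`, `a = u_xx`, `b = u_xy`, `c = u_yy`, at all points of the set `U`. -/
structure IntegrableDensity (U : Set (𝕜 × 𝕜 × 𝕜)) (f : 𝕜 → 𝕜 → 𝕜 → 𝕜) : Prop where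
  /-- `(f_ab f_cc - f_ac f_bc)_a = (f_bc f_aa - f_ab f_ac)_c` -/
  cond₁ : ∀ a b c, (a, b, c) ∈ U →
    dA (dB (dA f) * dC (dC f) - dC (dA f) * dC (dB f)) a b c =
      dC (dC (dB f) * dA (dA f) - dB (dA f) * dC (dA f)) a b c
  /-- `(f_aa f_cc - f_ac²)_a = (f_aa f_bb - f_ab²)_c` -/
  cond₂ : ∀ a b c, (a, b, c) ∈ U →
    dA (dA (dA f) * dC (dC f) - dC (dA f) ^ 2) a b c =
      dC (dA (dA f) * dB (dB f) - dB (dA f) ^ 2) a b c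
  /-- `(f_aa f_cc - f_ac²)_c = (f_cc f_bb - f_bc²)_a` -/
  cond₃ : ∀ a b c, (a, b, c) ∈ U →
    dC (dA (dA f) * dC (dC f) - dC (dA f) ^ 2) a b c =
      dA (dC (dC f) * dB (dB f) - dC (dB f) ^ 2) a b c
  /-- `(f_bb f_cc - f_bc²)_b = 2 (f_ab f_cc - f_ac f_bc)_c` -/
  cond₄ : ∀ a b c, (a, b, c) ∈ U →
    dB (dB (dB f) * dC (dC f) - dC (dB f) ^ 2) a b c =
      2 * dC (dB (dA f) * dC (dC f) - dC (dA f) * dC (dB f)) a b c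
  /-- `(f_bb f_aa - f_ab²)_b = 2 (f_bc f_aa - f_ac f_ab)_a` -/
  cond₅ : ∀ a b c, (a, b, c) ∈ U →
    dB (dB (dB f) * dA (dA f) - dB (dA f) ^ 2) a b c =
      2 * dA (dC (dB f) * dA (dA f) - dC (dA f) * dB (dA f)) a b c

/-- The density `f(a, b, c) = e^a g(b, c)`. -/
def expDensity (g : 𝕜 → 𝕜 → 𝕜) (a b c : 𝕜) : 𝕜 := NormedSpace.exp a * g b c

/-- A density `f` is degenerate on `U` if a linear change of the independent variables
`x = p x' + r y'`, `y = q x' + s y'` (`p s - q r ≠ 0`) turns it into a density `F(u_x'x', u_x'y')`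
that does not involve `u_y'y'`; here
`u_x'x' = p² u_xx + 2 p q u_xy + q² u_yy` and
`u_x'y' = p r u_xx + (p s + q r) u_xy + q s u_yy`.
(The Lagrangian is then of first order in `v = u_x'`.) -/
def IsDegenerate (U : Set (𝕜 × 𝕜 × 𝕜)) (f : 𝕜 → 𝕜 → 𝕜 → 𝕜) : Prop :=
  ∃ (p q r s : 𝕜) (F : 𝕜 → 𝕜 → 𝕜), p * s - q * r ≠ 0 ∧
    ∀ a b c, (a, b, c) ∈ U →
      f a b c = F (p ^ 2 * a + 2 * p * q * b + q ^ 2 * c)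
        (p * r * a + (p * s + q * r) * b + q * s * c)

/-! ### The Chazy equation and the reduced system -/

/-- The Chazy equation `h''' = 2 h h'' - 3 h'²` at the point `c`. -/
def ChazyAt (h : 𝕜 → 𝕜) (c : 𝕜) : Prop :=
  iteratedDeriv 3 h c = 2 * h c * iteratedDeriv 2 h c - 3 * deriv h c ^ 2

/-- `v = -(ln g)_bb`, the logarithmic derivative in `b` being `g_b / g`. -/
def negLogDerivTwo (g : 𝕜 → 𝕜 → 𝕜) (b c : 𝕜) : 𝕜 :=
  -deriv (logDeriv (fun t => g t c)) b

/-- The system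
`g_c = (g_bb - h g) / 4`, `v = -(ln g)_bb`, `v_b² = 4 v³ + 4 h v² + 8 h' v + (8/3) h''`
on `B × C`. -/
structure ReducedSystem (B C : Set 𝕜) (g : 𝕜 → 𝕜 → 𝕜) (h : 𝕜 → 𝕜) : Prop where
  heat : ∀ b ∈ B, ∀ c ∈ C,
    deriv (fun t => g b t) c = 1 / 4 * (iteratedDeriv 2 (fun t => g t c) b - h c * g b c)
  weierstrass : ∀ b ∈ B, ∀ c ∈ C,
    deriv (fun t => negLogDerivTwo g t c) b ^ 2 =
      4 * negLogDerivTwo g b c ^ 3 + 4 * h c * negLogDerivTwo g b c ^ 2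
        + 8 * deriv h c * negLogDerivTwo g b c + 8 / 3 * iteratedDeriv 2 h c

/-- The invariant `g₂ = (4/3) h² - 8 h'`. -/
def invTwo (h : 𝕜 → 𝕜) (c : 𝕜) : 𝕜 := 4 / 3 * h c ^ 2 - 8 * deriv h c

/-- The invariant `g₃ = -(8/27) h³ + (8/3) h h' - (8/3) h''`. -/
def invThree (h : 𝕜 → 𝕜) (c : 𝕜) : 𝕜 :=
  -(8 / 27) * h c ^ 3 + 8 / 3 * h c * deriv h c - 8 / 3 * iteratedDeriv 2 h c

end General

/-! ### Special functions -/

/-- The upper half-plane as a subset of `ℂ`. -/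
def upperHalf : Set ℂ := {c | 0 < c.im}

/-- The modular discriminant `Δ(c) = (2π)¹² q ∏_{n ≥ 1} (1 - qⁿ)²⁴`, `q = e^{2πic}`. -/
def modularDisc (c : ℂ) : ℂ :=
  (2 * Real.pi : ℂ) ^ 12 * Complex.exp (2 * Real.pi * Complex.I * c) *
    ∏' n : ℕ, (1 - Complex.exp (2 * Real.pi * Complex.I * c) ^ (n + 1)) ^ 24

/-- The elliptic solution `h = Δ' / (2Δ)` of the Chazy equation. -/
def ellipticChazy (c : ℂ) : ℂ := 1 / 2 * (deriv modularDisc c / modularDisc c)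

/-- The real function `H(c) = -1 + 24 ∑_{n ≥ 1} σ₁(n) e^{-2nc}`, `c > 0`. -/
def realChazy (c : ℝ) : ℝ :=
  -1 + 24 * ∑' n : ℕ, (ArithmeticFunction.sigma 1 (n + 1) : ℝ) * Real.exp (-2 * (n + 1) * c)

/-- The Weierstrass sigma function of a lattice,
`σ(z) = z ∏_{l ≠ 0} (1 - z/l) exp(z/l + z²/(2l²))`
(the factor of `l = 0` in the product below is `1`, as division by `0` gives `0`). -/
def latticeSigma (L : PeriodPair) (z : ℂ) : ℂ :=
  z * ∏' l : L.lattice,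
    (1 - z / (l : ℂ)) * Complex.exp (z / (l : ℂ) + z ^ 2 / (2 * (l : ℂ) ^ 2))

open Classical in
/-- The Weierstrass sigma function `σ(z; γ₂, γ₃)` with invariants `γ₂, γ₃`, that is, the sigma
function of the lattice with these invariants (the value `0` is given for a pair which is not the
pair of invariants of a lattice). -/
def weierstrassSigma (z γ₂ γ₃ : ℂ) : ℂ :=
  if hL : ∃ L : PeriodPair, L.g₂ = γ₂ ∧ L.g₃ = γ₃ then latticeSigma hL.choose z else 0

/-- `σ(z; g₂(c), g₃(c)) e^{z² h(c) / 6}`, with `g₂, g₃` the invariants built from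
`h = Δ' / (2Δ)`. -/
def sigmaSolution (z c : ℂ) : ℂ :=
  weierstrassSigma z (invTwo ellipticChazy c) (invThree ellipticChazy c) *
    Complex.exp (z ^ 2 * ellipticChazy c / 6)

/-- The Jacobi theta function
`θ₁(z, τ) = 2 ∑_{n ≥ 0} (-1)ⁿ e^{πiτ(n+1/2)²} sin((2n+1)z)`. -/
def jacobiThetaOne (z τ : ℂ) : ℂ :=
  2 * ∑' n : ℕ, (-1) ^ n * Complex.exp (Real.pi * Complex.I * τ * (n + 1 / 2) ^ 2) *
    Complex.sin ((2 * n + 1) * z)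

/-- The point `ic/π`. -/
def thetaPoint (c : ℝ) : ℂ := Complex.I * c / Real.pi

/-- `[Δ(ic/π)]^{-1/8} θ₁(z, ic/π)` for real `c > 0`, with the positive eighth root of
the positive number `Δ(ic/π)`. -/
def thetaSolution (z : ℂ) (c : ℝ) : ℂ :=
  (((modularDisc (thetaPoint c)).re ^ (-(1 / 8) : ℝ) : ℝ) : ℂ) * jacobiThetaOne z (thetaPoint c)

/-! ### The `SL(2)`-symmetry of the Chazy equation -/

/-- The transform of `h` under `c ↦ (αc+β)/(γc+δ)`, `αδ - βγ = 1`: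
`(γc+δ)⁻² h((αc+β)/(γc+δ)) - 6γ/(γc+δ)`. -/
def chazyTransform (α β γ δ : ℂ) (h : ℂ → ℂ) (c : ℂ) : ℂ :=
  h ((α * c + β) / (γ * c + δ)) / (γ * c + δ) ^ 2 - 6 * γ / (γ * c + δ)

/-- Near the point `c₀`, `h` is an `SL(2)`-transform of the function `k` defined on `D`. -/
def ChazyEquivAt (k : ℂ → ℂ) (D : Set ℂ) (h : ℂ → ℂ) (c₀ : ℂ) : Prop :=
  ∃ α β γ δ : ℂ, α * δ - β * γ = 1 ∧ γ * c₀ + δ ≠ 0 ∧ (α * c₀ + β) / (γ * c₀ + δ) ∈ D ∧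
    ∀ᶠ c in nhds c₀, h c = chazyTransform α β γ δ k c

/-- The rational, trigonometric and elliptic solutions `0`, `1`, `Δ' / (2Δ)`. -/
def chazyModel : Fin 3 → ℂ → ℂ := ![fun _ => 0, fun _ => 1, ellipticChazy]

/-- The domains of the three model solutions. -/
def chazyModelDomain : Fin 3 → Set ℂ := ![Set.univ, Set.univ, upperHalf]

end SecondOrderLagrangian

end

/-! Reduction. For `f = e^a g` every condition carries the factor `e^{2a}`, which leaves five
equations for `g(b, c)` (`ExpIntegrableAt`). The fifth says that `(g_bb - 4 g_c) / g` does not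
depend on `b`; this quotient is `h(c)`, and the heat equation results. With `w = g_b / g`, `v =
-w_b`, `p = v_b`, the second condition becomes `v_bb = 6v² + 4hv + 4h'`. Hence `m = p² - 4v³ - 4hv²
- 8h'v` does not depend on `b`, while the heat equation gives `m_c = (3m - 8h'')v + 2hm - 8h'²`.
Equality of mixed derivatives forces `m = (8/3)h''`, and what is left of the formula for `m_c` is
the Chazy equation. Conversely, the cubic equation for `p²` and the Chazy equation give back the
second order equation, and with it all five conditions.

Classification. For a fixed solution `h` of the Chazy equation, `(g, w, v, p)` satisfies a closed
system of first order equations (`IsJet`), so a solution on a connected set is determined by its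
value at one point (`IsJet.eq_of_eq`). Such a value consists of `g ≠ 0`, an arbitrary `w` and a
point `(v, p)` of the cubic. The Galilei symmetries `K e^{2μb+μ²c} g(b + μc + ν, c)` of the heat
equation adjust it: `K` sets `g`, `μ` sets `w`, and `ν` moves `(v, p)` along the cubic. It remains
to parametrize the cubic. For `h = 0` and `h = 1` it is cuspidal and nodal, and the two constants
`K, L` of an explicit family reach all its points; for elliptic `h` the functions `℘, ℘'` do.

Elliptic case. `P = θ₁ / θ₁'(0)` satisfies a heat equation with potential `E = P'''(0)`. By
Liouville's theorem `-(ln P)'' = ℘ - E/3`, whence `P(z) = σ(z) e^{Ez²/6}`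
(`ThetaModel.eq_latticeSigma`). Since `℘` takes every value, the compatibility of the heat equation
with the equation of `℘` is a polynomial identity in `v`; its coefficients yield the formulas for
`g₂`, `g₃` and the Chazy equation together (`modelLattice_invariants`). Jacobi's formula `θ₁'(0) =
2η³` ties the normalization to `Δ`. The scaled function `ellipticModel κ s` serves both for `S` and
for `Θ`. Where these functions vanish, the integrability conditions hold by continuity, as the zeros
have dense complement.

Types of Chazy solutions. Under the `SL(2)`-action `g₂[h]` and `g₃[h]` have weights 4 and 6, and
together with the free parameter `γ` they fix the 2-jet of `h`. So equivalence of solutions is a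
matter of `(g₂, g₃)` up to weighted scaling (`ChazyJet.chazyEquivAt_iff`): both zero, discriminant
zero but `g₂ ≠ 0`, or discriminant non-zero. The last class belongs to `Δ'/(2Δ)` because `(E₄ : E₆)`
takes all values off the discriminant: `A³E₆² - B²E₄³` is non-zero at infinity when `A³ ≠ B²`, and
without a zero its inverse would be a modular form of negative weight. -/

open scoped ContDiff

noncomputable section

namespace SecondOrderLagrangian

/-! ### Calculus of functions of two variables -/

section Calculus

open Filter Topology

variable {𝕜 : Type*} [RCLike 𝕜]

/-- Smoothness of a curried function of two variables on a set. -/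
def SmoothOn (Ω : Set (𝕜 × 𝕜)) (f : 𝕜 → 𝕜 → 𝕜) : Prop :=
  ContDiffOn 𝕜 ∞ (fun x : 𝕜 × 𝕜 => f x.1 x.2) Ω

/-- The partial derivative in the first variable. -/
def pb (f : 𝕜 → 𝕜 → 𝕜) (b c : 𝕜) : 𝕜 := deriv (fun t => f t c) b

/-- The partial derivative in the second variable. -/
def pc (f : 𝕜 → 𝕜 → 𝕜) (b c : 𝕜) : 𝕜 := deriv (fun t => f b t) c

variable {Ω : Set (𝕜 × 𝕜)} {f f₁ f₂ : 𝕜 → 𝕜 → 𝕜} {b c d : 𝕜}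

lemma SmoothOn.hasFDerivAt (hf : SmoothOn Ω f) (hΩ : IsOpen Ω) (h : (b, c) ∈ Ω) :
    HasFDerivAt (fun x : 𝕜 × 𝕜 => f x.1 x.2) (fderiv 𝕜 (fun x : 𝕜 × 𝕜 => f x.1 x.2) (b, c))
      (b, c) :=
  ((hf.contDiffAt (hΩ.mem_nhds h)).differentiableAt (by simp)).hasFDerivAt

lemma hasDerivAt_slice_fst {F : Type*} [NormedAddCommGroup F] [NormedSpace 𝕜 F]
    {f : 𝕜 × 𝕜 → F} {f' : 𝕜 × 𝕜 →L[𝕜] F} (hf : HasFDerivAt f f' (b, c)) :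
    HasDerivAt (fun t => f (t, c)) (f' (1, 0)) b :=
  HasFDerivAt.comp_hasDerivAt (l := f) b hf ((hasDerivAt_id b).prodMk (hasDerivAt_const b c))

lemma hasDerivAt_slice_snd {F : Type*} [NormedAddCommGroup F] [NormedSpace 𝕜 F]
    {f : 𝕜 × 𝕜 → F} {f' : 𝕜 × 𝕜 →L[𝕜] F} (hf : HasFDerivAt f f' (b, c)) :
    HasDerivAt (fun t => f (b, t)) (f' (0, 1)) c :=
  HasFDerivAt.comp_hasDerivAt (l := f) c hf ((hasDerivAt_const c b).prodMk (hasDerivAt_id c))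

lemma SmoothOn.hasDerivAt_fst (hf : SmoothOn Ω f) (hΩ : IsOpen Ω) (h : (b, c) ∈ Ω) :
    HasDerivAt (fun t => f t c) (pb f b c) b :=
  (hasDerivAt_slice_fst (hf.hasFDerivAt hΩ h)).differentiableAt.hasDerivAt

lemma SmoothOn.hasDerivAt_snd (hf : SmoothOn Ω f) (hΩ : IsOpen Ω) (h : (b, c) ∈ Ω) :
    HasDerivAt (fun t => f b t) (pc f b c) c :=
  (hasDerivAt_slice_snd (hf.hasFDerivAt hΩ h)).differentiableAt.hasDerivAt

lemma SmoothOn.pb_eq (hf : SmoothOn Ω f) (hΩ : IsOpen Ω) (h : (b, c) ∈ Ω) :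
    pb f b c = fderiv 𝕜 (fun x : 𝕜 × 𝕜 => f x.1 x.2) (b, c) (1, 0) :=
  (hasDerivAt_slice_fst (hf.hasFDerivAt hΩ h)).deriv

lemma SmoothOn.pc_eq (hf : SmoothOn Ω f) (hΩ : IsOpen Ω) (h : (b, c) ∈ Ω) :
    pc f b c = fderiv 𝕜 (fun x : 𝕜 × 𝕜 => f x.1 x.2) (b, c) (0, 1) :=
  (hasDerivAt_slice_snd (hf.hasFDerivAt hΩ h)).deriv

lemma SmoothOn.smoothOn_pb (hf : SmoothOn Ω f) (hΩ : IsOpen Ω) : SmoothOn Ω (pb f) := by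
  have h1 := ContDiffOn.fderiv_of_isOpen (m := ∞) hf hΩ (by simp)
  exact (h1.clm_apply contDiffOn_const).congr fun x hx => hf.pb_eq hΩ hx

lemma SmoothOn.smoothOn_pc (hf : SmoothOn Ω f) (hΩ : IsOpen Ω) : SmoothOn Ω (pc f) := by
  have h1 := ContDiffOn.fderiv_of_isOpen (m := ∞) hf hΩ (by simp)
  exact (h1.clm_apply contDiffOn_const).congr fun x hx => hf.pc_eq hΩ hx

lemma SmoothOn.continuousOn (hf : SmoothOn Ω f) : ContinuousOn (fun x : 𝕜 × 𝕜 => f x.1 x.2) Ω :=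
  ContDiffOn.continuousOn hf

lemma SmoothOn.mono {Ω' : Set (𝕜 × 𝕜)} (hf : SmoothOn Ω f) (h : Ω' ⊆ Ω) : SmoothOn Ω' f :=
  ContDiffOn.mono hf h

lemma eventually_slice_fst (hΩ : IsOpen Ω) (h : (b, c) ∈ Ω) : ∀ᶠ t in 𝓝 b, (t, c) ∈ Ω :=
  (Continuous.prodMk_left c).continuousAt.eventually_mem (hΩ.mem_nhds h)

lemma eventually_slice_snd (hΩ : IsOpen Ω) (h : (b, c) ∈ Ω) : ∀ᶠ t in 𝓝 c, (b, t) ∈ Ω :=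
  (Continuous.prodMk_right b).continuousAt.eventually_mem (hΩ.mem_nhds h)

/-- Both sides are the second Fréchet derivative evaluated on the two basis vectors, in either
order. -/
lemma SmoothOn.pb_pc (hf : SmoothOn Ω f) (hΩ : IsOpen Ω) (h : (b, c) ∈ Ω) :
    pb (pc f) b c =
      pc (pb f) b c := by
  have hs : IsSymmSndFDerivAt 𝕜 (fun x : 𝕜 × 𝕜 => f x.1 x.2) (b, c) :=
    (hf.contDiffAt (hΩ.mem_nhds h)).isSymmSndFDerivAt (by
      rw [minSmoothness_of_isRCLikeNormedField]; exact WithTop.coe_le_coe.2 le_top)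
  have h1 := ContDiffOn.fderiv_of_isOpen (m := ∞) hf hΩ (by simp)
  have h2 := ((h1.contDiffAt (hΩ.mem_nhds h)).differentiableAt (by simp)).hasFDerivAt
  have e1 : pb (pc f) b c =
      fderiv 𝕜 (fderiv 𝕜 (fun x : 𝕜 × 𝕜 => f x.1 x.2)) (b, c) (1, 0) (0, 1) := by
    have h3 := (hasDerivAt_slice_fst h2).clm_apply (hasDerivAt_const b ((0 : 𝕜), (1 : 𝕜)))
    rw [map_zero, add_zero] at h3
    rw [← h3.deriv]
    refine Filter.EventuallyEq.deriv_eq ?_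
    filter_upwards [eventually_slice_fst hΩ h] with t ht using hf.pc_eq hΩ ht
  have e2 : pc (pb f) b c =
      fderiv 𝕜 (fderiv 𝕜 (fun x : 𝕜 × 𝕜 => f x.1 x.2)) (b, c) (0, 1) (1, 0) := by
    have h3 := (hasDerivAt_slice_snd h2).clm_apply (hasDerivAt_const c ((1 : 𝕜), (0 : 𝕜)))
    rw [map_zero, add_zero] at h3
    rw [← h3.deriv]
    refine Filter.EventuallyEq.deriv_eq ?_
    filter_upwards [eventually_slice_snd hΩ h] with t ht using hf.pb_eq hΩ ht
  rw [e1, e2]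
  exact hs _ _

/-- Equality of mixed partial derivatives: the `c`-derivative of `f_b` is the `b`-derivative
of `f_c`. -/
lemma SmoothOn.mixed (hf : SmoothOn Ω f) (hΩ : IsOpen Ω)
    (h₁ : ∀ b c, (b, c) ∈ Ω → HasDerivAt (fun t => f t c) (f₁ b c) b)
    (h₂ : ∀ b c, (b, c) ∈ Ω → HasDerivAt (fun t => f b t) (f₂ b c) c) (h : (b, c) ∈ Ω)
    (hd : HasDerivAt (fun t => f₂ t c) d b) : HasDerivAt (fun t => f₁ b t) d c := by
  have e1 : (fun t => f₁ b t) =ᶠ[𝓝 c] fun t => pb f b t := by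
    filter_upwards [eventually_slice_snd hΩ h] with t ht using (h₁ b t ht).deriv.symm
  have e2 : (fun t => f₂ t c) =ᶠ[𝓝 b] fun t => pc f t c := by
    filter_upwards [eventually_slice_fst hΩ h] with t ht using (h₂ t c ht).deriv.symm
  have h3 : pb (pc f) b c = d :=
    (hd.congr_of_eventuallyEq e2.symm).deriv
  rw [← h3, hf.pb_pc hΩ h]
  exact ((hf.smoothOn_pb hΩ).hasDerivAt_snd hΩ h).congr_of_eventuallyEq e1

/-- If `p e = 0` on an open set and `e` vanishes at the points near which `p` vanishes
identically, then `e = 0`. -/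
lemma eq_zero_of_mul_eq_zero {X : Type*} [TopologicalSpace X] {Ω : Set X} (hΩ : IsOpen Ω)
    {p e : X → 𝕜} (he : ContinuousOn e Ω) (hpe : ∀ x ∈ Ω, p x * e x = 0)
    (h0 : ∀ x ∈ Ω, (∀ᶠ y in 𝓝 x, p y = 0) → e x = 0) {x : X} (hx : x ∈ Ω) : e x = 0 := by
  by_contra hne
  refine hne (h0 x hx ?_)
  -- By continuity `e` stays non-zero near `x`, so there the factor `p` has to vanish identically,
  -- and `h0` applies.
  have : ∀ᶠ y in 𝓝 x, e y ≠ 0 :=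
    (he.continuousAt (hΩ.mem_nhds hx)).eventually_ne hne
  filter_upwards [this, hΩ.mem_nhds hx] with y hy hy'
  exact (mul_eq_zero.1 (hpe y hy')).resolve_right hy

end Calculus

/-! ### Logarithmic derivatives of a solution of the heat equation -/

section Jets

open Filter Topology

variable {𝕜 : Type*} [RCLike 𝕜]

/-- The logarithmic derivative `g_b / g`. -/
def logB (g : 𝕜 → 𝕜 → 𝕜) (b c : 𝕜) : 𝕜 := pb g b c / g b c

lemma negLogDerivTwo_eq (g : 𝕜 → 𝕜 → 𝕜) (b c : 𝕜) : negLogDerivTwo g b c = -pb (logB g) b c := rfl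

variable {Ω : Set (𝕜 × 𝕜)} {g : 𝕜 → 𝕜 → 𝕜} {b c : 𝕜}

lemma SmoothOn.neg {f : 𝕜 → 𝕜 → 𝕜} (hf : SmoothOn Ω f) : SmoothOn Ω (fun b c => -f b c) :=
  ContDiffOn.neg hf

lemma SmoothOn.add {f f' : 𝕜 → 𝕜 → 𝕜} (hf : SmoothOn Ω f) (hf' : SmoothOn Ω f') :
    SmoothOn Ω (fun b c => f b c + f' b c) :=
  ContDiffOn.add hf hf'

lemma SmoothOn.sub {f f' : 𝕜 → 𝕜 → 𝕜} (hf : SmoothOn Ω f) (hf' : SmoothOn Ω f') :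
    SmoothOn Ω (fun b c => f b c - f' b c) :=
  ContDiffOn.sub hf hf'

lemma SmoothOn.mul {f f' : 𝕜 → 𝕜 → 𝕜} (hf : SmoothOn Ω f) (hf' : SmoothOn Ω f') :
    SmoothOn Ω (fun b c => f b c * f' b c) :=
  ContDiffOn.mul hf hf'

lemma SmoothOn.pow {f : 𝕜 → 𝕜 → 𝕜} (hf : SmoothOn Ω f) (n : ℕ) :
    SmoothOn Ω (fun b c => f b c ^ n) :=
  ContDiffOn.pow hf n

lemma smoothOn_const (a : 𝕜) : SmoothOn Ω (fun _ _ => a) := contDiffOn_const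

lemma SmoothOn.logB (hg : SmoothOn Ω g) (hΩ : IsOpen Ω) (h0 : ∀ b c, (b, c) ∈ Ω → g b c ≠ 0) :
    SmoothOn Ω (logB g) :=
  ContDiffOn.div (hg.smoothOn_pb hΩ) hg fun x hx => h0 x.1 x.2 hx

lemma SmoothOn.negLogDerivTwo (hg : SmoothOn Ω g) (hΩ : IsOpen Ω)
    (h0 : ∀ b c, (b, c) ∈ Ω → g b c ≠ 0) : SmoothOn Ω (negLogDerivTwo g) :=
  ((hg.logB hΩ h0).smoothOn_pb hΩ).neg

/-- The data of a smooth nowhere vanishing solution of `g_c = (g_bb - h g) / 4` on an open set: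
`w = g_b / g`, `v = -w_b`, `p = v_b`, `r = p_b`. -/
structure HeatJet (Ω : Set (𝕜 × 𝕜)) (g w v p r : 𝕜 → 𝕜 → 𝕜) (h : 𝕜 → 𝕜) : Prop where
  isOpen : IsOpen Ω
  ne : ∀ b c, (b, c) ∈ Ω → g b c ≠ 0
  smooth : SmoothOn Ω g
  smooth_w : SmoothOn Ω w
  smooth_v : SmoothOn Ω v
  smooth_p : SmoothOn Ω p
  smooth_r : SmoothOn Ω r
  gb : ∀ b c, (b, c) ∈ Ω → HasDerivAt (fun t => g t c) (g b c * w b c) b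
  wb : ∀ b c, (b, c) ∈ Ω → HasDerivAt (fun t => w t c) (-v b c) b
  vb : ∀ b c, (b, c) ∈ Ω → HasDerivAt (fun t => v t c) (p b c) b
  pb : ∀ b c, (b, c) ∈ Ω → HasDerivAt (fun t => p t c) (r b c) b
  gc : ∀ b c, (b, c) ∈ Ω →
    HasDerivAt (fun t => g b t) (g b c * (w b c ^ 2 - v b c - h c) / 4) c

lemma SmoothOn.hasDerivAt_logB (hg : SmoothOn Ω g) (hΩ : IsOpen Ω)
    (h0 : ∀ b c, (b, c) ∈ Ω → g b c ≠ 0) (h : (b, c) ∈ Ω) :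
    HasDerivAt (fun t => SecondOrderLagrangian.logB g t c)
      (-SecondOrderLagrangian.negLogDerivTwo g b c) b := by
  rw [negLogDerivTwo_eq, neg_neg]
  exact (hg.logB hΩ h0).hasDerivAt_fst hΩ h

lemma SmoothOn.hasDerivAt_mul_logB (hg : SmoothOn Ω g) (hΩ : IsOpen Ω)
    (h0 : ∀ b c, (b, c) ∈ Ω → g b c ≠ 0) (h : (b, c) ∈ Ω) :
    HasDerivAt (fun t => g t c) (g b c * SecondOrderLagrangian.logB g b c) b := by
  have := hg.hasDerivAt_fst hΩ h
  rwa [SecondOrderLagrangian.logB, mul_div_cancel₀ _ (h0 b c h)]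

lemma SmoothOn.pb_pb (hg : SmoothOn Ω g) (hΩ : IsOpen Ω)
    (h0 : ∀ b c, (b, c) ∈ Ω → g b c ≠ 0) (h : (b, c) ∈ Ω) :
    pb (pb g) b c = g b c * (SecondOrderLagrangian.logB g b c ^ 2 -
      SecondOrderLagrangian.negLogDerivTwo g b c) := by
  have h1 := (hg.hasDerivAt_mul_logB hΩ h0 h).mul (hg.hasDerivAt_logB hΩ h0 h)
  have h2 : (fun t => pb g t c) =ᶠ[𝓝 b]
      (fun t => g t c) * fun t => SecondOrderLagrangian.logB g t c := by
    filter_upwards [eventually_slice_fst hΩ h] with t ht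
    simp [SecondOrderLagrangian.logB, mul_div_cancel₀ _ (h0 t c ht)]
  rw [SecondOrderLagrangian.pb, h2.deriv_eq, h1.deriv]
  ring

lemma iteratedDeriv_two_slice (g : 𝕜 → 𝕜 → 𝕜) (b c : 𝕜) :
    iteratedDeriv 2 (fun t => g t c) b = pb (pb g) b c := by
  rw [iteratedDeriv_succ, iteratedDeriv_one]
  rfl

lemma SmoothOn.heatJet (hg : SmoothOn Ω g) (hΩ : IsOpen Ω) {h : 𝕜 → 𝕜}
    (h0 : ∀ b c, (b, c) ∈ Ω → g b c ≠ 0)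
    (heat : ∀ b c, (b, c) ∈ Ω → pc g b c = 1 / 4 * (pb (pb g) b c - h c * g b c)) :
    HeatJet Ω g (SecondOrderLagrangian.logB g) (SecondOrderLagrangian.negLogDerivTwo g)
      (pb (SecondOrderLagrangian.negLogDerivTwo g))
      (pb (pb (SecondOrderLagrangian.negLogDerivTwo g))) h where
  isOpen := hΩ
  ne := h0
  smooth := hg
  smooth_w := hg.logB hΩ h0
  smooth_v := hg.negLogDerivTwo hΩ h0
  smooth_p := (hg.negLogDerivTwo hΩ h0).smoothOn_pb hΩ
  smooth_r := ((hg.negLogDerivTwo hΩ h0).smoothOn_pb hΩ).smoothOn_pb hΩ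
  gb _ _ hx := hg.hasDerivAt_mul_logB hΩ h0 hx
  wb _ _ hx := hg.hasDerivAt_logB hΩ h0 hx
  vb _ _ hx := (hg.negLogDerivTwo hΩ h0).hasDerivAt_fst hΩ hx
  pb _ _ hx := ((hg.negLogDerivTwo hΩ h0).smoothOn_pb hΩ).hasDerivAt_fst hΩ hx
  gc b c hx := by
    have := hg.hasDerivAt_snd hΩ hx
    rw [heat b c hx, hg.pb_pb hΩ h0 hx] at this
    exact this.congr_deriv (by ring)

namespace HeatJet

variable {w v p r : 𝕜 → 𝕜 → 𝕜} {h : 𝕜 → 𝕜} (J : HeatJet Ω g w v p r h)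
include J

/-- Equality of mixed derivatives of `g`, `w` and `v` in turn expresses the `c`-derivatives of `w`,
`v` and `p` through `b`-derivatives. Here `w` is recovered as `(g w) / g`, which needs `g ≠ 0`. -/
lemma wc (hx : (b, c) ∈ Ω) :
    HasDerivAt (fun t => w b t) ((-p b c - 2 * w b c * v b c) / 4) c := by
  have h1 := J.smooth.mixed J.isOpen J.gb J.gc hx
    (((J.gb b c hx).mul ((((J.wb b c hx).pow 2).sub (J.vb b c hx)).sub_const (h c))).div_const 4)
  have h2 := h1.div (J.gc b c hx) (J.ne b c hx)
  have hne := J.ne b c hx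
  have h3 : (fun t => w b t) =ᶠ[𝓝 c] (fun t => g b t * w b t) / fun t => g b t := by
    filter_upwards [eventually_slice_snd J.isOpen hx] with t ht
    simp [mul_div_cancel_left₀ _ (J.ne b t ht)]
  refine (h2.congr_of_eventuallyEq h3).congr_deriv ?_
  simp only [Pi.sub_apply, Pi.pow_apply]
  field_simp
  push_cast
  ring

lemma vc (hx : (b, c) ∈ Ω) :
    HasDerivAt (fun t => v b t) ((r b c - 2 * v b c ^ 2 + 2 * w b c * p b c) / 4) c := by
  have h1 := J.smooth_w.mixed J.isOpen J.wb (fun b c hx => J.wc hx) hx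
    (((J.pb b c hx).neg.sub (((J.wb b c hx).const_mul 2).mul (J.vb b c hx))).div_const 4)
  have h3 : (fun t => v b t) = -fun t => -v b t := by ext; simp
  rw [h3]
  exact h1.neg.congr_deriv (by ring)

lemma pc (hx : (b, c) ∈ Ω) {s : 𝕜} (hs : HasDerivAt (fun t => r t c) s b) :
    HasDerivAt (fun t => p b t) ((s - 6 * v b c * p b c + 2 * w b c * r b c) / 4) c := by
  have h1 := J.smooth_v.mixed J.isOpen J.vb (fun b c hx => J.vc hx) hx
    (((hs.sub (((J.vb b c hx).pow 2).const_mul 2)).add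
      (((J.wb b c hx).const_mul 2).mul (J.pb b c hx))).div_const 4)
  exact h1.congr_deriv (by push_cast; ring)

end HeatJet

end Jets

/-! ### The second order equation for `v` and its first integral -/

section Jets

open Filter Topology

variable {𝕜 : Type*} [RCLike 𝕜] {Ω : Set (𝕜 × 𝕜)}

namespace HeatJet

variable {b c : 𝕜} {g w v p r : 𝕜 → 𝕜 → 𝕜} {h h₁ h₂ : 𝕜 → 𝕜} (J : HeatJet Ω g w v p r h)
include J

/-- The `c`-derivative of `p² - 4v³ - 4hv² - 8h'v`. -/
lemma hasDerivAt_cubic (hr : ∀ b c, (b, c) ∈ Ω → r b c = 6 * v b c ^ 2 + 4 * h c * v b c + 4 * h₁ c)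
    (hx : (b, c) ∈ Ω) (hh : HasDerivAt h (h₁ c) c) (hh₁ : HasDerivAt h₁ (h₂ c) c) :
    HasDerivAt (fun t => p b t ^ 2 - 4 * v b t ^ 3 - 4 * h t * v b t ^ 2 - 8 * h₁ t * v b t)
      ((3 * (p b c ^ 2 - 4 * v b c ^ 3 - 4 * h c * v b c ^ 2 - 8 * h₁ c * v b c) - 8 * h₂ c) * v b c
        + 2 * h c * (p b c ^ 2 - 4 * v b c ^ 3 - 4 * h c * v b c ^ 2 - 8 * h₁ c * v b c)
        - 8 * h₁ c ^ 2) c := by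
  have hs : HasDerivAt (fun t => r t c) ((12 * v b c + 4 * h c) * p b c) b := by
    have h1 := ((((J.vb b c hx).pow 2).const_mul 6).add
      ((J.vb b c hx).const_mul (4 * h c))).add_const (4 * h₁ c)
    refine (h1.congr_of_eventuallyEq ?_).congr_deriv (by ring)
    filter_upwards [eventually_slice_fst J.isOpen hx] with t ht using by simp [hr t c ht]
  have hv := J.vc hx
  have h1 := ((((J.pc hx hs).pow 2).sub ((hv.pow 3).const_mul 4)).sub
    ((hh.const_mul 4).mul (hv.pow 2))).sub ((hh₁.const_mul 8).mul hv)
  refine h1.congr_deriv ?_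
  simp only [hr b c hx, Pi.pow_apply]
  push_cast
  ring

lemma smoothOn_cubic (hsh : SmoothOn Ω fun _ c => h c) (hsh₁ : SmoothOn Ω fun _ c => h₁ c) :
    SmoothOn Ω fun b t => p b t ^ 2 - 4 * v b t ^ 3 - 4 * h t * v b t ^ 2 - 8 * h₁ t * v b t :=
  (((J.smooth_p.pow 2).sub ((smoothOn_const 4).mul (J.smooth_v.pow 3))).sub
    (((smoothOn_const 4).mul hsh).mul (J.smooth_v.pow 2))).sub
      (((smoothOn_const 8).mul hsh₁).mul J.smooth_v)

/-- The first integral of `v_bb = 6v² + 4hv + 4h'` determined by the heat equation. -/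
lemma sq_eq_of_second_order
    (hr : ∀ b c, (b, c) ∈ Ω → r b c = 6 * v b c ^ 2 + 4 * h c * v b c + 4 * h₁ c)
    (hh : ∀ b c, (b, c) ∈ Ω → HasDerivAt h (h₁ c) c)
    (hh₁ : ∀ b c, (b, c) ∈ Ω → HasDerivAt h₁ (h₂ c) c)
    (hsh : SmoothOn Ω fun _ c => h c) (hsh₁ : SmoothOn Ω fun _ c => h₁ c)
    (hsh₂ : SmoothOn Ω fun _ c => h₂ c) (hx : (b, c) ∈ Ω) :
    p b c ^ 2 = 4 * v b c ^ 3 + 4 * h c * v b c ^ 2 + 8 * h₁ c * v b c + 8 / 3 * h₂ c := by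
  have hm := J.smoothOn_cubic hsh hsh₁
  have hmb : ∀ b c, (b, c) ∈ Ω → HasDerivAt
      (fun t => p t c ^ 2 - 4 * v t c ^ 3 - 4 * h c * v t c ^ 2 - 8 * h₁ c * v t c) 0 b := by
    intro b c hx
    have h1 := ((((J.pb b c hx).pow 2).sub (((J.vb b c hx).pow 3).const_mul 4)).sub
      (((J.vb b c hx).pow 2).const_mul (4 * h c))).sub ((J.vb b c hx).const_mul (8 * h₁ c))
    refine h1.congr_deriv ?_
    rw [hr b c hx]
    push_cast
    ring
  -- Write `m` for `p² - 4v³ - 4hv² - 8h'v`. As `m_b = 0`, also `(m_c)_b = p (3m - 8h'')` vanishes,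
  -- so the second factor is zero unless `p` is zero near the point.
  have key : (fun x : 𝕜 × 𝕜 => 3 * (p x.1 x.2 ^ 2 - 4 * v x.1 x.2 ^ 3 - 4 * h x.2 * v x.1 x.2 ^ 2
      - 8 * h₁ x.2 * v x.1 x.2) - 8 * h₂ x.2) (b, c) = 0 := by
    refine eq_zero_of_mul_eq_zero (p := fun x : 𝕜 × 𝕜 => p x.1 x.2) J.isOpen
      (((smoothOn_const 3).mul hm).sub ((smoothOn_const 8).mul hsh₂)).continuousOn ?_ ?_ hx
    · rintro ⟨b, c⟩ hx
      have h1 := ((((hmb b c hx).const_mul 3).sub_const (8 * h₂ c)).mul (J.vb b c hx)).add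
        (((hmb b c hx).const_mul (2 * h c)).sub_const (8 * h₁ c ^ 2))
      have h2 := hm.mixed J.isOpen hmb (fun b c hx => J.hasDerivAt_cubic hr hx (hh b c hx)
        (hh₁ b c hx)) hx (h1.congr_of_eventuallyEq (Eventually.of_forall fun t => by
          simp only [Pi.add_apply, Pi.mul_apply]; ring))
      have h3 := h2.unique (hasDerivAt_const c (0 : 𝕜))
      simp only at h3 ⊢
      linear_combination h3
    -- If `p` vanishes near the point, so does `r = p_b`, that is `6v² + 4hv + 4h' = 0`.
    -- Differentiating this in `c` with `v_c = -v²/2` gives `3m = 8h''` here too.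
    · rintro ⟨b, c⟩ hx hp
      have hp' := hp.self_of_nhds
      have hrz : ∀ᶠ y in 𝓝 (b, c), r y.1 y.2 = 0 := by
        filter_upwards [hp.eventually_nhds, J.isOpen.mem_nhds hx] with y hy hy'
        refine (J.pb y.1 y.2 hy').unique ((hasDerivAt_const y.1 (0 : 𝕜)).congr_of_eventuallyEq ?_)
        exact (Continuous.prodMk_left y.2).continuousAt.eventually hy
      have hr0 := hrz.self_of_nhds
      have e1 : ∀ᶠ t in 𝓝 c, 6 * v b t ^ 2 + 4 * h t * v b t + 4 * h₁ t = 0 := by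
        filter_upwards [(Continuous.prodMk_right b).continuousAt.eventually hrz,
          eventually_slice_snd J.isOpen hx] with t ht ht'
        rw [← hr b t ht']
        exact ht
      have hv := J.vc hx
      have h1 := ((((hv.pow 2).const_mul 6).add (((hh b c hx).const_mul 4).mul hv)).add
        ((hh₁ b c hx).const_mul 4)).unique
          ((hasDerivAt_const c (0 : 𝕜)).congr_of_eventuallyEq e1)
      have h2 := e1.self_of_nhds
      simp only at hp' hr0 h1 h2 ⊢
      rw [hp', hr0] at h1
      rw [hp']
      push_cast at h1
      linear_combination (-2) * h1 - 4 * v b c * h2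
  simp only at key
  linear_combination key / 3

/-- The second order equation follows from the first order one and the Chazy equation. -/
lemma second_order_of_sq_eq
    (hp : ∀ b c, (b, c) ∈ Ω → p b c ^ 2 =
      4 * v b c ^ 3 + 4 * h c * v b c ^ 2 + 8 * h₁ c * v b c + 8 / 3 * h₂ c)
    (hh : ∀ b c, (b, c) ∈ Ω → HasDerivAt h (h₁ c) c)
    (hh₁ : ∀ b c, (b, c) ∈ Ω → HasDerivAt h₁ (h₂ c) c)
    (hh₂ : ∀ b c, (b, c) ∈ Ω → HasDerivAt h₂ (2 * h c * h₂ c - 3 * h₁ c ^ 2) c)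
    (hsh : SmoothOn Ω fun _ c => h c) (hsh₁ : SmoothOn Ω fun _ c => h₁ c) (hx : (b, c) ∈ Ω) :
    r b c = 6 * v b c ^ 2 + 4 * h c * v b c + 4 * h₁ c := by
  have hsm : SmoothOn Ω fun b c => r b c - (6 * v b c ^ 2 + 4 * h c * v b c + 4 * h₁ c) :=
    J.smooth_r.sub ((((smoothOn_const 6).mul (J.smooth_v.pow 2)).add
      (((smoothOn_const 4).mul hsh).mul J.smooth_v)).add ((smoothOn_const 4).mul hsh₁))
  rw [← sub_eq_zero]
  refine eq_zero_of_mul_eq_zero (p := fun x : 𝕜 × 𝕜 => p x.1 x.2) (x := (b, c)) J.isOpen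
    hsm.continuousOn ?_ ?_ hx
  -- The `b`-derivative of the cubic equation is `p (r - 6v² - 4hv - 4h') = 0` up to a factor 2.
  · rintro ⟨b, c⟩ hx
    have hv := J.vb b c hx
    have h1 := ((((hv.pow 3).const_mul 4).add ((hv.pow 2).const_mul (4 * h c))).add
      (hv.const_mul (8 * h₁ c))).add_const (8 / 3 * h₂ c)
    have h2 := ((J.pb b c hx).pow 2).unique (h1.congr_of_eventuallyEq (by
      filter_upwards [eventually_slice_fst J.isOpen hx] with t ht using by simp [hp t c ht]))
    push_cast at h2
    simp only at h2 ⊢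
    linear_combination h2 / 2
  -- If `p` vanishes near the point, then `v_c = -v²/2`, and the `c`-derivative of the cubic,
  -- simplified by the Chazy equation and by the cubic itself, is `-(6v² + 4hv + 4h')² / 2`. It is
  -- zero, so the base of the square is zero.
  · rintro ⟨b, c⟩ hx h0
    have hr0 : r b c = 0 := (J.pb b c hx).unique ((hasDerivAt_const b (0 : 𝕜)).congr_of_eventuallyEq
      ((Continuous.prodMk_left c).continuousAt.eventually h0))
    have hp0 : p b c = 0 := h0.self_of_nhds
    have hv := J.vc hx
    have h1 := ((((hv.pow 3).const_mul 4).add (((hh b c hx).const_mul 4).mul (hv.pow 2))).add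
      (((hh₁ b c hx).const_mul 8).mul hv)).add ((hh₂ b c hx).const_mul (8 / 3))
    have h2 := h1.unique ((hasDerivAt_const c (0 : 𝕜)).congr_of_eventuallyEq (by
      filter_upwards [(Continuous.prodMk_right b).continuousAt.eventually h0,
        eventually_slice_snd J.isOpen hx] with t ht ht'
      have h3 := hp b t ht'
      rw [show p b t = 0 from ht] at h3
      simp only [Pi.add_apply, Pi.mul_apply, Pi.pow_apply]
      linear_combination -h3))
    have h3 := hp b c hx
    rw [hp0] at h3
    rw [hr0, hp0] at h2
    simp only [hr0, Pi.pow_apply] at h2 ⊢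
    push_cast at h2
    have h4 : (6 * v b c ^ 2 + 4 * h c * v b c + 4 * h₁ c) ^ 2 = 0 := by
      linear_combination (-2) * h2 + (-2) * (3 * v b c + 2 * h c) * h3
    rw [pow_eq_zero_iff (by norm_num)] at h4
    rw [h4, sub_zero]

end HeatJet

end Jets

/-! ### The integrability conditions of `e^a g` as equations for `g` -/

section Reduction

open Filter Topology

variable {𝕜 : Type*} [RCLike 𝕜]

lemma normedSpace_exp_ne_zero (a : 𝕜) : NormedSpace.exp a ≠ 0 := by
  let _ : NormedAlgebra ℚ 𝕜 := NormedAlgebra.restrictScalars ℚ ℝ 𝕜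
  exact (NormedSpace.isUnit_exp a).ne_zero

/-- The integrability conditions of `e^a g(b, c)`, written for `g`. -/
structure ExpIntegrableAt (g : 𝕜 → 𝕜 → 𝕜) (b c : 𝕜) : Prop where
  cond₁ : 2 * (pb g * pc (pc g) - pc g * pc (pb g)) b c = pc (pc (pb g) * g - pb g * pc g) b c
  cond₂ : 2 * (g * pc (pc g) - pc g ^ 2) b c = pc (g * pb (pb g) - pb g ^ 2) b c
  cond₃ : pc (g * pc (pc g) - pc g ^ 2) b c = 2 * (pc (pc g) * pb (pb g) - pc (pb g) ^ 2) b c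
  cond₄ : pb (pb (pb g) * pc (pc g) - pc (pb g) ^ 2) b c =
    2 * pc (pb g * pc (pc g) - pc g * pc (pb g)) b c
  cond₅ : pb (pb (pb g) * g - pb g ^ 2) b c = 4 * (pc (pb g) * g - pc g * pb g) b c

/-- The function `e^{2a} g(b, c)`. -/
def expSqDensity (g : 𝕜 → 𝕜 → 𝕜) (a b c : 𝕜) : 𝕜 := NormedSpace.exp a ^ 2 * g b c

lemma dA_expDensity (g : 𝕜 → 𝕜 → 𝕜) : dA (expDensity g) = expDensity g := by
  ext a b c
  exact ((hasDerivAt_exp (x := a)).mul_const (g b c)).deriv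

lemma dB_expDensity (g : 𝕜 → 𝕜 → 𝕜) : dB (expDensity g) = expDensity (pb g) := by
  ext a b c
  exact deriv_const_mul_field _

lemma dC_expDensity (g : 𝕜 → 𝕜 → 𝕜) : dC (expDensity g) = expDensity (pc g) := by
  ext a b c
  exact deriv_const_mul_field _

lemma dA_expSqDensity (g : 𝕜 → 𝕜 → 𝕜) : dA (expSqDensity g) = expSqDensity (2 * g) := by
  ext a b c
  refine (((hasDerivAt_exp (x := a)).pow 2).mul_const (g b c)).deriv.trans ?_
  simp only [expSqDensity, Pi.mul_apply, Pi.ofNat_apply]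
  push_cast
  ring

lemma dB_expSqDensity (g : 𝕜 → 𝕜 → 𝕜) : dB (expSqDensity g) = expSqDensity (pb g) := by
  ext a b c
  exact deriv_const_mul_field _

lemma dC_expSqDensity (g : 𝕜 → 𝕜 → 𝕜) : dC (expSqDensity g) = expSqDensity (pc g) := by
  ext a b c
  exact deriv_const_mul_field _

lemma expDensity_mul_expDensity (g g' : 𝕜 → 𝕜 → 𝕜) :
    expDensity g * expDensity g' = expSqDensity (g * g') := by
  ext a b c
  simp only [expDensity, expSqDensity, Pi.mul_apply]
  ring

lemma expDensity_sq (g : 𝕜 → 𝕜 → 𝕜) : expDensity g ^ 2 = expSqDensity (g ^ 2) := by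
  rw [sq, sq, expDensity_mul_expDensity]

lemma expSqDensity_sub (g g' : 𝕜 → 𝕜 → 𝕜) :
    expSqDensity g - expSqDensity g' = expSqDensity (g - g') := by
  ext a b c
  simp only [expSqDensity, Pi.sub_apply]
  ring

lemma expSqDensity_eq_iff (g g' : 𝕜 → 𝕜 → 𝕜) (k : 𝕜) (a b c : 𝕜) :
    expSqDensity g a b c = k * expSqDensity g' a b c ↔ g b c = k * g' b c := by
  have h : NormedSpace.exp a ^ 2 ≠ 0 := pow_ne_zero _ (normedSpace_exp_ne_zero a)
  simp only [expSqDensity]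
  rw [mul_left_comm, mul_right_inj' h]

lemma expSqDensity_eq_iff' (g g' : 𝕜 → 𝕜 → 𝕜) (a b c : 𝕜) :
    expSqDensity g a b c = expSqDensity g' a b c ↔ g b c = g' b c := by
  simpa using expSqDensity_eq_iff g g' 1 a b c

/-- `∂_a` fixes `e^a g` and doubles the quadratic expressions, which carry `e^{2a}`; this factor
never vanishes and cancels. The constant 4 of the fifth condition is the given 2 times the 2 from
`∂_a`. -/
lemma integrableDensity_expDensity_iff (g : 𝕜 → 𝕜 → 𝕜) (B C : Set 𝕜) :
    IntegrableDensity (Set.univ ×ˢ B ×ˢ C) (expDensity g) ↔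
      ∀ b ∈ B, ∀ c ∈ C, ExpIntegrableAt g b c := by
  have e : ∀ a b c, (a, b, c) ∈ (Set.univ : Set 𝕜) ×ˢ B ×ˢ C ↔ b ∈ B ∧ c ∈ C := by simp
  constructor
  · rintro ⟨h1, h2, h3, h4, h5⟩ b hb c hc
    have hU := (e 0 b c).2 ⟨hb, hc⟩
    replace h1 := h1 0 b c hU
    replace h2 := h2 0 b c hU
    replace h3 := h3 0 b c hU
    replace h4 := h4 0 b c hU
    replace h5 := h5 0 b c hU
    simp only [dA_expDensity, dB_expDensity, dC_expDensity, expDensity_mul_expDensity,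
      expDensity_sq, expSqDensity_sub, dA_expSqDensity, dB_expSqDensity, dC_expSqDensity,
      expSqDensity_eq_iff, expSqDensity_eq_iff'] at h1 h2 h3 h4 h5
    refine ⟨h1, h2, h3, h4, h5.trans ?_⟩
    simp only [Pi.mul_apply, Pi.sub_apply, Pi.ofNat_apply]
    ring
  · intro H
    refine ⟨fun a b c hU => ?_, fun a b c hU => ?_, fun a b c hU => ?_, fun a b c hU => ?_,
      fun a b c hU => ?_⟩ <;>
    · obtain ⟨hb, hc⟩ := (e a b c).1 hU
      obtain ⟨h1, h2, h3, h4, h5⟩ := H b hb c hc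
      simp only [dA_expDensity, dB_expDensity, dC_expDensity, expDensity_mul_expDensity,
        expDensity_sq, expSqDensity_sub, dA_expSqDensity, dB_expSqDensity, dC_expSqDensity,
        expSqDensity_eq_iff, expSqDensity_eq_iff']
      first
        | exact h1
        | exact h2
        | exact h3
        | exact h4
        | (refine h5.trans ?_
           simp only [Pi.mul_apply, Pi.sub_apply, Pi.ofNat_apply]
           ring)

variable {Ω : Set (𝕜 × 𝕜)} {g : 𝕜 → 𝕜 → 𝕜}

/-- The integrability conditions extend from a dense subset by continuity. -/
lemma expIntegrableAt_of_dense (hg : SmoothOn Ω g) (hΩ : IsOpen Ω) {D : Set (𝕜 × 𝕜)}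
    (hD : Ω ⊆ closure (Ω ∩ D)) (H : ∀ b c, (b, c) ∈ Ω → (b, c) ∈ D → ExpIntegrableAt g b c)
    {b c : 𝕜} (hx : (b, c) ∈ Ω) : ExpIntegrableAt g b c := by
  have key : ∀ f f' : 𝕜 → 𝕜 → 𝕜, SmoothOn Ω f → SmoothOn Ω f' →
      (∀ b c, (b, c) ∈ Ω → (b, c) ∈ D → f b c = f' b c) → f b c = f' b c := by
    intro f f' hf hf' h
    have hm : (b, c) ∈ closure (Ω ∩ D) := hD hx
    have : (𝓝[Ω ∩ D] (b, c)).NeBot := mem_closure_iff_nhdsWithin_neBot.1 hm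
    have h1 := ((hf.continuousOn (b, c) hx).mono (Set.inter_subset_left (t := D))).tendsto
    have h2 := ((hf'.continuousOn (b, c) hx).mono (Set.inter_subset_left (t := D))).tendsto
    refine tendsto_nhds_unique (h1.congr' ?_) h2
    filter_upwards [self_mem_nhdsWithin] with x hx using h x.1 x.2 hx.1 hx.2
  have gb := hg.smoothOn_pb hΩ
  have gc := hg.smoothOn_pc hΩ
  have gbb := gb.smoothOn_pb hΩ
  have gbc := gb.smoothOn_pc hΩ
  have gcc := gc.smoothOn_pc hΩ
  have s2 : SmoothOn Ω fun _ _ => (2 : 𝕜) := smoothOn_const 2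
  have s4 : SmoothOn Ω fun _ _ => (4 : 𝕜) := smoothOn_const 4
  refine ⟨?_, ?_, ?_, ?_, ?_⟩
  · exact key _ _ (s2.mul ((gb.mul gcc).sub (gc.mul gbc)))
      (((gbc.mul hg).sub (gb.mul gc)).smoothOn_pc hΩ) fun b c h h' => (H b c h h').cond₁
  · exact key _ _ (s2.mul ((hg.mul gcc).sub (gc.pow 2)))
      (((hg.mul gbb).sub (gb.pow 2)).smoothOn_pc hΩ) fun b c h h' => (H b c h h').cond₂
  · exact key _ _ (((hg.mul gcc).sub (gc.pow 2)).smoothOn_pc hΩ)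
      (s2.mul ((gcc.mul gbb).sub (gbc.pow 2))) fun b c h h' => (H b c h h').cond₃
  · exact key _ _ (((gbb.mul gcc).sub (gbc.pow 2)).smoothOn_pb hΩ)
      (s2.mul (((gb.mul gcc).sub (gc.mul gbc)).smoothOn_pc hΩ)) fun b c h h' => (H b c h h').cond₄
  · exact key _ _ (((gbb.mul hg).sub (gb.pow 2)).smoothOn_pb hΩ)
      (s4.mul ((gbc.mul hg).sub (gc.mul gb))) fun b c h h' => (H b c h h').cond₅

end Reduction

/-! ### Equivalence of the integrability conditions with the reduced system -/

section Reduction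

open Filter Topology

variable {𝕜 : Type*} [RCLike 𝕜] {Ω : Set (𝕜 × 𝕜)}

namespace HeatJet

variable {b c : 𝕜} {g w v p r : 𝕜 → 𝕜 → 𝕜} {h h₁ h₂ : 𝕜 → 𝕜} (J : HeatJet Ω g w v p r h)
include J

lemma pb_eq (hx : (b, c) ∈ Ω) : SecondOrderLagrangian.pb g b c = g b c * w b c :=
  (J.gb b c hx).deriv

lemma pc_eq (hx : (b, c) ∈ Ω) :
    SecondOrderLagrangian.pc g b c = g b c * ((w b c ^ 2 - v b c - h c) / 4) :=
  (J.gc b c hx).deriv.trans (by ring)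

lemma pb_pb_eq (hx : (b, c) ∈ Ω) :
    SecondOrderLagrangian.pb (SecondOrderLagrangian.pb g) b c =
      g b c * (w b c ^ 2 - v b c) := by
  have h1 := (J.gb b c hx).mul (J.wb b c hx)
  have h2 : (fun t => SecondOrderLagrangian.pb g t c) =ᶠ[𝓝 b]
      (fun t => g t c) * fun t => w t c := by
    filter_upwards [eventually_slice_fst J.isOpen hx] with t ht using J.pb_eq ht
  rw [SecondOrderLagrangian.pb, h2.deriv_eq, h1.deriv]
  ring

lemma pc_pb_eq (hx : (b, c) ∈ Ω) :
    SecondOrderLagrangian.pc (SecondOrderLagrangian.pb g) b c =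
      g b c * ((w b c ^ 2 - v b c - h c) / 4 * w b c + (-p b c - 2 * w b c * v b c) / 4) := by
  have h1 := (J.gc b c hx).mul (J.wc hx)
  have h2 : (fun t => SecondOrderLagrangian.pb g b t) =ᶠ[𝓝 c]
      (fun t => g b t) * fun t => w b t := by
    filter_upwards [eventually_slice_snd J.isOpen hx] with t ht using J.pb_eq ht
  rw [SecondOrderLagrangian.pc, h2.deriv_eq, h1.deriv]
  ring

lemma pc_pc_eq (hx : (b, c) ∈ Ω) (hh : HasDerivAt h (h₁ c) c) :
    SecondOrderLagrangian.pc (SecondOrderLagrangian.pc g) b c =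
      g b c * (((w b c ^ 2 - v b c - h c) / 4) ^ 2 + (2 * w b c * ((-p b c - 2 * w b c * v b c) / 4)
        - (r b c - 2 * v b c ^ 2 + 2 * w b c * p b c) / 4 - h₁ c) / 4) := by
  have h1 := (J.gc b c hx).mul (((((J.wc hx).pow 2).sub (J.vc hx)).sub hh).div_const 4)
  have h2 : (fun t => SecondOrderLagrangian.pc g b t) =ᶠ[𝓝 c]
      (fun t => g b t) * fun t => (w b t ^ 2 - v b t - h t) / 4 := by
    filter_upwards [eventually_slice_snd J.isOpen hx] with t ht using J.pc_eq ht
  rw [SecondOrderLagrangian.pc, h2.deriv_eq]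
  refine h1.deriv.trans ?_
  simp only [Pi.sub_apply, Pi.pow_apply]
  push_cast
  ring

/-- The second integrability condition amounts to `v_bb = 6v² + 4hv + 4h'`. -/
lemma second_order_of_cond₂ (hx : (b, c) ∈ Ω)
    (hh : HasDerivAt h (h₁ c) c) (H : ExpIntegrableAt g b c) :
    r b c = 6 * v b c ^ 2 + 4 * h c * v b c + 4 * h₁ c := by
  have h1 := ((J.gc b c hx).pow 2).mul (J.vc hx).neg
  have h2 : (fun t => (g * SecondOrderLagrangian.pb (SecondOrderLagrangian.pb g)
      - SecondOrderLagrangian.pb g ^ 2) b t) =ᶠ[𝓝 c]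
      (fun t => g b t) ^ 2 * -fun t => v b t := by
    filter_upwards [eventually_slice_snd J.isOpen hx] with t ht
    simp only [Pi.sub_apply, Pi.mul_apply, Pi.pow_apply, Pi.neg_apply, J.pb_eq ht, J.pb_pb_eq ht]
    ring
  have h3 := H.cond₂
  rw [SecondOrderLagrangian.pc, h2.deriv_eq, h1.deriv] at h3
  simp only [Pi.mul_apply, Pi.sub_apply, Pi.pow_apply, Pi.neg_apply,
    J.pc_eq hx, J.pc_pc_eq hx hh] at h3
  push_cast at h3
  have h4 : g b c ^ 2 * (r b c - (6 * v b c ^ 2 + 4 * h c * v b c + 4 * h₁ c)) = 0 := by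
    linear_combination 8 * h3
  have h5 := (mul_eq_zero.1 h4).resolve_left (pow_ne_zero _ (J.ne b c hx))
  linear_combination h5

/-- The integrability conditions in terms of the second and first order equations for `v`. -/
lemma expIntegrableAt
    (hr : ∀ b c, (b, c) ∈ Ω → r b c = 6 * v b c ^ 2 + 4 * h c * v b c + 4 * h₁ c)
    (hp : ∀ b c, (b, c) ∈ Ω → p b c ^ 2 =
      4 * v b c ^ 3 + 4 * h c * v b c ^ 2 + 8 * h₁ c * v b c + 8 / 3 * h₂ c)
    (hh : ∀ b c, (b, c) ∈ Ω → HasDerivAt h (h₁ c) c)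
    (hh₁ : ∀ b c, (b, c) ∈ Ω → HasDerivAt h₁ (h₂ c) c) (hx : (b, c) ∈ Ω) :
    ExpIntegrableAt g b c := by
  have hs : HasDerivAt (fun t => r t c) ((12 * v b c + 4 * h c) * p b c) b := by
    have h1 := ((((J.vb b c hx).pow 2).const_mul 6).add
      ((J.vb b c hx).const_mul (4 * h c))).add_const (4 * h₁ c)
    refine (h1.congr_of_eventuallyEq ?_).congr_deriv (by ring)
    filter_upwards [eventually_slice_fst J.isOpen hx] with t ht using by simp [hr t c ht]
  have hg := J.gc b c hx
  have hw := J.wc hx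
  have hv := J.vc hx
  have hpc := J.pc hx hs
  have gb := J.gb b c hx
  have wb := J.wb b c hx
  have vb := J.vb b c hx
  have pb := J.pb b c hx
  have hh' := hh b c hx
  have hh₁' := hh₁ b c hx
  have evb := eventually_slice_fst J.isOpen hx
  have evc := eventually_slice_snd J.isOpen hx
  have er := hr b c hx
  have ep := hp b c hx
  have dW := ((hpc.neg.sub ((hw.const_mul 2).mul hv)).div_const 4)
  have dA := ((((hw.mul hpc).neg.sub ((hw.pow 2).mul hv)).sub (hv.pow 2)).sub (hh'.mul hv)).sub
    (hh₁'.const_mul 2)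
  have dA' := ((((wb.mul pb).neg.sub ((wb.pow 2).mul vb)).sub (vb.pow 2)).sub
    (vb.const_mul (h c))).sub_const (2 * h₁ c)
  have d0 := ((hw.pow 2).sub hv).sub hh'
  have d0' := ((wb.pow 2).sub vb).sub_const (h c)
  -- Every minor below is `g²` times a polynomial in `w, v, p, h, h'` once `v_bb` is eliminated. The
  -- fifth condition then follows from the heat equation alone, the first and second need also the
  -- equation for `v_bb`, and only the third and fourth need the cubic equation `ep`.
  refine ⟨?_, ?_, ?_, ?_, ?_⟩
  · have h2 : (fun t => (SecondOrderLagrangian.pc (SecondOrderLagrangian.pb g) * g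
        - SecondOrderLagrangian.pb g * SecondOrderLagrangian.pc g) b t) =ᶠ[𝓝 c]
        (fun t => g b t) ^ 2 * fun t => (-p b t - 2 * w b t * v b t) / 4 := by
      filter_upwards [evc] with t ht
      simp only [Pi.sub_apply, Pi.mul_apply, Pi.pow_apply, J.pb_eq ht, J.pc_eq ht, J.pc_pb_eq ht]
      ring
    rw [SecondOrderLagrangian.pc, h2.deriv_eq]
    refine Eq.trans ?_ ((hg.pow 2).mul dW).deriv.symm
    simp only [Pi.mul_apply, Pi.sub_apply, Pi.pow_apply, Pi.neg_apply,
      J.pc_eq hx, J.pb_eq hx, J.pc_pc_eq hx hh', J.pc_pb_eq hx, er]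
    push_cast
    ring
  · have h2 : (fun t => (g * SecondOrderLagrangian.pb (SecondOrderLagrangian.pb g)
        - SecondOrderLagrangian.pb g ^ 2) b t) =ᶠ[𝓝 c]
        (fun t => g b t) ^ 2 * -fun t => v b t := by
      filter_upwards [evc] with t ht
      simp only [Pi.sub_apply, Pi.mul_apply, Pi.pow_apply, Pi.neg_apply, J.pb_eq ht, J.pb_pb_eq ht]
      ring
    rw [SecondOrderLagrangian.pc, h2.deriv_eq, ((hg.pow 2).mul hv.neg).deriv]
    simp only [Pi.mul_apply, Pi.sub_apply, Pi.pow_apply, Pi.neg_apply,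
      J.pc_eq hx, J.pc_pc_eq hx hh', er]
    push_cast
    ring
  · have h2 : (fun t => (g * SecondOrderLagrangian.pc (SecondOrderLagrangian.pc g)
        - SecondOrderLagrangian.pc g ^ 2) b t) =ᶠ[𝓝 c]
        (fun t => g b t) ^ 2 * fun t => (-(w b t * p b t) - w b t ^ 2 * v b t - v b t ^ 2
          - h t * v b t - 2 * h₁ t) / 4 := by
      filter_upwards [evc] with t ht
      simp only [Pi.sub_apply, Pi.mul_apply, Pi.pow_apply, J.pc_eq ht,
        J.pc_pc_eq ht (hh b t ht), hr b t ht]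
      ring
    rw [SecondOrderLagrangian.pc, h2.deriv_eq]
    refine ((hg.pow 2).mul (dA.div_const 4)).deriv.trans ?_
    simp only [Pi.mul_apply, Pi.sub_apply, Pi.pow_apply, Pi.neg_apply,
      J.pc_pb_eq hx, J.pb_pb_eq hx, J.pc_pc_eq hx hh', er]
    push_cast
    linear_combination (3 / 16 * g b c ^ 2) * ep
  · have h1 : (fun t => (SecondOrderLagrangian.pb (SecondOrderLagrangian.pb g) *
        SecondOrderLagrangian.pc (SecondOrderLagrangian.pc g) -
        SecondOrderLagrangian.pc (SecondOrderLagrangian.pb g) ^ 2) t c) =ᶠ[𝓝 b]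
        (fun t => g t c) ^ 2 * (((fun t => w t c) ^ 2 - fun t => v t c) *
          ((fun t => (w t c ^ 2 - v t c - h c) / 4) ^ 2 + fun t => (-(w t c * p t c)
            - w t c ^ 2 * v t c - v t c ^ 2 - h c * v t c - 2 * h₁ c) / 4)
          - (((fun t => (w t c ^ 2 - v t c - h c) / 4) * fun t => w t c) +
            fun t => (-p t c - 2 * w t c * v t c) / 4) ^ 2) := by
      filter_upwards [evb] with t ht
      simp only [Pi.sub_apply, Pi.mul_apply, Pi.pow_apply, Pi.add_apply, J.pb_pb_eq ht,
        J.pc_pb_eq ht, J.pc_pc_eq ht hh', hr t c ht]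
      ring
    have h2 : (fun t => (SecondOrderLagrangian.pb g *
        SecondOrderLagrangian.pc (SecondOrderLagrangian.pc g) -
        SecondOrderLagrangian.pc g * SecondOrderLagrangian.pc (SecondOrderLagrangian.pb g)) b t)
        =ᶠ[𝓝 c] (fun t => g b t) ^ 2 * ((fun t => w b t) * (fun t => (-(w b t * p b t)
            - w b t ^ 2 * v b t - v b t ^ 2 - h t * v b t - 2 * h₁ t) / 4)
          - (fun t => (w b t ^ 2 - v b t - h t) / 4) *
            fun t => (-p b t - 2 * w b t * v b t) / 4) := by
      filter_upwards [evc] with t ht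
      simp only [Pi.sub_apply, Pi.mul_apply, Pi.pow_apply, J.pb_eq ht, J.pc_eq ht,
        J.pc_pb_eq ht, J.pc_pc_eq ht (hh b t ht), hr b t ht]
      ring
    have e1 := (gb.pow 2).mul ((((wb.pow 2).sub vb).mul (((d0'.div_const 4).pow 2).add
      (dA'.div_const 4))).sub ((((d0'.div_const 4).mul wb).add
        ((pb.neg.sub ((wb.const_mul 2).mul vb)).div_const 4)).pow 2))
    have e2 := (hg.pow 2).mul ((hw.mul (dA.div_const 4)).sub ((d0.div_const 4).mul dW))
    rw [SecondOrderLagrangian.pc, SecondOrderLagrangian.pb, h2.deriv_eq, h1.deriv_eq]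
    refine e1.deriv.trans (Eq.trans ?_ (congrArg (2 * ·) e2.deriv.symm))
    simp only [Pi.mul_apply, Pi.sub_apply, Pi.pow_apply, Pi.neg_apply, Pi.add_apply, er]
    push_cast
    linear_combination (-3 / 8 * g b c ^ 2 * w b c) * ep
  · have h2 : (fun t => (SecondOrderLagrangian.pb (SecondOrderLagrangian.pb g) * g
        - SecondOrderLagrangian.pb g ^ 2) t c) =ᶠ[𝓝 b]
        (fun t => g t c) ^ 2 * -fun t => v t c := by
      filter_upwards [evb] with t ht
      simp only [Pi.sub_apply, Pi.mul_apply, Pi.pow_apply, Pi.neg_apply, J.pb_eq ht, J.pb_pb_eq ht]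
      ring
    rw [SecondOrderLagrangian.pb, h2.deriv_eq, ((gb.pow 2).mul vb.neg).deriv]
    simp only [Pi.mul_apply, Pi.sub_apply, Pi.pow_apply, Pi.neg_apply,
      J.pc_eq hx, J.pb_eq hx, J.pc_pb_eq hx]
    push_cast
    ring

end HeatJet

variable {B C : Set 𝕜} {g : 𝕜 → 𝕜 → 𝕜} {h : 𝕜 → 𝕜}

lemma iteratedDeriv_two (h : 𝕜 → 𝕜) : iteratedDeriv 2 h = deriv (deriv h) := by
  rw [iteratedDeriv_succ, iteratedDeriv_one]

lemma smoothOn_snd (hh : ContDiffOn 𝕜 ∞ h C) : SmoothOn (B ×ˢ C) fun _ c => h c :=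
  hh.comp contDiffOn_snd fun _ hx => hx.2

lemma contDiffOn_deriv (hC : IsOpen C) (hh : ContDiffOn 𝕜 ∞ h C) : ContDiffOn 𝕜 ∞ (deriv h) C :=
  hh.deriv_of_isOpen hC (by simp)

lemma contDiffOn_hasDerivAt (hC : IsOpen C) (hh : ContDiffOn 𝕜 ∞ h C) {c : 𝕜} (hc : c ∈ C) :
    HasDerivAt h (deriv h c) c :=
  ((hh.contDiffAt (hC.mem_nhds hc)).differentiableAt (by simp)).hasDerivAt

lemma chazyAt_iff_hasDerivAt (hC : IsOpen C) (hh : ContDiffOn 𝕜 ∞ h C) {c : 𝕜} (hc : c ∈ C) :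
    ChazyAt h c ↔ HasDerivAt (deriv (deriv h))
      (2 * h c * deriv (deriv h) c - 3 * deriv h c ^ 2) c := by
  have h3 := contDiffOn_hasDerivAt hC (contDiffOn_deriv hC (contDiffOn_deriv hC hh)) hc
  rw [ChazyAt, iteratedDeriv_succ, iteratedDeriv_two]
  exact ⟨fun e => e ▸ h3, fun e => h3.unique e⟩

section

variable (hB : IsOpen B) (hC : IsOpen C)
  (hg : ContDiffOn 𝕜 ∞ (fun x : 𝕜 × 𝕜 => g x.1 x.2) (B ×ˢ C))
  (h0 : ∀ b ∈ B, ∀ c ∈ C, g b c ≠ 0) (hh : ContDiffOn 𝕜 ∞ h C)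
include hB hC hg h0

lemma ReducedSystem.heatJet (R : ReducedSystem B C g h) :
    HeatJet (B ×ˢ C) g (logB g) (negLogDerivTwo g) (pb (negLogDerivTwo g))
      (pb (pb (negLogDerivTwo g))) h :=
  SmoothOn.heatJet hg (hB.prod hC) (fun b c hx => h0 b hx.1 c hx.2) fun b c hx => by
    rw [← iteratedDeriv_two_slice]
    exact R.heat b hx.1 c hx.2

omit hB hC hg h0 in
lemma ReducedSystem.sq_eq (R : ReducedSystem B C g h) {b c : 𝕜} (hx : (b, c) ∈ B ×ˢ C) :
    pb (negLogDerivTwo g) b c ^ 2 = 4 * negLogDerivTwo g b c ^ 3 +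
      4 * h c * negLogDerivTwo g b c ^ 2 + 8 * deriv h c * negLogDerivTwo g b c
      + 8 / 3 * deriv (deriv h) c := by
  rw [← iteratedDeriv_two]
  exact R.weierstrass b hx.1 c hx.2

include hh in
lemma ReducedSystem.second_order (R : ReducedSystem B C g h) (hch : ∀ c ∈ C, ChazyAt h c)
    {b c : 𝕜} (hx : (b, c) ∈ B ×ˢ C) :
    pb (pb (negLogDerivTwo g)) b c =
      6 * negLogDerivTwo g b c ^ 2 + 4 * h c * negLogDerivTwo g b c + 4 * deriv h c :=
  (R.heatJet hB hC hg h0).second_order_of_sq_eq (h₂ := deriv (deriv h))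
    (fun _ _ hx => R.sq_eq hx) (fun _ _ hx => contDiffOn_hasDerivAt hC hh hx.2)
    (fun _ _ hx => contDiffOn_hasDerivAt hC (contDiffOn_deriv hC hh) hx.2)
    (fun _ c hx => (chazyAt_iff_hasDerivAt hC hh hx.2).1 (hch c hx.2))
    (smoothOn_snd hh) (smoothOn_snd (contDiffOn_deriv hC hh)) hx

include hh in
lemma ReducedSystem.expIntegrableAt (R : ReducedSystem B C g h) (hch : ∀ c ∈ C, ChazyAt h c)
    {b c : 𝕜} (hx : (b, c) ∈ B ×ˢ C) : ExpIntegrableAt g b c :=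
  (R.heatJet hB hC hg h0).expIntegrableAt (h₂ := deriv (deriv h))
    (fun _ _ hx => R.second_order hB hC hg h0 hh hch hx)
    (fun _ _ hx => R.sq_eq hx) (fun _ _ hx => contDiffOn_hasDerivAt hC hh hx.2)
    (fun _ _ hx => contDiffOn_hasDerivAt hC (contDiffOn_deriv hC hh) hx.2) hx

lemma exists_reducedSystem (hB' : IsConnected B)
    (H : ∀ b ∈ B, ∀ c ∈ C, ExpIntegrableAt g b c) :
    ∃ h : 𝕜 → 𝕜, ContDiffOn 𝕜 ∞ h C ∧ (∀ c ∈ C, ChazyAt h c) ∧ ReducedSystem B C g h := by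
  obtain ⟨b₀, hb₀⟩ := hB'.nonempty
  have hΩ : IsOpen (B ×ˢ C) := hB.prod hC
  have hg' : SmoothOn (B ×ˢ C) g := hg
  -- The fifth condition divided by `g²` says that this quotient has zero `b`-derivative; it becomes
  -- `h(c)`.
  set k : 𝕜 → 𝕜 → 𝕜 := fun b c => (pb (pb g) b c - 4 * pc g b c) / g b c with hk
  have hks : SmoothOn (B ×ˢ C) k :=
    ContDiffOn.div (((hg'.smoothOn_pb hΩ).smoothOn_pb hΩ).sub
      ((smoothOn_const 4).mul (hg'.smoothOn_pc hΩ))) hg fun x hx => h0 x.1 hx.1 x.2 hx.2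
  have hkb : ∀ b ∈ B, ∀ c ∈ C, HasDerivAt (fun t => k t c) 0 b := by
    intro b hb c hc
    have hx : (b, c) ∈ B ×ˢ C := ⟨hb, hc⟩
    have g1 := hg'.hasDerivAt_fst hΩ hx
    have g2 := (hg'.smoothOn_pb hΩ).hasDerivAt_fst hΩ hx
    have g3 := ((hg'.smoothOn_pb hΩ).smoothOn_pb hΩ).hasDerivAt_fst hΩ hx
    have g4 := (hg'.smoothOn_pc hΩ).hasDerivAt_fst hΩ hx
    have e := (H b hb c hc).cond₅
    rw [pb] at e
    have e2 := ((g3.mul g1).sub (g2.pow 2)).deriv.symm.trans e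
    simp only [Pi.mul_apply, Pi.sub_apply] at e2
    push_cast at e2
    refine ((g3.sub (g4.const_mul 4)).div g1 (h0 b hb c hc)).congr_deriv ?_
    rw [hg'.pb_pc hΩ hx]
    simp only [Pi.sub_apply]
    rw [div_eq_zero_iff]
    left
    linear_combination e2
  have hkc : ∀ b ∈ B, ∀ c ∈ C, k b c = k b₀ c := by
    intro b hb c hc
    exact hB.is_const_of_deriv_eq_zero hB'.isPreconnected
      (fun t ht => (hkb t ht c hc).differentiableAt.differentiableWithinAt)
      (fun t ht => (hkb t ht c hc).deriv) hb hb₀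
  set h : 𝕜 → 𝕜 := fun c => k b₀ c with hh
  have hhs : ContDiffOn 𝕜 ∞ h C :=
    hks.comp (contDiffOn_const.prodMk contDiffOn_id) fun c hc => ⟨hb₀, hc⟩
  have heat : ∀ b c, (b, c) ∈ B ×ˢ C → pc g b c = 1 / 4 * (pb (pb g) b c - h c * g b c) := by
    intro b c hx
    have h1 : h c = k b c := (hkc b hx.1 c hx.2).symm
    rw [h1, hk]
    have := h0 b hx.1 c hx.2
    field_simp
    ring
  have J := hg'.heatJet hΩ (fun b c hx => h0 b hx.1 c hx.2) heat
  have hd := fun (b c : 𝕜) (hx : (b, c) ∈ B ×ˢ C) => contDiffOn_hasDerivAt hC hhs hx.2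
  have hd' := fun (b c : 𝕜) (hx : (b, c) ∈ B ×ˢ C) =>
    contDiffOn_hasDerivAt hC (contDiffOn_deriv hC hhs) hx.2
  have hr := fun (b c : 𝕜) (hx : (b, c) ∈ B ×ˢ C) =>
    J.second_order_of_cond₂ hx (hd b c hx) (H b hx.1 c hx.2)
  have hp := fun (b c : 𝕜) (hx : (b, c) ∈ B ×ˢ C) =>
    J.sq_eq_of_second_order hr hd hd' (smoothOn_snd hhs) (smoothOn_snd (contDiffOn_deriv hC hhs))
      (smoothOn_snd (contDiffOn_deriv hC (contDiffOn_deriv hC hhs))) hx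
  refine ⟨h, hhs, fun c hc => ?_, ⟨fun b hb c hc => ?_, fun b hb c hc => ?_⟩⟩
  · have hx : (b₀, c) ∈ B ×ˢ C := ⟨hb₀, hc⟩
    -- On the line `b = b₀` the first integral equals `(8/3)h''`, so its `c`-derivative is
    -- `(8/3)h'''`; comparison with `hasDerivAt_cubic` gives the Chazy equation.
    have h1 := J.hasDerivAt_cubic hr hx (hd _ _ hx) (hd' _ _ hx)
    have h3 := ((h1.congr_of_eventuallyEq (f₁ := fun t => 8 / 3 * deriv (deriv h) t) (by
      filter_upwards [eventually_slice_snd hΩ hx] with t ht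
      linear_combination -hp b₀ t ht))).const_mul (3 / 8)
    rw [chazyAt_iff_hasDerivAt hC hhs hc]
    refine (h3.congr_of_eventuallyEq (Eventually.of_forall fun t => ?_)).congr_deriv ?_
    · ring
    · linear_combination (3 / 8 * (3 * negLogDerivTwo g b₀ c + 2 * h c)) * hp b₀ c hx
  · rw [iteratedDeriv_two_slice]
    exact heat b c ⟨hb, hc⟩
  · rw [iteratedDeriv_two]
    exact hp b c ⟨hb, hc⟩

/-- The integrability conditions for `e^a g` reduce to the system for `g` with `h` a solution of
the Chazy equation. -/
theorem integrableDensity_expDensity_iff_reducedSystem (hB' : IsConnected B) :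
    IntegrableDensity (Set.univ ×ˢ B ×ˢ C) (expDensity g) ↔
      ∃ h : 𝕜 → 𝕜, ContDiffOn 𝕜 ∞ h C ∧ (∀ c ∈ C, ChazyAt h c) ∧ ReducedSystem B C g h := by
  rw [integrableDensity_expDensity_iff]
  refine ⟨exists_reducedSystem hB hC hg h0 hB', ?_⟩
  rintro ⟨h, hh, hch, R⟩ b hb c hc
  exact R.expIntegrableAt hB hC hg h0 hh hch ⟨hb, hc⟩

end

end Reduction

/-! ### Uniqueness for total differential equations and for jets -/

section Uniqueness

open Filter Topology

/-- Near the initial value `Ψ` is `K`-Lipschitz. On a ball of radius `ρ` with `Kρ ≤ 1/2` the mean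
value inequality halves any bound for `‖f₁ - f₂‖`, so this norm is at most `2⁻ⁿ` for all `n`. The
real structure on `E` serves for the convexity of the ball. -/
lemma eventuallyEq_of_hasFDerivAt {𝕜 E X : Type*} [RCLike 𝕜] [NormedAddCommGroup E]
    [NormedSpace ℝ E] [NormedSpace 𝕜 E] [NormedAddCommGroup X] [NormedSpace 𝕜 X]
    {Ψ : E × X → E →L[𝕜] X} {f₁ f₂ : E → X} {x₀ : E} (hΨ : ContDiffAt 𝕜 1 Ψ (x₀, f₁ x₀))
    (h₁ : ∀ᶠ x in 𝓝 x₀, HasFDerivAt f₁ (Ψ (x, f₁ x)) x)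
    (h₂ : ∀ᶠ x in 𝓝 x₀, HasFDerivAt f₂ (Ψ (x, f₂ x)) x) (h : f₁ x₀ = f₂ x₀) :
    f₁ =ᶠ[𝓝 x₀] f₂ := by
  obtain ⟨K, t, ht, hL⟩ := hΨ.exists_lipschitzOnWith
  have c₁ : ContinuousAt f₁ x₀ := h₁.self_of_nhds.continuousAt
  have c₂ : ContinuousAt f₂ x₀ := h₂.self_of_nhds.continuousAt
  have t₁ : ∀ᶠ x in 𝓝 x₀, (x, f₁ x) ∈ t := (continuousAt_id.prodMk c₁).eventually_mem ht
  have t₂ : ∀ᶠ x in 𝓝 x₀, (x, f₂ x) ∈ t :=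
    (continuousAt_id.prodMk c₂).eventually_mem (by simpa [h] using ht)
  have n0 : ∀ᶠ x in 𝓝 x₀, ‖f₁ x - f₂ x‖ < 1 :=
    ((c₁.sub c₂).norm).eventually_lt continuousAt_const (by simp [h])
  obtain ⟨ε, hε, H⟩ := Metric.eventually_nhds_iff_ball.1
    (h₁.and (h₂.and (t₁.and (t₂.and n0))))
  obtain ⟨ρ, hρ, hρε, hKρ⟩ : ∃ ρ > 0, ρ ≤ ε ∧ K * ρ ≤ 1 / 2 := by
    refine ⟨min ε (1 / (2 * (K + 1))), lt_min hε (by positivity), min_le_left _ _, ?_⟩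
    calc (K : ℝ) * min ε (1 / (2 * (K + 1))) ≤ K * (1 / (2 * (K + 1))) := by
          gcongr; exact min_le_right _ _
      _ ≤ 1 / 2 := by
          rw [mul_one_div, div_le_div_iff₀ (by positivity) (by norm_num)]
          linarith
  have key : ∀ n : ℕ, ∀ x ∈ Metric.ball x₀ ρ, ‖f₁ x - f₂ x‖ ≤ (1 / 2) ^ n := by
    intro n
    induction n with
    | zero => exact fun x hx => by simpa using (H x (Metric.ball_subset_ball hρε hx)).2.2.2.2.le
    | succ n ih =>
      intro x hx
      have h3 := (convex_ball x₀ ρ).norm_image_sub_le_of_norm_hasFDerivWithin_le (𝕜 := 𝕜)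
        (f := fun x => f₁ x - f₂ x) (f' := fun x => Ψ (x, f₁ x) - Ψ (x, f₂ x))
        (C := K * (1 / 2) ^ n) (x := x₀) (y := x)
        (fun y hy => ((H y (Metric.ball_subset_ball hρε hy)).1.sub
          (H y (Metric.ball_subset_ball hρε hy)).2.1).hasFDerivWithinAt)
        (fun y hy => by
          obtain ⟨-, -, m₁, m₂, -⟩ := H y (Metric.ball_subset_ball hρε hy)
          refine (hL.norm_sub_le m₁ m₂).trans ?_
          gcongr
          simpa [Prod.norm_def] using ih y hy)
        (Metric.mem_ball_self hρ) hx
      rw [h, sub_self, sub_zero] at h3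
      refine h3.trans ?_
      have h4 : ‖x - x₀‖ ≤ ρ := by simpa [dist_eq_norm] using (Metric.mem_ball.1 hx).le
      calc K * (1 / 2) ^ n * ‖x - x₀‖ ≤ K * (1 / 2) ^ n * ρ := by gcongr
        _ = (K * ρ) * (1 / 2) ^ n := by ring
        _ ≤ 1 / 2 * (1 / 2) ^ n := by gcongr
        _ = (1 / 2) ^ (n + 1) := by ring
  filter_upwards [Metric.ball_mem_nhds x₀ hρ] with x hx
  have h5 : ‖f₁ x - f₂ x‖ ≤ 0 := ge_of_tendsto'
    (tendsto_pow_atTop_nhds_zero_of_lt_one (by norm_num) (by norm_num : (1 / 2 : ℝ) < 1))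
    fun n => key n x hx
  exact sub_eq_zero.1 (norm_le_zero_iff.1 h5)

section Grad

variable {𝕜 F : Type*} [RCLike 𝕜] [NormedAddCommGroup F] [NormedSpace 𝕜 F]

/-- The linear map `𝕜 × 𝕜 → F` with partial derivatives `x` and `y`. -/
def grad (𝕜 : Type*) [RCLike 𝕜] {F : Type*} [NormedAddCommGroup F] [NormedSpace 𝕜 F] (x y : F) :
    𝕜 × 𝕜 →L[𝕜] F :=
  (ContinuousLinearMap.fst 𝕜 𝕜 𝕜).smulRight x + (ContinuousLinearMap.snd 𝕜 𝕜 𝕜).smulRight y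

@[simp] lemma grad_apply (x y : F) (z : 𝕜 × 𝕜) : grad 𝕜 x y z = z.1 • x + z.2 • y := rfl

lemma hasFDerivAt_grad {f : 𝕜 × 𝕜 → F} {x y : F} {b c : 𝕜} (hf : DifferentiableAt 𝕜 f (b, c))
    (hx : HasDerivAt (fun t => f (t, c)) x b) (hy : HasDerivAt (fun t => f (b, t)) y c) :
    HasFDerivAt f (grad 𝕜 x y) (b, c) := by
  refine hf.hasFDerivAt.congr_fderiv ?_
  have h1 := (hasDerivAt_slice_fst hf.hasFDerivAt).unique hx
  have h2 := (hasDerivAt_slice_snd hf.hasFDerivAt).unique hy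
  ext
  · simpa using h1
  · simpa using h2

lemma hasDerivAt_fst_of_grad {f : 𝕜 × 𝕜 → F} {x y : F} {b c : 𝕜}
    (hf : HasFDerivAt f (grad 𝕜 x y) (b, c)) : HasDerivAt (fun t => f (t, c)) x b := by
  simpa using hasDerivAt_slice_fst hf

lemma hasDerivAt_snd_of_grad {f : 𝕜 × 𝕜 → F} {x y : F} {b c : 𝕜}
    (hf : HasFDerivAt f (grad 𝕜 x y) (b, c)) : HasDerivAt (fun t => f (b, t)) y c := by
  simpa using hasDerivAt_slice_snd hf

end Grad

/-- Functions `g, w, v, p` of `(b, c)` that satisfy the closed system of first order equations of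
the jet `w = g_b / g`, `v = -w_b`, `p = v_b` of a solution `g` of the reduced system. -/
structure IsJet {𝕜 F : Type*} [RCLike 𝕜] [NormedField F] [NormedAlgebra 𝕜 F] (Ω : Set (𝕜 × 𝕜))
    (g w v p : 𝕜 → 𝕜 → F) (h h₁ : 𝕜 → F) : Prop where
  isOpen : IsOpen Ω
  dg : ∀ b c, (b, c) ∈ Ω → HasFDerivAt (fun x : 𝕜 × 𝕜 => g x.1 x.2) (grad 𝕜 (g b c * w b c)
    (g b c * (w b c ^ 2 - v b c - h c) / 4)) (b, c)
  dw : ∀ b c, (b, c) ∈ Ω → HasFDerivAt (fun x : 𝕜 × 𝕜 => w x.1 x.2) (grad 𝕜 (-v b c)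
    (-(p b c + 2 * w b c * v b c) / 4)) (b, c)
  dv : ∀ b c, (b, c) ∈ Ω → HasFDerivAt (fun x : 𝕜 × 𝕜 => v x.1 x.2) (grad 𝕜 (p b c)
    (v b c ^ 2 + h c * v b c + h₁ c + w b c * p b c / 2)) (b, c)
  dp : ∀ b c, (b, c) ∈ Ω → HasFDerivAt (fun x : 𝕜 × 𝕜 => p x.1 x.2)
    (grad 𝕜 (6 * v b c ^ 2 + 4 * h c * v b c + 4 * h₁ c)
      (p b c * (3 * v b c / 2 + h c) + w b c * (3 * v b c ^ 2 + 2 * h c * v b c + 2 * h₁ c)))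
    (b, c)

namespace IsJet

variable {𝕜 F : Type*} [RCLike 𝕜] [RCLike F] [NormedAlgebra 𝕜 F] {Ω Ω' : Set (𝕜 × 𝕜)}
  {g w v p g' w' v' p' : 𝕜 → 𝕜 → F} {h h₁ : 𝕜 → F}

lemma mono (J : IsJet Ω g w v p h h₁) (hΩ' : IsOpen Ω') (hs : Ω' ⊆ Ω) :
    IsJet Ω' g w v p h h₁ :=
  ⟨hΩ', fun b c hx => J.dg b c (hs hx), fun b c hx => J.dw b c (hs hx),
    fun b c hx => J.dv b c (hs hx), fun b c hx => J.dp b c (hs hx)⟩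

lemma eventuallyEq {b c : 𝕜} (J : IsJet Ω g w v p h h₁) (J' : IsJet Ω' g' w' v' p' h h₁)
    (hx : (b, c) ∈ Ω) (hx' : (b, c) ∈ Ω') (hh : ContDiffAt 𝕜 1 h c) (hh₁ : ContDiffAt 𝕜 1 h₁ c)
    (eg : g b c = g' b c) (ew : w b c = w' b c) (ev : v b c = v' b c) (ep : p b c = p' b c) :
    ∀ᶠ x : 𝕜 × 𝕜 in 𝓝 (b, c), g x.1 x.2 = g' x.1 x.2 ∧ w x.1 x.2 = w' x.1 x.2 ∧
      v x.1 x.2 = v' x.1 x.2 ∧ p x.1 x.2 = p' x.1 x.2 := by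
  let Ψ : (𝕜 × 𝕜) × (F × F × F × F) → (𝕜 × 𝕜) →L[𝕜] (F × F × F × F) := fun z =>
    grad 𝕜 (z.2.1 * z.2.2.1, -z.2.2.2.1, z.2.2.2.2,
      6 * z.2.2.2.1 ^ 2 + 4 * h z.1.2 * z.2.2.2.1 + 4 * h₁ z.1.2)
    (z.2.1 * (z.2.2.1 ^ 2 - z.2.2.2.1 - h z.1.2) / 4, -(z.2.2.2.2 + 2 * z.2.2.1 * z.2.2.2.1) / 4,
      z.2.2.2.1 ^ 2 + h z.1.2 * z.2.2.2.1 + h₁ z.1.2 + z.2.2.1 * z.2.2.2.2 / 2,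
      z.2.2.2.2 * (3 * z.2.2.2.1 / 2 + h z.1.2) + z.2.2.1 * (3 * z.2.2.2.1 ^ 2
        + 2 * h z.1.2 * z.2.2.2.1 + 2 * h₁ z.1.2))
  have hgrad : ∀ {x y : (𝕜 × 𝕜) × (F × F × F × F) → F × F × F × F}
      {z : (𝕜 × 𝕜) × (F × F × F × F)},
      ContDiffAt 𝕜 1 x z → ContDiffAt 𝕜 1 y z → ContDiffAt 𝕜 1 (fun z => grad 𝕜 (x z) (y z)) z :=
    fun hx hy => (contDiffAt_const.smulRight hx).add (contDiffAt_const.smulRight hy)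
  have hΨ : ContDiffAt 𝕜 1 Ψ ((b, c), (g b c, w b c, v b c, p b c)) := by
    have H : ContDiffAt 𝕜 1 (fun z : (𝕜 × 𝕜) × (F × F × F × F) => h z.1.2)
        ((b, c), (g b c, w b c, v b c, p b c)) := hh.comp (f := fun z : (𝕜 × 𝕜) × (F × F × F × F) =>
          z.1.2) _ (by fun_prop)
    have H₁ : ContDiffAt 𝕜 1 (fun z : (𝕜 × 𝕜) × (F × F × F × F) => h₁ z.1.2)
        ((b, c), (g b c, w b c, v b c, p b c)) := hh₁.comp (f := fun z : (𝕜 × 𝕜) × (F × F × F × F) =>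
          z.1.2) _ (by fun_prop)
    exact hgrad (by fun_prop) (by fun_prop)
  have := eventuallyEq_of_hasFDerivAt (Ψ := Ψ) (x₀ := (b, c))
    (f₁ := fun x : 𝕜 × 𝕜 => (g x.1 x.2, w x.1 x.2, v x.1 x.2, p x.1 x.2))
    (f₂ := fun x : 𝕜 × 𝕜 => (g' x.1 x.2, w' x.1 x.2, v' x.1 x.2, p' x.1 x.2)) hΨ
    (by
      filter_upwards [J.isOpen.mem_nhds hx] with x hx
      exact ((J.dg x.1 x.2 hx).prodMk ((J.dw x.1 x.2 hx).prodMk ((J.dv x.1 x.2 hx).prodMk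
        (J.dp x.1 x.2 hx)))).congr_fderiv rfl)
    (by
      filter_upwards [J'.isOpen.mem_nhds hx'] with x hx
      exact ((J'.dg x.1 x.2 hx).prodMk ((J'.dw x.1 x.2 hx).prodMk ((J'.dv x.1 x.2 hx).prodMk
        (J'.dp x.1 x.2 hx)))).congr_fderiv rfl)
    (by simp [eg, ew, ev, ep])
  filter_upwards [this] with x hx
  simpa using hx

/-- A jet on a connected set is determined by its value at a point. -/
theorem eq_of_eq (J : IsJet Ω g w v p h h₁) (hΩ : IsPreconnected Ω)
    (hne : ∀ b c, (b, c) ∈ Ω → g b c ≠ 0)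
    (hg' : ContinuousOn (fun x : 𝕜 × 𝕜 => g' x.1 x.2) Ω)
    (J' : IsJet {x ∈ Ω | g' x.1 x.2 ≠ 0} g' w' v' p' h h₁)
    (hh : ∀ b c, (b, c) ∈ Ω → ContDiffAt 𝕜 1 h c)
    (hh₁ : ∀ b c, (b, c) ∈ Ω → ContDiffAt 𝕜 1 h₁ c) {b₀ c₀ : 𝕜} (hx₀ : (b₀, c₀) ∈ Ω)
    (eg : g b₀ c₀ = g' b₀ c₀) (ew : w b₀ c₀ = w' b₀ c₀) (ev : v b₀ c₀ = v' b₀ c₀)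
    (ep : p b₀ c₀ = p' b₀ c₀) {b c : 𝕜} (hx : (b, c) ∈ Ω) : g b c = g' b c := by
  set A : Set (𝕜 × 𝕜) := {x | ∀ᶠ y : 𝕜 × 𝕜 in 𝓝 x, g y.1 y.2 = g' y.1 y.2 ∧
    w y.1 y.2 = w' y.1 y.2 ∧ v y.1 y.2 = v' y.1 y.2 ∧ p y.1 y.2 = p' y.1 y.2} with hA
  have hAo : IsOpen A := isOpen_setOfPred_eventually_nhds
  have hpt : ∀ b c, (b, c) ∈ Ω → g b c = g' b c → w b c = w' b c → v b c = v' b c →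
      p b c = p' b c → (b, c) ∈ A := fun b c hx eg ew ev ep =>
    J.eventuallyEq J' hx ⟨hx, eg ▸ hne b c hx⟩ (hh b c hx) (hh₁ b c hx) eg ew ev ep
  -- `A` is open, and it is closed in `Ω`: at a limit point continuity gives `g' = g ≠ 0`, so the
  -- point lies in the domain of the second jet, the other components agree by continuity as well,
  -- and local uniqueness applies.
  have key : Ω ⊆ A := by
    refine hΩ.subset_of_closure_inter_subset hAo
      ⟨(b₀, c₀), hx₀, hpt b₀ c₀ hx₀ eg ew ev ep⟩ ?_
    rintro ⟨b, c⟩ ⟨hcl, hx⟩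
    have lim : ∀ {f f' : 𝕜 → 𝕜 → F}, ContinuousAt (fun x : 𝕜 × 𝕜 => f x.1 x.2) (b, c) →
        ContinuousAt (fun x : 𝕜 × 𝕜 => f' x.1 x.2) (b, c) →
        (∀ x ∈ A, f x.1 x.2 = f' x.1 x.2) → f b c = f' b c := by
      intro f f' hf hf' he
      have : (𝓝[A] (b, c)).NeBot := mem_closure_iff_nhdsWithin_neBot.1 hcl
      exact tendsto_nhds_unique_of_eventuallyEq (hf.mono_left nhdsWithin_le_nhds)
        (hf'.mono_left nhdsWithin_le_nhds) (eventually_nhdsWithin_of_forall he)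
    have e1 := lim (J.dg b c hx).continuousAt (hg'.continuousAt (J.isOpen.mem_nhds hx))
      fun x hx => (Filter.Eventually.self_of_nhds hx).1
    have hx' : (b, c) ∈ {x ∈ Ω | g' x.1 x.2 ≠ 0} := ⟨hx, e1 ▸ hne b c hx⟩
    exact hpt b c hx e1
      (lim (J.dw b c hx).continuousAt (J'.dw b c hx').continuousAt
        fun x hx => (Filter.Eventually.self_of_nhds hx).2.1)
      (lim (J.dv b c hx).continuousAt (J'.dv b c hx').continuousAt
        fun x hx => (Filter.Eventually.self_of_nhds hx).2.2.1)
      (lim (J.dp b c hx).continuousAt (J'.dp b c hx').continuousAt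
        fun x hx => (Filter.Eventually.self_of_nhds hx).2.2.2)
  exact (key hx).self_of_nhds.1

end IsJet

end Uniqueness

/-! ### Change of field, Galilei symmetries and explicit families of jets -/

section JetFamilies

open Filter Topology

variable {𝕜 F : Type*} [RCLike 𝕜] [RCLike F] [NormedAlgebra 𝕜 F]

lemma HeatJet.isJet {Ω : Set (𝕜 × 𝕜)} {g w v p r : 𝕜 → 𝕜 → 𝕜} {h h₁ : 𝕜 → 𝕜}
    (J : HeatJet Ω g w v p r h)
    (hr : ∀ b c, (b, c) ∈ Ω → r b c = 6 * v b c ^ 2 + 4 * h c * v b c + 4 * h₁ c) :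
    IsJet Ω g w v p h h₁ := by
  have hd : ∀ {f : 𝕜 → 𝕜 → 𝕜}, SmoothOn Ω f → ∀ b c, (b, c) ∈ Ω →
      DifferentiableAt 𝕜 (fun x : 𝕜 × 𝕜 => f x.1 x.2) (b, c) :=
    fun hf b c hx => (hf.hasFDerivAt J.isOpen hx).differentiableAt
  refine ⟨J.isOpen, fun b c hx => ?_, fun b c hx => ?_, fun b c hx => ?_, fun b c hx => ?_⟩
  · exact hasFDerivAt_grad (hd J.smooth b c hx) (J.gb b c hx) (J.gc b c hx)
  · exact hasFDerivAt_grad (hd J.smooth_w b c hx) (J.wb b c hx)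
      ((J.wc hx).congr_deriv (by ring))
  · exact hasFDerivAt_grad (hd J.smooth_v b c hx) (J.vb b c hx)
      ((J.vc hx).congr_deriv (by rw [hr b c hx]; ring))
  · have hs : HasDerivAt (fun t => r t c) ((12 * v b c + 4 * h c) * p b c) b := by
      have h1 := ((((J.vb b c hx).pow 2).const_mul 6).add
        ((J.vb b c hx).const_mul (4 * h c))).add_const (4 * h₁ c)
      refine (h1.congr_of_eventuallyEq ?_).congr_deriv (by ring)
      filter_upwards [eventually_slice_fst J.isOpen hx] with t ht using by simp [hr t c ht]
    exact hasFDerivAt_grad (hd J.smooth_p b c hx) ((J.pb b c hx).congr_deriv (hr b c hx))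
      ((J.pc hx hs).congr_deriv (by rw [hr b c hx]; ring))

lemma hasFDerivAt_algebraMap_grad {f : 𝕜 × 𝕜 → 𝕜} {x y : 𝕜} {z : 𝕜 × 𝕜}
    (hf : HasFDerivAt f (grad 𝕜 x y) z) :
    HasFDerivAt (fun z => algebraMap 𝕜 F (f z)) (grad 𝕜 (algebraMap 𝕜 F x) (algebraMap 𝕜 F y))
      z := by
  refine ((algebraMapCLM 𝕜 F).hasFDerivAt.comp z hf).congr_fderiv ?_
  ext <;> simp

/-- The variables stay in `𝕜` while the values pass to `F`. In this way a real solution can be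
compared with the theta family, whose parameters `μ, ν, K` are complex. -/
lemma IsJet.lift {Ω : Set (𝕜 × 𝕜)} {g w v p : 𝕜 → 𝕜 → 𝕜} {h h₁ : 𝕜 → 𝕜}
    (J : IsJet Ω g w v p h h₁) :
    IsJet Ω (fun b c => algebraMap 𝕜 F (g b c)) (fun b c => algebraMap 𝕜 F (w b c))
      (fun b c => algebraMap 𝕜 F (v b c)) (fun b c => algebraMap 𝕜 F (p b c))
      (fun c => algebraMap 𝕜 F (h c)) (fun c => algebraMap 𝕜 F (h₁ c)) where
  isOpen := J.isOpen
  dg b c hx := by simpa [map_ofNat] using hasFDerivAt_algebraMap_grad (F := F) (J.dg b c hx)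
  dw b c hx := by simpa [map_ofNat] using hasFDerivAt_algebraMap_grad (F := F) (J.dw b c hx)
  dv b c hx := by simpa [map_ofNat] using hasFDerivAt_algebraMap_grad (F := F) (J.dv b c hx)
  dp b c hx := by simpa [map_ofNat] using hasFDerivAt_algebraMap_grad (F := F) (J.dp b c hx)

lemma hasFDerivAt_comp_algebraMap {f : F × F → F} {x y : F} {b c : 𝕜}
    (hf : HasFDerivAt f (grad F x y) (algebraMap 𝕜 F b, algebraMap 𝕜 F c)) :
    HasFDerivAt (fun z : 𝕜 × 𝕜 => f (algebraMap 𝕜 F z.1, algebraMap 𝕜 F z.2)) (grad 𝕜 x y)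
      (b, c) := by
  have h1 : HasFDerivAt (fun z : 𝕜 × 𝕜 => (algebraMap 𝕜 F z.1, algebraMap 𝕜 F z.2))
      (((algebraMapCLM 𝕜 F).comp (ContinuousLinearMap.fst 𝕜 𝕜 𝕜)).prod
        ((algebraMapCLM 𝕜 F).comp (ContinuousLinearMap.snd 𝕜 𝕜 𝕜))) (b, c) :=
    (algebraMapCLM 𝕜 F).hasFDerivAt.comp (b, c) hasFDerivAt_fst |>.prodMk
      ((algebraMapCLM 𝕜 F).hasFDerivAt.comp (b, c) hasFDerivAt_snd)
  refine (HasFDerivAt.comp (g := f) (b, c) (hf.restrictScalars 𝕜) h1).congr_fderiv ?_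
  ext <;> simp

/-- Restriction of a jet over `F` to the smaller field `𝕜`. -/
lemma IsJet.restrict {Ω : Set (F × F)} {g w v p : F → F → F} {h h₁ : F → F}
    (J : IsJet Ω g w v p h h₁) {Ω' : Set (𝕜 × 𝕜)} (hΩ' : IsOpen Ω')
    (hs : ∀ b c, (b, c) ∈ Ω' → (algebraMap 𝕜 F b, algebraMap 𝕜 F c) ∈ Ω) :
    IsJet Ω' (fun b c => g (algebraMap 𝕜 F b) (algebraMap 𝕜 F c))
      (fun b c => w (algebraMap 𝕜 F b) (algebraMap 𝕜 F c))
      (fun b c => v (algebraMap 𝕜 F b) (algebraMap 𝕜 F c))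
      (fun b c => p (algebraMap 𝕜 F b) (algebraMap 𝕜 F c))
      (fun c => h (algebraMap 𝕜 F c)) (fun c => h₁ (algebraMap 𝕜 F c)) where
  isOpen := hΩ'
  dg b c hx := hasFDerivAt_comp_algebraMap (J.dg _ _ (hs b c hx))
  dw b c hx := hasFDerivAt_comp_algebraMap (J.dw _ _ (hs b c hx))
  dv b c hx := hasFDerivAt_comp_algebraMap (J.dv _ _ (hs b c hx))
  dp b c hx := hasFDerivAt_comp_algebraMap (J.dp _ _ (hs b c hx))

lemma hasFDerivAt_galilei {f : 𝕜 × 𝕜 → 𝕜} {x y μ ν : 𝕜} {b c : 𝕜}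
    (hf : HasFDerivAt f (grad 𝕜 x y) (b + μ * c + ν, c)) :
    HasFDerivAt (fun z : 𝕜 × 𝕜 => f (z.1 + μ * z.2 + ν, z.2)) (grad 𝕜 x (μ * x + y)) (b, c) := by
  have h1 : HasFDerivAt (fun z : 𝕜 × 𝕜 => (z.1 + μ * z.2 + ν, z.2))
      ((grad 𝕜 1 μ).prod (grad 𝕜 0 1)) (b, c) := by
    have h2 : HasFDerivAt (fun z : 𝕜 × 𝕜 => z.1 + μ * z.2) (grad 𝕜 1 μ) (b, c) := by
      refine (hasFDerivAt_fst.add (hasFDerivAt_snd.const_mul μ)).congr_fderiv ?_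
      ext <;> simp
    have h3 : HasFDerivAt (fun z : 𝕜 × 𝕜 => z.2) (grad 𝕜 0 1) (b, c) := by
      refine hasFDerivAt_snd.congr_fderiv ?_
      ext <;> simp
    exact (h2.add_const ν).prodMk h3
  refine (HasFDerivAt.comp (g := f) (b, c) hf h1).congr_fderiv ?_
  ext <;> simp

/-- The action of the Galilei symmetries of the heat equation on jets. -/
lemma IsJet.galilei {Ω : Set (𝕜 × 𝕜)} {g w v p : 𝕜 → 𝕜 → 𝕜} {h h₁ : 𝕜 → 𝕜}
    (J : IsJet Ω g w v p h h₁) (μ ν K : 𝕜) :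
    IsJet {x | (x.1 + μ * x.2 + ν, x.2) ∈ Ω}
      (fun b c => K * NormedSpace.exp (2 * μ * b + μ ^ 2 * c) * g (b + μ * c + ν) c)
      (fun b c => 2 * μ + w (b + μ * c + ν) c) (fun b c => v (b + μ * c + ν) c)
      (fun b c => p (b + μ * c + ν) c) h h₁ where
  isOpen := J.isOpen.preimage (by fun_prop)
  dg b c hx := by
    have h1 := hasFDerivAt_galilei (J.dg (b + μ * c + ν) c hx)
    have h2 : HasFDerivAt (fun z : 𝕜 × 𝕜 => 2 * μ * z.1 + μ ^ 2 * z.2) (grad 𝕜 (2 * μ) (μ ^ 2))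
        (b, c) := by
      refine ((hasFDerivAt_fst.const_mul _).add (hasFDerivAt_snd.const_mul _)).congr_fderiv ?_
      ext <;> simp
    have h3 := (HasDerivAt.comp_hasFDerivAt (b, c)
      (hasDerivAt_exp (x := 2 * μ * b + μ ^ 2 * c)) h2).const_mul K
    refine (h3.mul h1).congr_fderiv ?_
    ext
    · simp
      ring
    · simp
      ring
  dw b c hx := by
    refine ((hasFDerivAt_galilei (J.dw (b + μ * c + ν) c hx)).const_add (2 * μ)).congr_fderiv ?_
    congr 1
    ring
  dv b c hx := by
    refine (hasFDerivAt_galilei (J.dv (b + μ * c + ν) c hx)).congr_fderiv ?_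
    congr 1
    ring
  dp b c hx := by
    refine (hasFDerivAt_galilei (J.dp (b + μ * c + ν) c hx)).congr_fderiv ?_
    congr 1
    ring

lemma hasFDerivAt_fst_grad {f : 𝕜 → 𝕜} {f' b c y : 𝕜} (hf : HasDerivAt f f' b) (hy : y = 0) :
    HasFDerivAt (fun z : 𝕜 × 𝕜 => f z.1) (grad 𝕜 f' y) (b, c) := by
  subst hy
  refine (HasDerivAt.comp_hasFDerivAt (b, c) (f := Prod.fst) hf hasFDerivAt_fst).congr_fderiv ?_
  ext <;> simp

/-- The ratio `ρ = g_b / g` satisfies `ρ_b = -ρ²`, so the jet is `v = ρ²`, `p = -2ρ³`: the cuspidal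
cubic `p² = 4v³`, with the cusp reached for `K = 0`. -/
lemma isJet_rational (K L : 𝕜) :
    IsJet {x : 𝕜 × 𝕜 | K * x.1 + L ≠ 0} (fun b _ => K * b + L) (fun b _ => K / (K * b + L))
      (fun b _ => (K / (K * b + L)) ^ 2) (fun b _ => -2 * (K / (K * b + L)) ^ 3)
      (fun _ => 0) (fun _ => 0) := by
  have h1 : ∀ b : 𝕜, HasDerivAt (fun t => K * t + L) K b := fun b =>
    (((hasDerivAt_id b).const_mul K).add_const L).congr_deriv (by simp)
  have h2 : ∀ b : 𝕜, K * b + L ≠ 0 →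
      HasDerivAt (fun t => K / (K * t + L)) (-(K / (K * b + L)) ^ 2) b := fun b hb =>
    ((hasDerivAt_const b K).div (h1 b) hb).congr_deriv (by field_simp; ring)
  refine ⟨isOpen_ne_fun (by fun_prop) (by fun_prop), fun b c hx => ?_, fun b c hx => ?_,
    fun b c hx => ?_, fun b c hx => ?_⟩
  · have hx : K * b + L ≠ 0 := hx
    exact hasFDerivAt_fst_grad ((h1 b).congr_deriv (by field_simp)) (by ring)
  · exact hasFDerivAt_fst_grad (h2 b hx) (by ring)
  · exact hasFDerivAt_fst_grad (((h2 b hx).pow 2).congr_deriv (by push_cast; ring)) (by ring)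
  · exact hasFDerivAt_fst_grad ((((h2 b hx).pow 3).const_mul (-2)).congr_deriv
      (by push_cast; ring)) (by ring)

/-- Since `g_bb = g`, the ratio `ρ = g_b / g` satisfies `ρ_b = 1 - ρ²`, so `v = ρ² - 1`, `p = 2ρ -
2ρ³` run over the nodal cubic `p² = 4v³ + 4v²`. -/
lemma isJet_trigonometric (K L : 𝕜) :
    IsJet {x : 𝕜 × 𝕜 | K * NormedSpace.exp x.1 + L * NormedSpace.exp (-x.1) ≠ 0}
      (fun b _ => K * NormedSpace.exp b + L * NormedSpace.exp (-b))
      (fun b _ => (K * NormedSpace.exp b - L * NormedSpace.exp (-b)) /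
        (K * NormedSpace.exp b + L * NormedSpace.exp (-b)))
      (fun b _ => ((K * NormedSpace.exp b - L * NormedSpace.exp (-b)) /
        (K * NormedSpace.exp b + L * NormedSpace.exp (-b))) ^ 2 - 1)
      (fun b _ => 2 * ((K * NormedSpace.exp b - L * NormedSpace.exp (-b)) /
        (K * NormedSpace.exp b + L * NormedSpace.exp (-b))) -
        2 * ((K * NormedSpace.exp b - L * NormedSpace.exp (-b)) /
        (K * NormedSpace.exp b + L * NormedSpace.exp (-b))) ^ 3)
      (fun _ => 1) (fun _ => 0) := by
  have he : ∀ b : 𝕜, HasDerivAt (fun t => NormedSpace.exp (-t)) (-NormedSpace.exp (-b)) b :=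
    fun b => (HasDerivAt.scomp b (hasDerivAt_exp (x := -b)) (hasDerivAt_neg b)).congr_deriv
      (by simp)
  have h1 : ∀ b : 𝕜, HasDerivAt (fun t => K * NormedSpace.exp t + L * NormedSpace.exp (-t))
      (K * NormedSpace.exp b - L * NormedSpace.exp (-b)) b := fun b =>
    (((hasDerivAt_exp (x := b)).const_mul K).add ((he b).const_mul L)).congr_deriv (by ring)
  have h1' : ∀ b : 𝕜, HasDerivAt (fun t => K * NormedSpace.exp t - L * NormedSpace.exp (-t))
      (K * NormedSpace.exp b + L * NormedSpace.exp (-b)) b := fun b =>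
    (((hasDerivAt_exp (x := b)).const_mul K).sub ((he b).const_mul L)).congr_deriv (by ring)
  have h2 : ∀ b : 𝕜, K * NormedSpace.exp b + L * NormedSpace.exp (-b) ≠ 0 →
      HasDerivAt (fun t => (K * NormedSpace.exp t - L * NormedSpace.exp (-t)) /
        (K * NormedSpace.exp t + L * NormedSpace.exp (-t)))
        (-(((K * NormedSpace.exp b - L * NormedSpace.exp (-b)) /
        (K * NormedSpace.exp b + L * NormedSpace.exp (-b))) ^ 2 - 1)) b := fun b hb =>
    ((h1' b).div (h1 b) hb).congr_deriv (by field_simp; ring)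
  have hc : Continuous fun b : 𝕜 => K * NormedSpace.exp b + L * NormedSpace.exp (-b) :=
    continuous_iff_continuousAt.2 fun b => (h1 b).continuousAt
  refine ⟨isOpen_ne_fun (hc.comp continuous_fst) (by fun_prop), fun b c hx => ?_, fun b c hx => ?_,
    fun b c hx => ?_, fun b c hx => ?_⟩
  · exact hasFDerivAt_fst_grad ((h1 b).congr_deriv (mul_div_cancel₀ _ hx).symm) (by ring)
  · exact hasFDerivAt_fst_grad (h2 b hx) (by ring)
  · exact hasFDerivAt_fst_grad (((h2 b hx).pow 2).sub_const 1 |>.congr_deriv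
      (by push_cast; ring)) (by ring)
  · exact hasFDerivAt_fst_grad ((((h2 b hx).const_mul 2).sub
      (((h2 b hx).pow 3).const_mul 2)).congr_deriv (by push_cast; ring)) (by ring)

end JetFamilies

/-! ### Solutions of the reduced system and jets -/

section Classification

open Filter Topology

variable {𝕜 F : Type*} [RCLike 𝕜] [RCLike F] [NormedAlgebra 𝕜 F] {B C : Set 𝕜} {g : 𝕜 → 𝕜 → 𝕜}
  {h : 𝕜 → 𝕜} (hB : IsOpen B) (hC : IsOpen C)
  (hg : ContDiffOn 𝕜 ∞ (fun x : 𝕜 × 𝕜 => g x.1 x.2) (B ×ˢ C))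
  (h0 : ∀ b ∈ B, ∀ c ∈ C, g b c ≠ 0) (hh : ContDiffOn 𝕜 ∞ h C)
include hB hC hg h0 hh

/-- A solution of the reduced system coincides with a jet that has the same value at a point. -/
theorem ReducedSystem.eq_of_isJet (hB' : IsPreconnected B) (hC' : IsPreconnected C)
    (R : ReducedSystem B C g h) (hch : ∀ c ∈ C, ChazyAt h c) {G W V P : 𝕜 → 𝕜 → F}
    (hG : ContinuousOn (fun x : 𝕜 × 𝕜 => G x.1 x.2) (B ×ˢ C))
    (J : IsJet {x ∈ B ×ˢ C | G x.1 x.2 ≠ 0} G W V P (fun c => algebraMap 𝕜 F (h c))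
      (fun c => algebraMap 𝕜 F (deriv h c))) {b₀ c₀ : 𝕜} (hb₀ : b₀ ∈ B) (hc₀ : c₀ ∈ C)
    (eg : algebraMap 𝕜 F (g b₀ c₀) = G b₀ c₀) (ew : algebraMap 𝕜 F (logB g b₀ c₀) = W b₀ c₀)
    (ev : algebraMap 𝕜 F (negLogDerivTwo g b₀ c₀) = V b₀ c₀)
    (ep : algebraMap 𝕜 F (pb (negLogDerivTwo g) b₀ c₀) = P b₀ c₀) {b c : 𝕜} (hb : b ∈ B)
    (hc : c ∈ C) : algebraMap 𝕜 F (g b c) = G b c := by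
  have hι : ContDiff 𝕜 ∞ (fun c => algebraMap 𝕜 F c) := (algebraMapCLM 𝕜 F).contDiff
  refine ((R.heatJet hB hC hg h0).isJet
    (fun b c hx => R.second_order hB hC hg h0 hh hch hx)).lift.eq_of_eq
    (hB'.prod hC') (fun b c hx => ?_) hG J (fun b c hx => ?_) (fun b c hx => ?_)
    ⟨hb₀, hc₀⟩ eg ew ev ep ⟨hb, hc⟩
  · exact (map_ne_zero _).2 (h0 b hx.1 c hx.2)
  · exact hι.contDiffAt.comp c (hh.contDiffAt (hC.mem_nhds hx.2)) |>.of_le (by simp)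
  · exact hι.contDiffAt.comp c ((contDiffOn_deriv hC hh).contDiffAt (hC.mem_nhds hx.2))
      |>.of_le (by simp)

omit hh in
/-- A jet on the curve `p² = 4v³ + 4hv² + 8h'v + (8/3)h''` is a solution of the reduced system. -/
theorem reducedSystem_of_isJet {w v p : 𝕜 → 𝕜 → F}
    (J : IsJet (B ×ˢ C) (fun b c => algebraMap 𝕜 F (g b c)) w v p
      (fun c => algebraMap 𝕜 F (h c)) (fun c => algebraMap 𝕜 F (deriv h c)))
    (hp : ∀ b ∈ B, ∀ c ∈ C, p b c ^ 2 = 4 * v b c ^ 3 + 4 * algebraMap 𝕜 F (h c) * v b c ^ 2 +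
      8 * algebraMap 𝕜 F (deriv h c) * v b c + 8 / 3 * algebraMap 𝕜 F (deriv (deriv h) c)) :
    ReducedSystem B C g h := by
  have hΩ : IsOpen (B ×ˢ C) := hB.prod hC
  have hg' : SmoothOn (B ×ˢ C) g := hg
  have h0' : ∀ b c, (b, c) ∈ B ×ˢ C → g b c ≠ 0 := fun b c hx => h0 b hx.1 c hx.2
  have hinj : Function.Injective (algebraMap 𝕜 F) := (algebraMap 𝕜 F).injective
  have push : ∀ {f : 𝕜 → 𝕜} {f' b : 𝕜}, HasDerivAt f f' b →
      HasDerivAt (fun t => algebraMap 𝕜 F (f t)) (algebraMap 𝕜 F f') b := fun {f f' b} hf =>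
    ((algebraMapCLM 𝕜 F).hasFDerivAt.comp_hasDerivAt b hf)
  -- The jet equations in the `b`-direction identify `w`, `v`, `p` successively with the derivatives
  -- attached to `g`; the first identification divides by `g`.
  have ew : ∀ b c, (b, c) ∈ B ×ˢ C → w b c = algebraMap 𝕜 F (logB g b c) := by
    intro b c hx
    have h1 := (hasDerivAt_fst_of_grad (J.dg b c hx)).unique (push (hg'.hasDerivAt_mul_logB hΩ h0' hx))
    rw [map_mul] at h1
    exact mul_left_cancel₀ ((map_ne_zero _).2 (h0' b c hx)) h1
  have ev : ∀ b c, (b, c) ∈ B ×ˢ C → v b c = algebraMap 𝕜 F (negLogDerivTwo g b c) := by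
    intro b c hx
    have h1 := ((hasDerivAt_fst_of_grad (J.dw b c hx)).congr_of_eventuallyEq (by
      filter_upwards [eventually_slice_fst hΩ hx] with t ht using (ew t c ht).symm)).unique
      (push (hg'.hasDerivAt_logB hΩ h0' hx))
    rw [map_neg] at h1
    exact neg_injective h1
  have ep : ∀ b c, (b, c) ∈ B ×ˢ C → p b c = algebraMap 𝕜 F (pb (negLogDerivTwo g) b c) := by
    intro b c hx
    exact ((hasDerivAt_fst_of_grad (J.dv b c hx)).congr_of_eventuallyEq (by
      filter_upwards [eventually_slice_fst hΩ hx] with t ht using (ev t c ht).symm)).unique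
      (push ((hg'.negLogDerivTwo hΩ h0').hasDerivAt_fst hΩ hx))
  refine ⟨fun b hb c hc => ?_, fun b hb c hc => ?_⟩
  · have hx : (b, c) ∈ B ×ˢ C := ⟨hb, hc⟩
    have h1 := (hasDerivAt_snd_of_grad (J.dg b c hx)).unique (push (hg'.hasDerivAt_snd hΩ hx))
    rw [ew b c hx, ev b c hx] at h1
    rw [iteratedDeriv_two_slice, hg'.pb_pb hΩ h0' hx]
    refine hinj ?_
    change algebraMap 𝕜 F (pc g b c) = _
    rw [← h1]
    simp only [map_mul, map_sub, map_pow, map_div₀, map_one, map_ofNat]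
    ring
  · have hx : (b, c) ∈ B ×ˢ C := ⟨hb, hc⟩
    refine hinj ?_
    have h1 := hp b hb c hc
    rw [ep b c hx, ev b c hx] at h1
    rw [iteratedDeriv_two]
    simp only [map_mul, map_add, map_pow, map_div₀, map_ofNat]
    exact h1

end Classification

/-! ### The rational and trigonometric cases -/

section ConstantSolutions

variable {𝕜 : Type*} [RCLike 𝕜]

lemma chazyAt_const (k c : 𝕜) : ChazyAt (fun _ => k) c := by
  simp [ChazyAt, iteratedDeriv_succ, iteratedDeriv_zero]

lemma normedSpace_exp_add (x y : 𝕜) :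
    NormedSpace.exp (x + y) = NormedSpace.exp x * NormedSpace.exp y := by
  let _ : NormedAlgebra ℚ 𝕜 := NormedAlgebra.restrictScalars ℚ ℝ 𝕜
  exact NormedSpace.exp_add

lemma normedSpace_exp_mul_exp_neg (x : 𝕜) : NormedSpace.exp x * NormedSpace.exp (-x) = 1 := by
  rw [← normedSpace_exp_add, add_neg_cancel, NormedSpace.exp_zero]

/-- The substitution `x = x'`, `y = μx' + y'` gives `u_x'x' = a + 2μb + μ²c` and `u_x'y' = b + μc`,
which are the total exponent of `e^a g` and the argument of `Y`. -/
lemma isDegenerate_expDensity {B C : Set 𝕜} {g : 𝕜 → 𝕜 → 𝕜} {μ : 𝕜} (Y : 𝕜 → 𝕜)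
    (hg : ∀ b ∈ B, ∀ c ∈ C, g b c = NormedSpace.exp (2 * μ * b + μ ^ 2 * c) * Y (b + μ * c)) :
    IsDegenerate (Set.univ ×ˢ B ×ˢ C) (expDensity g) := by
  refine ⟨1, μ, 0, 1, fun X Z => NormedSpace.exp X * Y Z, by simp, ?_⟩
  rintro a b c ⟨-, hb, hc⟩
  have h1 : (1 : 𝕜) ^ 2 * a + 2 * 1 * μ * b + μ ^ 2 * c = a + (2 * μ * b + μ ^ 2 * c) := by ring
  have h2 : (1 : 𝕜) * 0 * a + (1 * 1 + μ * 0) * b + μ * 1 * c = b + μ * c := by ring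
  simp only [h1, h2]
  rw [expDensity, hg b hb c hc, normedSpace_exp_add a]
  ring

variable {B C : Set 𝕜} {g : 𝕜 → 𝕜 → 𝕜} (hB : IsOpen B) (hC : IsOpen C)
  (hg : ContDiffOn 𝕜 ∞ (fun x : 𝕜 × 𝕜 => g x.1 x.2) (B ×ˢ C))
  (h0 : ∀ b ∈ B, ∀ c ∈ C, g b c ≠ 0)
include hB hC hg h0

/-- Solutions of the reduced system with constant `h` that are Galilei transforms of jets
depending on `b` only. -/
lemma ReducedSystem.eq_galilei_of_const (hB' : IsConnected B) (hC' : IsConnected C) {k : 𝕜}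
    (R : ReducedSystem B C g fun _ => k) {b₀ c₀ μ : 𝕜} (G W V P : 𝕜 → 𝕜)
    (J : IsJet {x : 𝕜 × 𝕜 | G x.1 ≠ 0} (fun b _ => G b) (fun b _ => W b) (fun b _ => V b)
      (fun b _ => P b) (fun _ => k) (fun _ => 0)) (hG : Continuous G)
    (hb₀ : b₀ ∈ B) (hc₀ : c₀ ∈ C)
    (eg : g b₀ c₀ = NormedSpace.exp (2 * μ * b₀ + μ ^ 2 * c₀) * G (b₀ + μ * c₀))
    (ew : logB g b₀ c₀ = 2 * μ + W (b₀ + μ * c₀)) (ev : negLogDerivTwo g b₀ c₀ = V (b₀ + μ * c₀))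
    (ep : pb (negLogDerivTwo g) b₀ c₀ = P (b₀ + μ * c₀)) :
    ∀ b ∈ B, ∀ c ∈ C,
      g b c = NormedSpace.exp (2 * μ * b + μ ^ 2 * c) * G (b + μ * c) := by
  intro b hb c hc
  have J1 := J.galilei μ 0 1
  simp only [add_zero, one_mul] at J1
  have hE : Continuous fun x : 𝕜 × 𝕜 => NormedSpace.exp (2 * μ * x.1 + μ ^ 2 * x.2) :=
    (continuous_iff_continuousAt.2 fun x : 𝕜 => (hasDerivAt_exp (x := x)).continuousAt).comp
      (by fun_prop)
  have hΦ : Continuous fun x : 𝕜 × 𝕜 =>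
      NormedSpace.exp (2 * μ * x.1 + μ ^ 2 * x.2) * G (x.1 + μ * x.2) :=
    hE.mul (hG.comp (by fun_prop))
  have J2 := J1.mono (Ω' := {x ∈ B ×ˢ C |
      NormedSpace.exp (2 * μ * x.1 + μ ^ 2 * x.2) * G (x.1 + μ * x.2) ≠ 0})
    ((hB.prod hC).inter (isOpen_ne_fun hΦ continuous_const)) (fun x hx => right_ne_zero_of_mul hx.2)
  refine R.eq_of_isJet (F := 𝕜) hB hC hg h0 contDiffOn_const hB'.isPreconnected hC'.isPreconnected
    (fun c _ => chazyAt_const k c) (G := fun b c =>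
      NormedSpace.exp (2 * μ * b + μ ^ 2 * c) * G (b + μ * c))
    (W := fun b c => 2 * μ + W (b + μ * c)) (V := fun b c => V (b + μ * c))
    (P := fun b c => P (b + μ * c)) hΦ.continuousOn ?_ hb₀ hc₀ eg ew ev ep
    hb hc
  simpa using J2

lemma reducedSystem_of_galilei_const {k μ : 𝕜} (G W V P : 𝕜 → 𝕜)
    (J : IsJet {x : 𝕜 × 𝕜 | G x.1 ≠ 0} (fun b _ => G b) (fun b _ => W b) (fun b _ => V b)
      (fun b _ => P b) (fun _ => k) (fun _ => 0))
    (hP : ∀ b, G b ≠ 0 → P b ^ 2 = 4 * V b ^ 3 + 4 * k * V b ^ 2)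
    (H : ∀ b ∈ B, ∀ c ∈ C, g b c = NormedSpace.exp (2 * μ * b + μ ^ 2 * c) * G (b + μ * c)) :
    ReducedSystem B C g fun _ => k := by
  have J1 := J.galilei μ 0 1
  simp only [add_zero, one_mul] at J1
  have hne : ∀ b ∈ B, ∀ c ∈ C, G (b + μ * c) ≠ 0 := fun b hb c hc h => h0 b hb c hc <| by
    rw [H b hb c hc, h, mul_zero]
  have J2 := J1.mono (hB.prod hC) fun x hx => hne x.1 hx.1 x.2 hx.2
  refine reducedSystem_of_isJet (F := 𝕜) hB hC hg h0 (w := fun b c => 2 * μ + W (b + μ * c))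
    (v := fun b c => V (b + μ * c)) (p := fun b c => P (b + μ * c)) ?_ ?_
  · refine ⟨J2.isOpen, fun b c hx => ?_, ?_, ?_, ?_⟩
    · have h1 := (J2.dg b c hx).congr_of_eventuallyEq (f₁ := fun x : 𝕜 × 𝕜 => g x.1 x.2) (by
        filter_upwards [J2.isOpen.mem_nhds hx] with x hx using H x.1 hx.1 x.2 hx.2)
      rw [← H b hx.1 c hx.2] at h1
      exact h1
    · simpa using J2.dw
    · simpa using J2.dv
    · simpa using J2.dp
  · intro b hb c hc
    simpa using hP _ (hne b hb c hc)

lemma reducedSystem_zero_iff (hB' : IsConnected B) (hC' : IsConnected C) :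
    ReducedSystem B C g (fun _ => 0) ↔
      ∃ μ K L : 𝕜, ∀ b ∈ B, ∀ c ∈ C,
        g b c = NormedSpace.exp (2 * μ * b + μ ^ 2 * c) * (K * (b + μ * c) + L) := by
  constructor
  · intro R
    obtain ⟨b₀, hb₀⟩ := hB'.nonempty
    obtain ⟨c₀, hc₀⟩ := hC'.nonempty
    have hsq := R.sq_eq (b := b₀) (c := c₀) ⟨hb₀, hc₀⟩
    simp only [mul_zero, zero_mul, add_zero, deriv_const'] at hsq
    -- Parametrization of the cuspidal cubic `p² = 4v³` by `r = -p / (2v)`, with `r = 0` at the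
    -- cusp.
    obtain ⟨r, hr2, hr3⟩ : ∃ r : 𝕜, negLogDerivTwo g b₀ c₀ = r ^ 2 ∧
        pb (negLogDerivTwo g) b₀ c₀ = -2 * r ^ 3 := by
      generalize negLogDerivTwo g b₀ c₀ = v at hsq
      generalize pb (negLogDerivTwo g) b₀ c₀ = p at hsq
      by_cases hv : v = 0
      · subst hv
        exact ⟨0, by simp, by simpa using hsq⟩
      · have h2 : v = (-p / (2 * v)) ^ 2 := by
          field_simp
          linear_combination -hsq
        refine ⟨-p / (2 * v), h2, ?_⟩
        rw [pow_succ, ← h2]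
        field_simp
    -- The equation `w = 2μ + r` fixes `μ`. The linear factor must have the value `A` at `b₀ + μc₀`
    -- and the slope `rA`, which fixes its coefficients.
    set μ := (logB g b₀ c₀ - r) / 2 with hμ
    set A := g b₀ c₀ / NormedSpace.exp (2 * μ * b₀ + μ ^ 2 * c₀) with hA
    have hE := normedSpace_exp_ne_zero (2 * μ * b₀ + μ ^ 2 * c₀)
    have hA0 : A ≠ 0 := div_ne_zero (h0 b₀ hb₀ c₀ hc₀) hE
    have hval : r * A * (b₀ + μ * c₀) + (A - r * A * (b₀ + μ * c₀)) = A := by ring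
    have hr : r * A / A = r := mul_div_cancel_right₀ r hA0
    refine ⟨μ, r * A, A - r * A * (b₀ + μ * c₀), ?_⟩
    refine R.eq_galilei_of_const hB hC hg h0 hB' hC'
      (fun b => (r * A) * b + (A - r * A * (b₀ + μ * c₀))) (fun b => (r * A) / ((r * A) * b + (A - r * A * (b₀ + μ * c₀))))
      (fun b => ((r * A) / ((r * A) * b + (A - r * A * (b₀ + μ * c₀)))) ^ 2) (fun b => -2 * ((r * A) / ((r * A) * b + (A - r * A * (b₀ + μ * c₀)))) ^ 3)
      (isJet_rational (r * A) (A - r * A * (b₀ + μ * c₀))) (by fun_prop) hb₀ hc₀ ?_ ?_ ?_ ?_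
    · rw [hval, hA, mul_div_cancel₀ _ hE]
    · rw [hval, hr, hμ]
      ring
    · rw [hval, hr, hr2]
    · rw [hval, hr, hr3]
  · rintro ⟨μ, K, L, H⟩
    exact reducedSystem_of_galilei_const hB hC hg h0
      (fun b => K * b + L) (fun b => K / (K * b + L))
      (fun b => (K / (K * b + L)) ^ 2) (fun b => -2 * (K / (K * b + L)) ^ 3) (isJet_rational K L)
      (fun b _ => by ring) H

lemma reducedSystem_one_iff (hB' : IsConnected B) (hC' : IsConnected C) :
    ReducedSystem B C g (fun _ => 1) ↔
      ∃ μ K L : 𝕜, ∀ b ∈ B, ∀ c ∈ C,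
        g b c = NormedSpace.exp (2 * μ * b + μ ^ 2 * c) *
          (K * NormedSpace.exp (b + μ * c) + L * NormedSpace.exp (-(b + μ * c))) := by
  have hcont : Continuous fun b : 𝕜 => NormedSpace.exp b :=
    continuous_iff_continuousAt.2 fun x : 𝕜 => (hasDerivAt_exp (x := x)).continuousAt
  constructor
  · intro R
    obtain ⟨b₀, hb₀⟩ := hB'.nonempty
    obtain ⟨c₀, hc₀⟩ := hC'.nonempty
    have hsq := R.sq_eq (b := b₀) (c := c₀) ⟨hb₀, hc₀⟩
    simp only [mul_zero, zero_mul, add_zero, mul_one, deriv_const'] at hsq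
    -- The same parameter for the nodal cubic `p² = 4v²(v + 1)`; at the node both `r = 1` and `r =
    -- -1` would do.
    obtain ⟨r, hr2, hr3⟩ : ∃ r : 𝕜, negLogDerivTwo g b₀ c₀ = r ^ 2 - 1 ∧
        pb (negLogDerivTwo g) b₀ c₀ = 2 * r - 2 * r ^ 3 := by
      generalize negLogDerivTwo g b₀ c₀ = v at hsq
      generalize pb (negLogDerivTwo g) b₀ c₀ = p at hsq
      by_cases hv : v = 0
      · subst hv
        exact ⟨1, by simp, by simpa using hsq⟩
      · have h2 : v = (-p / (2 * v)) ^ 2 - 1 := by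
          field_simp
          linear_combination -hsq
        refine ⟨-p / (2 * v), h2, ?_⟩
        have h3 : 2 * (-p / (2 * v)) - 2 * (-p / (2 * v)) ^ 3 =
          -2 * (-p / (2 * v)) * ((-p / (2 * v)) ^ 2 - 1) := by ring
        rw [h3, ← h2]
        field_simp
    set μ := (logB g b₀ c₀ - r) / 2 with hμ
    set A := g b₀ c₀ / NormedSpace.exp (2 * μ * b₀ + μ ^ 2 * c₀) with hA
    have hE := normedSpace_exp_ne_zero (2 * μ * b₀ + μ ^ 2 * c₀)
    have hA0 : A ≠ 0 := div_ne_zero (h0 b₀ hb₀ c₀ hc₀) hE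
    have hX := normedSpace_exp_mul_exp_neg (b₀ + μ * c₀)
    -- `K` and `L` are chosen so that the combination of exponentials has the value `A` and the
    -- derivative `rA` at `b₀ + μc₀`.
    set K := A * (1 + r) / 2 * NormedSpace.exp (-(b₀ + μ * c₀)) with hK
    set L := A * (1 - r) / 2 * NormedSpace.exp (b₀ + μ * c₀) with hL
    have e1 : K * NormedSpace.exp (b₀ + μ * c₀) + L * NormedSpace.exp (-(b₀ + μ * c₀)) = A := by
      rw [hK, hL]
      linear_combination A * hX
    have e2 : K * NormedSpace.exp (b₀ + μ * c₀) - L * NormedSpace.exp (-(b₀ + μ * c₀)) = r * A := by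
      rw [hK, hL]
      linear_combination r * A * hX
    have hr : r * A / A = r := mul_div_cancel_right₀ r hA0
    refine ⟨μ, K, L, ?_⟩
    refine R.eq_galilei_of_const hB hC hg h0 hB' hC'
      (fun b => K * NormedSpace.exp b + L * NormedSpace.exp (-b))
      (fun b => (K * NormedSpace.exp b - L * NormedSpace.exp (-b)) /
        (K * NormedSpace.exp b + L * NormedSpace.exp (-b)))
      (fun b => ((K * NormedSpace.exp b - L * NormedSpace.exp (-b)) /
        (K * NormedSpace.exp b + L * NormedSpace.exp (-b))) ^ 2 - 1)
      (fun b => 2 * ((K * NormedSpace.exp b - L * NormedSpace.exp (-b)) /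
        (K * NormedSpace.exp b + L * NormedSpace.exp (-b))) - 2 * ((K * NormedSpace.exp b - L * NormedSpace.exp (-b)) /
        (K * NormedSpace.exp b + L * NormedSpace.exp (-b))) ^ 3)
      (isJet_trigonometric K L) (by fun_prop) hb₀ hc₀ ?_ ?_ ?_ ?_
    · rw [e1, hA, mul_div_cancel₀ _ hE]
    · rw [e1, e2, hr, hμ]
      ring
    · rw [e1, e2, hr, hr2]
    · rw [e1, e2, hr, hr3]
  · rintro ⟨μ, K, L, H⟩
    exact reducedSystem_of_galilei_const hB hC hg h0
      (fun b => K * NormedSpace.exp b + L * NormedSpace.exp (-b))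
      (fun b => (K * NormedSpace.exp b - L * NormedSpace.exp (-b)) /
        (K * NormedSpace.exp b + L * NormedSpace.exp (-b)))
      (fun b => ((K * NormedSpace.exp b - L * NormedSpace.exp (-b)) /
        (K * NormedSpace.exp b + L * NormedSpace.exp (-b))) ^ 2 - 1)
      (fun b => 2 * ((K * NormedSpace.exp b - L * NormedSpace.exp (-b)) /
        (K * NormedSpace.exp b + L * NormedSpace.exp (-b))) - 2 * ((K * NormedSpace.exp b - L * NormedSpace.exp (-b)) /
        (K * NormedSpace.exp b + L * NormedSpace.exp (-b))) ^ 3) (isJet_trigonometric K L)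
      (fun b _ => by ring) H

end ConstantSolutions

/-! ### The Chazy equation modulo its `SL(2)`-symmetry -/

section Chazy

open Filter Topology

/-- A solution of the Chazy equation on an open set with its first two derivatives. -/
structure ChazyJet {𝕜 : Type*} [RCLike 𝕜] (D : Set 𝕜) (h h₁ h₂ : 𝕜 → 𝕜) : Prop where
  isOpen : IsOpen D
  d₀ : ∀ c ∈ D, HasDerivAt h (h₁ c) c
  d₁ : ∀ c ∈ D, HasDerivAt h₁ (h₂ c) c
  d₂ : ∀ c ∈ D, HasDerivAt h₂ (2 * h c * h₂ c - 3 * h₁ c ^ 2) c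

namespace ChazyJet

variable {𝕜 : Type*} [RCLike 𝕜] {D D' : Set 𝕜} {h h₁ h₂ k k₁ k₂ : 𝕜 → 𝕜} {c : 𝕜}

lemma of_chazyAt (hD : IsOpen D) (hh : ContDiffOn 𝕜 ∞ h D) (hch : ∀ c ∈ D, ChazyAt h c) :
    ChazyJet D h (deriv h) (deriv (deriv h)) :=
  ⟨hD, fun _ hc => contDiffOn_hasDerivAt hD hh hc,
    fun _ hc => contDiffOn_hasDerivAt hD (contDiffOn_deriv hD hh) hc,
    fun c hc => (chazyAt_iff_hasDerivAt hD hh hc).1 (hch c hc)⟩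

lemma deriv_eq (J : ChazyJet D h h₁ h₂) (hc : c ∈ D) : deriv h c = h₁ c := (J.d₀ c hc).deriv

lemma hasDerivAt_deriv (J : ChazyJet D h h₁ h₂) (hc : c ∈ D) : HasDerivAt (deriv h) (h₂ c) c :=
  (J.d₁ c hc).congr_of_eventuallyEq (by
    filter_upwards [J.isOpen.mem_nhds hc] with t ht using J.deriv_eq ht)

lemma deriv_deriv_eq (J : ChazyJet D h h₁ h₂) (hc : c ∈ D) : deriv (deriv h) c = h₂ c :=
  (J.hasDerivAt_deriv hc).deriv

lemma chazyAt (J : ChazyJet D h h₁ h₂) (hc : c ∈ D) : ChazyAt h c := by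
  have h3 : deriv (deriv (deriv h)) c = 2 * h c * h₂ c - 3 * h₁ c ^ 2 :=
    ((J.d₂ c hc).congr_of_eventuallyEq (by
      filter_upwards [J.isOpen.mem_nhds hc] with t ht using J.deriv_deriv_eq ht)).deriv
  rw [ChazyAt, iteratedDeriv_succ, iteratedDeriv_two, h3, J.deriv_deriv_eq hc, J.deriv_eq hc]

lemma eventuallyEq (J : ChazyJet D h h₁ h₂) (J' : ChazyJet D' k k₁ k₂) (hc : c ∈ D) (hc' : c ∈ D')
    (e₀ : h c = k c) (e₁ : h₁ c = k₁ c) (e₂ : h₂ c = k₂ c) : h =ᶠ[𝓝 c] k := by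
  let Ψ : 𝕜 × (𝕜 × 𝕜 × 𝕜) → 𝕜 →L[𝕜] (𝕜 × 𝕜 × 𝕜) := fun z =>
    (ContinuousLinearMap.id 𝕜 𝕜).smulRight
      (z.2.2.1, z.2.2.2, 2 * z.2.1 * z.2.2.2 - 3 * z.2.2.1 ^ 2)
  have hΨ : ContDiffAt 𝕜 1 Ψ (c, (h c, h₁ c, h₂ c)) :=
    contDiffAt_const.smulRight (by fun_prop)
  have := eventuallyEq_of_hasFDerivAt (Ψ := Ψ) (x₀ := c) (f₁ := fun c => (h c, h₁ c, h₂ c))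
    (f₂ := fun c => (k c, k₁ c, k₂ c)) hΨ
    (by
      filter_upwards [J.isOpen.mem_nhds hc] with x hx
      exact ((J.d₀ x hx).prodMk ((J.d₁ x hx).prodMk (J.d₂ x hx))).hasFDerivAt)
    (by
      filter_upwards [J'.isOpen.mem_nhds hc'] with x hx
      exact ((J'.d₀ x hx).prodMk ((J'.d₁ x hx).prodMk (J'.d₂ x hx))).hasFDerivAt)
    (by simp [e₀, e₁, e₂])
  filter_upwards [this] with x hx using congrArg Prod.fst hx

end ChazyJet

variable {α β γ δ c c₀ : ℂ} {D : Set ℂ} {h h₁ h₂ : ℂ → ℂ}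

lemma hasDerivAt_moebius (hdet : α * δ - β * γ = 1) (hs : γ * c + δ ≠ 0) :
    HasDerivAt (fun c => (α * c + β) / (γ * c + δ)) (1 / (γ * c + δ) ^ 2) c := by
  have h1 := (((hasDerivAt_id c).const_mul α).add_const β).div
    (((hasDerivAt_id c).const_mul γ).add_const δ) hs
  refine h1.congr_deriv ?_
  congr 1
  simp only [id]
  linear_combination hdet

lemma hasDerivAt_inv_pow (hs : γ * c + δ ≠ 0) (n : ℕ) :
    HasDerivAt (fun c => 1 / (γ * c + δ) ^ n) (-(n : ℂ) * γ / (γ * c + δ) ^ (n + 1)) c := by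
  have h1 := ((((hasDerivAt_id c).const_mul γ).add_const δ).inv hs).pow n
  refine (h1.congr_of_eventuallyEq (Eventually.of_forall fun t => by simp)).congr_deriv ?_
  simp only [id, Pi.inv_apply]
  rcases n with - | n
  · simp
  · rw [Nat.add_sub_cancel]
    push_cast
    generalize γ * c + δ = s at hs ⊢
    rw [inv_pow]
    field_simp
    ring

/-- The derivative of `f(mc) / (γc + δ)ⁿ`. -/
lemma hasDerivAt_comp_moebius (hdet : α * δ - β * γ = 1) (hs : γ * c + δ ≠ 0) {f : ℂ → ℂ} {f' : ℂ}
    (hf : HasDerivAt f f' ((α * c + β) / (γ * c + δ))) (n : ℕ) :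
    HasDerivAt (fun c => f ((α * c + β) / (γ * c + δ)) / (γ * c + δ) ^ n)
      (f' / (γ * c + δ) ^ (n + 2)
        - n * γ * f ((α * c + β) / (γ * c + δ)) / (γ * c + δ) ^ (n + 1)) c := by
  have h1 := (hf.comp c (hasDerivAt_moebius hdet hs)).mul (hasDerivAt_inv_pow hs n)
  refine (h1.congr_of_eventuallyEq (Eventually.of_forall fun t => ?_)).congr_deriv ?_
  · simp [div_eq_mul_inv]
  · simp only [Function.comp]
    field_simp
    ring

/-- With `s = γc + δ` the Möbius map has derivative `s⁻²`, so the derivatives of the transform are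
polynomials in `h, h', h''` at the image point, `γ` and `s⁻¹`. The Chazy equation for the transform
is then an identity of rational functions. -/
lemma ChazyJet.chazyTransform (J : ChazyJet D h h₁ h₂) (hdet : α * δ - β * γ = 1) :
    ChazyJet {c | γ * c + δ ≠ 0 ∧ (α * c + β) / (γ * c + δ) ∈ D}
      (chazyTransform α β γ δ h)
      (fun c => h₁ ((α * c + β) / (γ * c + δ)) / (γ * c + δ) ^ 4
        - 2 * γ * (h ((α * c + β) / (γ * c + δ)) / (γ * c + δ) ^ 3)
        + 6 * γ ^ 2 * (1 / (γ * c + δ) ^ 2))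
      (fun c => h₂ ((α * c + β) / (γ * c + δ)) / (γ * c + δ) ^ 6
        - 6 * γ * (h₁ ((α * c + β) / (γ * c + δ)) / (γ * c + δ) ^ 5)
        + 6 * γ ^ 2 * (h ((α * c + β) / (γ * c + δ)) / (γ * c + δ) ^ 4)
        - 12 * γ ^ 3 * (1 / (γ * c + δ) ^ 3)) where
  isOpen := by
    have hs : IsOpen {c : ℂ | γ * c + δ ≠ 0} := isOpen_ne_fun (by fun_prop) (by fun_prop)
    refine ContinuousOn.isOpen_inter_preimage (f := fun c => (α * c + β) / (γ * c + δ)) ?_ hs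
      J.isOpen
    exact ContinuousOn.div (by fun_prop) (by fun_prop) fun c hc => hc
  d₀ c hc := by
    obtain ⟨hs, hm⟩ := hc
    have h1 := (hasDerivAt_comp_moebius hdet hs (J.d₀ _ hm) 2).sub
      ((hasDerivAt_inv_pow hs 1).const_mul (6 * γ))
    refine (h1.congr_of_eventuallyEq (Eventually.of_forall fun t => ?_)).congr_deriv ?_
    · simp [SecondOrderLagrangian.chazyTransform, div_eq_mul_inv]
    · push_cast
      ring
  d₁ c hc := by
    obtain ⟨hs, hm⟩ := hc
    have h1 := ((hasDerivAt_comp_moebius hdet hs (J.d₁ _ hm) 4).sub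
      ((hasDerivAt_comp_moebius hdet hs (J.d₀ _ hm) 3).const_mul (2 * γ))).add
      ((hasDerivAt_inv_pow hs 2).const_mul (6 * γ ^ 2))
    refine h1.congr_deriv ?_
    push_cast
    ring
  d₂ c hc := by
    obtain ⟨hs, hm⟩ := hc
    have h1 := (((hasDerivAt_comp_moebius hdet hs (J.d₂ _ hm) 6).sub
      ((hasDerivAt_comp_moebius hdet hs (J.d₁ _ hm) 5).const_mul (6 * γ))).add
      ((hasDerivAt_comp_moebius hdet hs (J.d₀ _ hm) 4).const_mul (6 * γ ^ 2))).sub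
      ((hasDerivAt_inv_pow hs 3).const_mul (12 * γ ^ 3))
    refine h1.congr_deriv ?_
    simp only [SecondOrderLagrangian.chazyTransform]
    push_cast
    generalize h ((α * c + β) / (γ * c + δ)) = x
    generalize h₁ ((α * c + β) / (γ * c + δ)) = y
    generalize h₂ ((α * c + β) / (γ * c + δ)) = z
    generalize γ * c + δ = s at hs ⊢
    field_simp
    ring

lemma ChazyJet.invTwo_eq (J : ChazyJet D h h₁ h₂) (hc : c ∈ D) :
    invTwo h c = 4 / 3 * h c ^ 2 - 8 * h₁ c := by
  rw [invTwo, J.deriv_eq hc]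

lemma ChazyJet.invThree_eq (J : ChazyJet D h h₁ h₂) (hc : c ∈ D) :
    invThree h c = -(8 / 27) * h c ^ 3 + 8 / 3 * h c * h₁ c - 8 / 3 * h₂ c := by
  rw [invThree, J.deriv_eq hc, iteratedDeriv_two, J.deriv_deriv_eq hc]

/-- The invariants `g₂` and `g₃` characterize the equivalence of solutions of the Chazy equation. -/
lemma ChazyJet.chazyEquivAt_iff {D' : Set ℂ} {k k₁ k₂ : ℂ → ℂ} (J : ChazyJet D h h₁ h₂)
    (J' : ChazyJet D' k k₁ k₂) (hc : c₀ ∈ D) :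
    ChazyEquivAt k D' h c₀ ↔ ∃ τ ∈ D', ∃ s : ℂ, s ≠ 0 ∧ invTwo k τ = s ^ 4 * invTwo h c₀ ∧
      invThree k τ = s ^ 6 * invThree h c₀ := by
  constructor
  · rintro ⟨α, β, γ, δ, hdet, hs, hm, he⟩
    have T := J'.chazyTransform hdet
    have e1 : deriv h =ᶠ[𝓝 c₀] deriv (SecondOrderLagrangian.chazyTransform α β γ δ k) :=
      EventuallyEq.deriv he
    have x0 := he.self_of_nhds
    have x1 := e1.eq_of_nhds
    have x2 := e1.deriv_eq
    rw [J.deriv_eq hc, T.deriv_eq ⟨hs, hm⟩] at x1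
    rw [J.deriv_deriv_eq hc, T.deriv_deriv_eq ⟨hs, hm⟩] at x2
    refine ⟨_, hm, _, hs, ?_, ?_⟩
    · rw [J'.invTwo_eq hm, J.invTwo_eq hc, x0, x1, SecondOrderLagrangian.chazyTransform]
      generalize k ((α * c₀ + β) / (γ * c₀ + δ)) = x
      generalize k₁ ((α * c₀ + β) / (γ * c₀ + δ)) = y
      generalize γ * c₀ + δ = s at hs ⊢
      field_simp
      ring
    · rw [J'.invThree_eq hm, J.invThree_eq hc, x0, x1, x2, SecondOrderLagrangian.chazyTransform]
      generalize k ((α * c₀ + β) / (γ * c₀ + δ)) = x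
      generalize k₁ ((α * c₀ + β) / (γ * c₀ + δ)) = y
      generalize k₂ ((α * c₀ + β) / (γ * c₀ + δ)) = z
      generalize γ * c₀ + δ = s at hs ⊢
      field_simp
      ring
  · rintro ⟨τ, hτ, s, hs, i2, i3⟩
    rw [J'.invTwo_eq hτ, J.invTwo_eq hc] at i2
    rw [J'.invThree_eq hτ, J.invThree_eq hc] at i3
    -- At `c₀` the transform has the value `k(τ)/s² - 6γ/s`; equating it with `h(c₀)` fixes `γ`.
    -- Then `γc₀ + δ = s`, the condition that `c₀` goes to `τ`, and determinant 1 fix `δ, β, α`.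
    obtain ⟨γ, hγ⟩ : ∃ γ : ℂ, 6 * γ = s * (k τ / s ^ 2 - h c₀) :=
      ⟨s * (k τ / s ^ 2 - h c₀) / 6, by ring⟩
    have hsc : γ * c₀ + (s - γ * c₀) = s := by ring
    have hmc : ((1 / s + τ * γ) * c₀ + (τ * s - (1 / s + τ * γ) * c₀)) / s = τ := by
      field_simp
      ring
    have hdet : (1 / s + τ * γ) * (s - γ * c₀) - (τ * s - (1 / s + τ * γ) * c₀) * γ = 1 := by
      field_simp
      ring
    have T := J'.chazyTransform hdet
    have hmem : c₀ ∈ {c | γ * c + (s - γ * c₀) ≠ 0 ∧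
        ((1 / s + τ * γ) * c + (τ * s - (1 / s + τ * γ) * c₀)) / (γ * c + (s - γ * c₀)) ∈ D'} := by
      refine ⟨by rwa [hsc], ?_⟩
      rwa [hsc, hmc]
    -- It suffices to match the 2-jets at `c₀`. The values agree by the choice of `γ`; `g₂` contains
    -- `h'` linearly and `g₃` contains `h''` linearly, so the two weight relations give the first
    -- and second derivatives.
    refine ⟨_, _, _, _, hdet, hmem.1, hmem.2, J.eventuallyEq T hc hmem ?_ ?_ ?_⟩
    · rw [SecondOrderLagrangian.chazyTransform, hsc, hmc]
      field_simp
      field_simp at hγ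
      linear_combination hγ
    · rw [hsc, hmc]
      have hh : h c₀ = k τ / s ^ 2 - 6 * γ / s := by
        rw [hγ]
        field_simp
        ring
      rw [hh] at i2
      field_simp at i2 ⊢
      linear_combination i2 / 24
    · rw [hsc, hmc]
      have hh : h c₀ = k τ / s ^ 2 - 6 * γ / s := by
        rw [hγ]
        field_simp
        ring
      have hh1 : h₁ c₀ = k₁ τ / s ^ 4 - 2 * γ * (k τ / s ^ 3) + 6 * γ ^ 2 * (1 / s ^ 2) := by
        rw [hh] at i2
        field_simp at i2 ⊢
        linear_combination i2 / 24
      rw [hh1, hh] at i3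
      field_simp at i3 ⊢
      linear_combination i3 / 27

lemma chazyJet_const (k : ℂ) : ChazyJet Set.univ (fun _ : ℂ => k) (fun _ => 0) (fun _ => 0) :=
  ⟨isOpen_univ, fun c _ => hasDerivAt_const c k, fun c _ => hasDerivAt_const c 0,
    fun c _ => (hasDerivAt_const c 0).congr_deriv (by simp)⟩

lemma ChazyJet.chazyEquivAt_zero_iff (J : ChazyJet D h h₁ h₂) (hc : c₀ ∈ D) :
    ChazyEquivAt (fun _ => 0) Set.univ h c₀ ↔ invTwo h c₀ = 0 ∧ invThree h c₀ = 0 := by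
  rw [J.chazyEquivAt_iff (chazyJet_const 0) hc]
  simp only [(chazyJet_const 0).invTwo_eq (Set.mem_univ _),
    (chazyJet_const 0).invThree_eq (Set.mem_univ _)]
  constructor
  · rintro ⟨τ, -, s, hs, h2, h3⟩
    simp at h2 h3
    simpa [hs] using And.intro h2 h3
  · rintro ⟨h2, h3⟩
    exact ⟨0, trivial, 1, one_ne_zero, by simp [h2], by simp [h3]⟩

/-- The invariants of `h = 1` are `4/3` and `-8/27`, a non-zero point of the discriminant curve; the
weighted scaling is transitive on the non-zero points of that curve. -/
lemma ChazyJet.chazyEquivAt_one_iff (J : ChazyJet D h h₁ h₂) (hc : c₀ ∈ D) :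
    ChazyEquivAt (fun _ => 1) Set.univ h c₀ ↔
      invTwo h c₀ ^ 3 - 27 * invThree h c₀ ^ 2 = 0 ∧ invTwo h c₀ ≠ 0 := by
  rw [J.chazyEquivAt_iff (chazyJet_const 1) hc]
  simp only [(chazyJet_const 1).invTwo_eq (Set.mem_univ _),
    (chazyJet_const 1).invThree_eq (Set.mem_univ _)]
  generalize invTwo h c₀ = u
  generalize invThree h c₀ = v
  constructor
  · rintro ⟨τ, -, s, hs, h2, h3⟩
    have hu : u = 4 / 3 / s ^ 4 := by
      field_simp
      linear_combination -3 * h2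
    have hv : v = -(8 / 27) / s ^ 6 := by
      field_simp
      linear_combination -27 * h3
    subst hu hv
    refine ⟨?_, div_ne_zero (by norm_num) (pow_ne_zero _ hs)⟩
    field_simp
    norm_num
  · rintro ⟨hd, hu⟩
    have hv : v ≠ 0 := by
      rintro rfl
      exact hu (by simpa using hd)
    -- Dividing `s⁶v = -8/27` by `s⁴u = 4/3` leaves `s² = -(2/9)(u/v)`.
    obtain ⟨s, hs⟩ := IsAlgClosed.exists_pow_nat_eq (-(2 / 9) * (u / v)) (n := 2) (by norm_num)
    have hs4 : s ^ 4 = (-(2 / 9) * (u / v)) ^ 2 := by rw [← hs]; ring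
    have hs6 : s ^ 6 = (-(2 / 9) * (u / v)) ^ 3 := by rw [← hs]; ring
    refine ⟨0, trivial, s, ?_, ?_, ?_⟩
    · rintro rfl
      have h0 : -(2 / 9) * (u / v) = 0 := by rw [← hs]; simp
      simp [hu, hv] at h0
    · rw [hs4]
      field_simp
      linear_combination (-12) * hd
    · rw [hs6]
      field_simp
      linear_combination 648 * hd

/-- The type of a solution of the Chazy equation, once the elliptic solution is known to be
universal among those with non-zero discriminant. -/
lemma ChazyJet.existsUnique_model {e e₁ e₂ : ℂ → ℂ} {E : Set ℂ} (J : ChazyJet D h h₁ h₂)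
    (hc : c₀ ∈ D) (JE : ChazyJet E e e₁ e₂)
    (hE : ∀ τ ∈ E, invTwo e τ ^ 3 - 27 * invThree e τ ^ 2 ≠ 0)
    (hE' : ∀ u v : ℂ, u ^ 3 - 27 * v ^ 2 ≠ 0 → ∃ τ ∈ E, ∃ s : ℂ, s ≠ 0 ∧
      invTwo e τ = s ^ 4 * u ∧ invThree e τ = s ^ 6 * v) :
    ∃! k : Fin 3, ChazyEquivAt ((![fun _ => 0, fun _ => 1, e] : Fin 3 → ℂ → ℂ) k)
      ((![Set.univ, Set.univ, E] : Fin 3 → Set ℂ) k) h c₀ := by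
  have i0 := J.chazyEquivAt_zero_iff hc
  have i1 := J.chazyEquivAt_one_iff hc
  have i2 : ChazyEquivAt e E h c₀ ↔ invTwo h c₀ ^ 3 - 27 * invThree h c₀ ^ 2 ≠ 0 := by
    rw [J.chazyEquivAt_iff JE hc]
    refine ⟨?_, hE' _ _⟩
    rintro ⟨τ, hτ, s, hs, h2, h3⟩ h0
    refine hE τ hτ ?_
    rw [h2, h3]
    linear_combination s ^ 12 * h0
  by_cases hd : invTwo h c₀ ^ 3 - 27 * invThree h c₀ ^ 2 = 0
  · by_cases h2 : invTwo h c₀ = 0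
    · have h3 : invThree h c₀ = 0 := by simpa [h2] using hd
      refine ⟨0, i0.2 ⟨h2, h3⟩, fun k hk => ?_⟩
      fin_cases k
      · rfl
      · exact absurd h2 (i1.1 hk).2
      · exact absurd hd (i2.1 hk)
    · refine ⟨1, i1.2 ⟨hd, h2⟩, fun k hk => ?_⟩
      fin_cases k
      · exact absurd (i0.1 hk).1 h2
      · rfl
      · exact absurd hd (i2.1 hk)
  · refine ⟨2, i2.2 hd, fun k hk => ?_⟩
    fin_cases k
    · exact absurd (by rw [(i0.1 hk).1, (i0.1 hk).2]; simp) hd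
    · exact absurd (i1.1 hk).1 hd
    · rfl

end Chazy

/-! ### Smoothness of the theta series in both variables -/

section ThetaSeries

open Filter Topology Complex

lemma isOpen_upperHalf : IsOpen upperHalf := isOpen_lt continuous_const continuous_im

lemma isOpen_univ_prod_upperHalf : IsOpen ((Set.univ : Set ℂ) ×ˢ upperHalf) :=
  isOpen_univ.prod isOpen_upperHalf

/-- The `k`-th derivative in `z` of the Jacobi theta series. -/
def thetaSeries (k : ℕ) (z τ : ℂ) : ℂ :=
  ∑' n : ℤ, (2 * Real.pi * I * n) ^ k * jacobiTheta₂_term n z τ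

lemma thetaSeries_zero (z τ : ℂ) : thetaSeries 0 z τ = jacobiTheta₂ z τ := by
  simp [thetaSeries, jacobiTheta₂]

lemma norm_two_pi_I_mul_intCast (n : ℤ) : ‖(2 * Real.pi * I * n : ℂ)‖ = 2 * Real.pi * |(n : ℝ)| := by
  simp [abs_of_pos Real.pi_pos]

lemma summable_thetaSeries (k : ℕ) (z : ℂ) {τ : ℂ} (hτ : 0 < im τ) :
    Summable fun n : ℤ => (2 * Real.pi * I * n : ℂ) ^ k * jacobiTheta₂_term n z τ := by
  refine Summable.of_norm_bounded
    ((summable_pow_mul_jacobiTheta₂_term_bound |im z| hτ k).mul_left ((2 * Real.pi) ^ k))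
    fun n => ?_
  rw [norm_mul, norm_pow, norm_two_pi_I_mul_intCast, mul_pow, mul_assoc]
  push_cast
  gcongr
  simpa using norm_jacobiTheta₂_term_le hτ le_rfl le_rfl n

/-- On the `n`-th term `∂_z` acts as `2πin` and `∂_τ` as `πin² = (2πin)²/(4πi)`. Termwise
differentiation is justified by a bound uniform on `|Im z| < S`, `Im τ > T`. -/
lemma hasFDerivAt_thetaSeries (k : ℕ) (z : ℂ) {τ : ℂ} (hτ : 0 < im τ) :
    HasFDerivAt (fun x : ℂ × ℂ => thetaSeries k x.1 x.2)
      (grad ℂ (thetaSeries (k + 1) z τ) (thetaSeries (k + 2) z τ / (4 * Real.pi * I))) (z, τ) := by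
  obtain ⟨T, hT, hτ'⟩ := exists_between hτ
  obtain ⟨S, hz⟩ := exists_gt |im z|
  let V := {u : ℂ | |im u| < S} ×ˢ {v : ℂ | T < im v}
  have hVo : IsOpen V := (isOpen_lt (by fun_prop) (by fun_prop)).prod
    (isOpen_lt (by fun_prop) (by fun_prop))
  have hVmem : (z, τ) ∈ V := ⟨hz, hτ'⟩
  have hVp : IsPreconnected V := by
    refine (Convex.isPreconnected ?_).prod (convex_halfSpace_im_gt T).isPreconnected
    simpa only [abs_lt] using! (convex_halfSpace_im_gt _).inter (convex_halfSpace_im_lt _)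
  have h1 := hasFDerivAt_tsum_of_isPreconnected (𝕜 := ℂ)
    (f := fun (n : ℤ) (x : ℂ × ℂ) => (2 * Real.pi * I * n : ℂ) ^ k * jacobiTheta₂_term n x.1 x.2)
    (f' := fun (n : ℤ) (x : ℂ × ℂ) =>
      (2 * Real.pi * I * n : ℂ) ^ k • jacobiTheta₂_term_fderiv n x.1 x.2)
    (u := fun n : ℤ => (2 * Real.pi) ^ k * (3 * Real.pi) *
      (|n| ^ (k + 2) * Real.exp (-Real.pi * (T * n ^ 2 - 2 * S * |n|))))
    ((summable_pow_mul_jacobiTheta₂_term_bound S hT (k + 2)).mul_left _) hVo hVp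
    (fun n x _ => (hasFDerivAt_jacobiTheta₂_term n x.1 x.2).const_mul _) (fun n x hx => ?_) hVmem
    (summable_thetaSeries k z hτ) hVmem
  · refine h1.congr_fderiv ?_
    have e : (fun n : ℤ => (2 * Real.pi * I * n : ℂ) ^ k • jacobiTheta₂_term_fderiv n z τ) =
        fun n : ℤ => grad ℂ ((2 * Real.pi * I * n : ℂ) ^ (k + 1) * jacobiTheta₂_term n z τ)
          ((2 * Real.pi * I * n : ℂ) ^ (k + 2) * jacobiTheta₂_term n z τ / (4 * Real.pi * I)) := by
      funext n
      have hπ : (Real.pi : ℂ) ≠ 0 := by exact_mod_cast Real.pi_ne_zero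
      ext
      · simp only [jacobiTheta₂_term_fderiv, jacobiTheta₂_term]
        simp
        ring
      · simp only [jacobiTheta₂_term_fderiv, jacobiTheta₂_term]
        simp
        field_simp
        ring
    rw [e]
    have s1 := (summable_thetaSeries (k + 1) z hτ).hasSum
    have s2 := ((summable_thetaSeries (k + 2) z hτ).hasSum).div_const (4 * Real.pi * I)
    have s3 := (s1.mapL (ContinuousLinearMap.smulRightL ℂ (ℂ × ℂ) ℂ
      (ContinuousLinearMap.fst ℂ ℂ ℂ))).add (s2.mapL (ContinuousLinearMap.smulRightL ℂ (ℂ × ℂ) ℂ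
      (ContinuousLinearMap.snd ℂ ℂ ℂ)))
    exact s3.tsum_eq
  · rw [norm_smul, norm_pow, norm_two_pi_I_mul_intCast, mul_pow]
    have h2 := (norm_jacobiTheta₂_term_fderiv_le n x.1 x.2).trans
      (mul_le_mul_of_nonneg_left (norm_jacobiTheta₂_term_le hT (le_of_lt hx.1) (le_of_lt hx.2) n)
        (by positivity))
    refine (mul_le_mul_of_nonneg_left h2 (by positivity)).trans (le_of_eq ?_)
    push_cast
    ring

/-- The gradient is built from series of the same kind, so smoothness follows by induction on the
order. -/
lemma contDiffOn_thetaSeries (k : ℕ) : SmoothOn (Set.univ ×ˢ upperHalf) (thetaSeries k) := by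
  refine contDiffOn_infty.2 fun n => ?_
  induction n generalizing k with
  | zero =>
    exact contDiffOn_zero.2 fun x hx =>
      (hasFDerivAt_thetaSeries k x.1 hx.2).continuousAt.continuousWithinAt
  | succ n ih =>
    rw [Nat.cast_succ, contDiffOn_succ_iff_fderiv_of_isOpen isOpen_univ_prod_upperHalf]
    refine ⟨fun x hx =>
      (hasFDerivAt_thetaSeries k x.1 hx.2).differentiableAt.differentiableWithinAt, by simp, ?_⟩
    refine ContDiffOn.congr (f := fun x : ℂ × ℂ => grad ℂ (thetaSeries (k + 1) x.1 x.2)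
      (thetaSeries (k + 2) x.1 x.2 / (4 * Real.pi * I))) ?_
      fun x hx => (hasFDerivAt_thetaSeries k x.1 hx.2).fderiv
    exact (contDiffOn_const.smulRight (ih (k + 1))).add
      (contDiffOn_const.smulRight ((ih (k + 2)).div_const _))

end ThetaSeries

/-! ### Heat equation and quasi-periodicity of `θ₁` -/

section ThetaOne

open Filter Topology Complex

/-- The terms of indices `n` and `-(n + 1)` of the two-sided series combine to a sine; the shift by
`(τ + 1)/2` produces the half-integers and the signs. -/
lemma jacobiThetaOne_eq (z : ℂ) {τ : ℂ} (hτ : 0 < im τ) :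
    jacobiThetaOne z τ = -I * exp (Real.pi * I * τ / 4 + I * z) *
      thetaSeries 0 (z / Real.pi + (τ + 1) / 2) τ := by
  have hπ : (Real.pi : ℂ) ≠ 0 := by exact_mod_cast Real.pi_ne_zero
  rw [thetaSeries_zero]
  have h1 := (hasSum_jacobiTheta₂_term (z / Real.pi + (τ + 1) / 2) hτ).nat_add_neg_add_one
  have h2 := (h1.mul_left (-I * exp (Real.pi * I * τ / 4 + I * z))).tsum_eq
  rw [← h2, jacobiThetaOne, ← tsum_mul_left]
  refine tsum_congr fun n => ?_
  have e1 : exp (n * (Real.pi * I)) = (-1) ^ n := by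
    rw [exp_nat_mul, exp_pi_mul_I]
  have e2 : exp (-(n * (Real.pi * I))) = (-1) ^ n := by
    rw [Complex.exp_neg, e1, ← inv_pow, inv_neg, inv_one]
  have e3 : exp (-((n + 1) * (Real.pi * I))) = -(-1) ^ n := by
    rw [add_mul, one_mul, neg_add, Complex.exp_add, e2, Complex.exp_neg, exp_pi_mul_I]
    norm_num
  have f1 : exp (Real.pi * I * τ / 4 + I * z) * jacobiTheta₂_term n (z / Real.pi + (τ + 1) / 2) τ =
      (-1) ^ n * exp (Real.pi * I * τ * (n + 1 / 2) ^ 2) * exp ((2 * n + 1) * z * I) := by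
    rw [← e1, jacobiTheta₂_term, ← Complex.exp_add, ← Complex.exp_add, ← Complex.exp_add]
    congr 1
    push_cast
    field_simp
    ring
  have f2 : exp (Real.pi * I * τ / 4 + I * z) *
      jacobiTheta₂_term (-(n + 1)) (z / Real.pi + (τ + 1) / 2) τ =
      -((-1) ^ n * exp (Real.pi * I * τ * (n + 1 / 2) ^ 2) * exp (-((2 * n + 1) * z) * I)) := by
    rw [neg_mul_eq_neg_mul, neg_mul_eq_neg_mul, ← e3, jacobiTheta₂_term, ← Complex.exp_add,
      ← Complex.exp_add, ← Complex.exp_add]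
    congr 1
    push_cast
    field_simp
    ring
  rw [mul_assoc (-I), mul_add, f1, f2, Complex.sin]
  ring

lemma smoothOn_jacobiThetaOne : SmoothOn (Set.univ ×ˢ upperHalf) jacobiThetaOne := by
  have h1 : ContDiffOn ℂ ∞ (fun x : ℂ × ℂ => thetaSeries 0 (x.1 / Real.pi + (x.2 + 1) / 2) x.2)
      (Set.univ ×ˢ upperHalf) :=
    (contDiffOn_thetaSeries 0).comp (f := fun x : ℂ × ℂ => (x.1 / Real.pi + (x.2 + 1) / 2, x.2))
      (by fun_prop) fun x hx => ⟨trivial, hx.2⟩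
  have h2 : ContDiffOn ℂ ∞ (fun x : ℂ × ℂ => -I * exp (Real.pi * I * x.2 / 4 + I * x.1))
      (Set.univ ×ˢ upperHalf) := by fun_prop
  exact (h2.mul h1).congr fun x hx => jacobiThetaOne_eq x.1 hx.2

/-- The heat equation of the theta function. -/
lemma pc_jacobiThetaOne (z : ℂ) {τ : ℂ} (hτ : τ ∈ upperHalf) :
    pc jacobiThetaOne z τ = -(Real.pi * I / 4) * pb (pb jacobiThetaOne) z τ := by
  have hπ : (Real.pi : ℂ) ≠ 0 := by exact_mod_cast Real.pi_ne_zero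
  have hS : ∀ (k : ℕ) (z : ℂ), HasDerivAt (fun t => thetaSeries k (t / Real.pi + (τ + 1) / 2) τ)
      (thetaSeries (k + 1) (z / Real.pi + (τ + 1) / 2) τ / Real.pi) z := by
    intro k z
    have h1 := hasDerivAt_fst_of_grad
      (hasFDerivAt_thetaSeries k (z / Real.pi + (τ + 1) / 2) hτ)
    have h2 : HasDerivAt (fun t : ℂ => t / Real.pi + (τ + 1) / 2) (1 / Real.pi) z :=
      ((hasDerivAt_id z).div_const _).add_const _
    exact (HasDerivAt.comp (h₂ := fun t => thetaSeries k t τ) z h1 h2).congr_deriv (by ring)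
  have hE : ∀ z : ℂ, HasDerivAt (fun t => -I * exp (Real.pi * I * τ / 4 + I * t))
      (exp (Real.pi * I * τ / 4 + I * z)) z := by
    intro z
    have h1 := ((((hasDerivAt_id z).const_mul I).const_add (Real.pi * I * τ / 4)).cexp).const_mul (-I)
    refine h1.congr_deriv ?_
    simp only [id]
    linear_combination (-exp (Real.pi * I * τ / 4 + I * z)) * I_mul_I
  have hE' : ∀ z : ℂ, HasDerivAt (fun t => exp (Real.pi * I * τ / 4 + I * t))
      (I * exp (Real.pi * I * τ / 4 + I * z)) z := by
    intro z
    have h1 := (((hasDerivAt_id z).const_mul I).const_add (Real.pi * I * τ / 4)).cexp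
    exact h1.congr_deriv (by simp only [id]; ring)
  have d1 : (fun z => pb jacobiThetaOne z τ) = fun z => exp (Real.pi * I * τ / 4 + I * z) *
      thetaSeries 0 (z / Real.pi + (τ + 1) / 2) τ + -I * exp (Real.pi * I * τ / 4 + I * z) *
        (thetaSeries 1 (z / Real.pi + (τ + 1) / 2) τ / Real.pi) := by
    funext z
    have h1 := (hE z).mul (hS 0 z)
    rw [pb, show (fun t => jacobiThetaOne t τ) = _ from funext fun t => jacobiThetaOne_eq t hτ]
    exact h1.deriv
  have d2 : pb (pb jacobiThetaOne) z τ = I * exp (Real.pi * I * τ / 4 + I * z) *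
      thetaSeries 0 (z / Real.pi + (τ + 1) / 2) τ + exp (Real.pi * I * τ / 4 + I * z) *
        (thetaSeries 1 (z / Real.pi + (τ + 1) / 2) τ / Real.pi) +
      (exp (Real.pi * I * τ / 4 + I * z) * (thetaSeries 1 (z / Real.pi + (τ + 1) / 2) τ / Real.pi) +
      -I * exp (Real.pi * I * τ / 4 + I * z) *
        (thetaSeries 2 (z / Real.pi + (τ + 1) / 2) τ / Real.pi / Real.pi)) := by
    change deriv (fun z => pb jacobiThetaOne z τ) z = _
    rw [d1]
    exact (((hE' z).mul (hS 0 z)).add ((hE z).mul ((hS 1 z).div_const _))).deriv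
  have d3 : pc jacobiThetaOne z τ = -I * (exp (Real.pi * I * τ / 4 + I * z) * (Real.pi * I / 4)) *
      thetaSeries 0 (z / Real.pi + (τ + 1) / 2) τ + -I * exp (Real.pi * I * τ / 4 + I * z) *
      (thetaSeries 1 (z / Real.pi + (τ + 1) / 2) τ / 2 +
        thetaSeries 2 (z / Real.pi + (τ + 1) / 2) τ / (4 * Real.pi * I)) := by
    have h0 : HasDerivAt (fun t : ℂ => (z / Real.pi + (t + 1) / 2, t)) ((1 / 2 : ℂ), (1 : ℂ)) τ :=
      (((((hasDerivAt_id τ).add_const 1).div_const 2).const_add (z / Real.pi)).congr_deriv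
        (by norm_num)).prodMk (hasDerivAt_id τ)
    have h1 := HasFDerivAt.comp_hasDerivAt (l := fun x : ℂ × ℂ => thetaSeries 0 x.1 x.2)
      (f := fun t : ℂ => (z / Real.pi + (t + 1) / 2, t)) τ (hasFDerivAt_thetaSeries 0 (z / Real.pi + (τ + 1) / 2) hτ) h0
    have h2 := (((((hasDerivAt_id τ).const_mul (Real.pi * I)).div_const 4).add_const
      (I * z)).cexp).const_mul (-I)
    have e : (fun t => jacobiThetaOne z t) =ᶠ[𝓝 τ] fun t =>
        -I * exp (Real.pi * I * t / 4 + I * z) * thetaSeries 0 (z / Real.pi + (t + 1) / 2) t := by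
      filter_upwards [isOpen_upperHalf.mem_nhds hτ] with t ht using jacobiThetaOne_eq z ht
    rw [pc, e.deriv_eq]
    refine (h2.mul h1).deriv.trans ?_
    simp
    ring
  rw [d2, d3]
  field_simp
  ring_nf
  simp only [I_sq]
  ring_nf

lemma jacobiThetaOne_zero (τ : ℂ) : jacobiThetaOne 0 τ = 0 := by
  simp [jacobiThetaOne]

lemma jacobiThetaOne_add_pi (z τ : ℂ) :
    jacobiThetaOne (z + Real.pi) τ = -jacobiThetaOne z τ := by
  have h : ∀ n : ℕ, Complex.sin ((2 * n + 1) * (z + Real.pi)) = -Complex.sin ((2 * n + 1) * z) := by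
    intro n
    rw [show (2 * (n : ℂ) + 1) * (z + Real.pi) = (2 * n + 1) * z + Real.pi + n * (2 * Real.pi) by ring,
      Complex.sin_add_nat_mul_two_pi, Complex.sin_add_pi]
  simp only [jacobiThetaOne, h, mul_neg, tsum_neg]

lemma jacobiThetaOne_add_pi_mul (z : ℂ) {τ : ℂ} (hτ : τ ∈ upperHalf) :
    jacobiThetaOne (z + Real.pi * τ) τ =
      -exp (-2 * I * z - Real.pi * I * τ) * jacobiThetaOne z τ := by
  have hπ : (Real.pi : ℂ) ≠ 0 := by exact_mod_cast Real.pi_ne_zero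
  rw [jacobiThetaOne_eq _ hτ, jacobiThetaOne_eq _ hτ, thetaSeries_zero, thetaSeries_zero,
    show (z + Real.pi * τ) / Real.pi + (τ + 1) / 2 = z / Real.pi + (τ + 1) / 2 + τ by
      field_simp; ring, jacobiTheta₂_add_left']
  have e : exp (Real.pi * I * τ / 4 + I * (z + Real.pi * τ)) *
      exp (-Real.pi * I * (τ + 2 * (z / Real.pi + (τ + 1) / 2))) =
      -(exp (-2 * I * z - Real.pi * I * τ) * exp (Real.pi * I * τ / 4 + I * z)) := by
    have h1 : exp (-(Real.pi * I)) = -1 := by rw [Complex.exp_neg, exp_pi_mul_I]; norm_num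
    rw [← Complex.exp_add, ← Complex.exp_add, neg_eq_neg_one_mul (exp _), ← h1, ← Complex.exp_add]
    congr 1
    field_simp
    ring
  linear_combination (-I * jacobiTheta₂ (z / Real.pi + (τ + 1) / 2) τ) * e

end ThetaOne

/-! ### The products `∏ (1 + aₙ u)` as entire functions -/

section Products

open Filter Topology

variable {a : ℕ → ℂ}

lemma multipliableLocallyUniformlyOn_one_add_mul (ha : Summable fun n => ‖a n‖) (R : ℝ) :
    MultipliableLocallyUniformlyOn (fun n u => 1 + a n * u) (Metric.ball (0 : ℂ) R) :=
  Summable.multipliableLocallyUniformlyOn_nat_one_add Metric.isOpen_ball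
    (ha.mul_right R) (Eventually.of_forall fun n x hx => by
      rw [norm_mul]
      gcongr
      simpa using (Metric.mem_ball.1 hx).le) fun n => by fun_prop

lemma differentiable_tprod_one_add_mul (ha : Summable fun n => ‖a n‖) :
    Differentiable ℂ fun u => ∏' n, (1 + a n * u) := by
  intro u
  have hu : u ∈ Metric.ball (0 : ℂ) (‖u‖ + 1) := by simp
  refine DifferentiableOn.differentiableAt (s := Metric.ball (0 : ℂ) (‖u‖ + 1)) ?_
    (Metric.isOpen_ball.mem_nhds hu)
  exact (multipliableLocallyUniformlyOn_one_add_mul ha _).hasProdLocallyUniformlyOn.differentiableOn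
    (.of_forall fun _ => by simpa [Finset.prod_fn] using
      DifferentiableOn.finsetProd (fun _ _ => by fun_prop)) Metric.isOpen_ball

lemma tprod_one_add_mul_ne_zero (ha : Summable fun n => ‖a n‖) {u : ℂ}
    (hu : ∀ n, 1 + a n * u ≠ 0) : ∏' n, (1 + a n * u) ≠ 0 := by
  refine tprod_one_add_ne_zero_of_summable hu ?_
  simpa [norm_mul] using ha.mul_right ‖u‖

lemma tprod_one_add_mul_zero : ∏' n, (1 + a n * (0 : ℂ)) = 1 := by simp

lemma hasDerivAt_tprod_one_add_mul_zero (ha : Summable fun n => ‖a n‖) :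
    HasDerivAt (fun u => ∏' n, (1 + a n * u)) (∑' n, a n) 0 := by
  have e : ∀ n, logDeriv (fun u => 1 + a n * u) 0 = a n := by
    intro n
    have : HasDerivAt (fun u => 1 + a n * u) (a n) 0 :=
      (((hasDerivAt_id (0 : ℂ)).const_mul (a n)).const_add 1).congr_deriv (by simp)
    rw [logDeriv_apply, this.deriv]
    simp
  have h1 := logDeriv_tprod_eq_tsum (f := fun n u => 1 + a n * u) Metric.isOpen_ball
    (Metric.mem_ball_self one_pos : (0 : ℂ) ∈ Metric.ball 0 1) (by simp) (fun n => by fun_prop)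
    (by simpa [e] using ha.of_norm) (multipliableLocallyUniformlyOn_one_add_mul ha 1) (by simp)
  simp only [e, logDeriv_apply, mul_zero, add_zero, tprod_one, div_one] at h1
  rw [← h1]
  exact (differentiable_tprod_one_add_mul ha 0).hasDerivAt

end Products

/-! ### The normalized theta function as a product -/

section ThetaProduct

open Filter Topology Complex

/-- The nome `q = e^{2πiτ}`. -/
def nome (τ : ℂ) : ℂ := exp (2 * Real.pi * I * τ)

/-- The coefficients `4qⁿ / (1 - qⁿ)²`, `n ≥ 1`. -/
def thetaCoeff (τ : ℂ) (n : ℕ) : ℂ := 4 * nome τ ^ (n + 1) / (1 - nome τ ^ (n + 1)) ^ 2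

/-- The product `sin z ∏ (1 + 4qⁿ sin² z / (1 - qⁿ)²)`. -/
def thetaProduct (z τ : ℂ) : ℂ := sin z * ∏' n, (1 + thetaCoeff τ n * sin z ^ 2)

variable {τ : ℂ} (hτ : τ ∈ upperHalf)
include hτ

lemma norm_nome_lt_one : ‖nome τ‖ < 1 := by
  rw [nome, norm_exp, Real.exp_lt_one_iff]
  have : (2 * Real.pi * I * τ).re = -(2 * Real.pi * τ.im) := by simp
  rw [this, neg_lt_zero]
  exact mul_pos (by positivity) hτ

lemma one_sub_nome_pow_ne_zero (n : ℕ) : 1 - nome τ ^ (n + 1) ≠ 0 := by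
  intro h
  have h1 : ‖nome τ ^ (n + 1)‖ < 1 := by
    rw [norm_pow]
    exact pow_lt_one₀ (norm_nonneg _) (norm_nome_lt_one hτ) (by simp)
  rw [← sub_eq_zero.1 h] at h1
  simp at h1

lemma norm_thetaCoeff_le (n : ℕ) : ‖thetaCoeff τ n‖ ≤
    4 * ‖nome τ‖ / (1 - ‖nome τ‖) ^ 2 * ‖nome τ‖ ^ n := by
  have hq := norm_nome_lt_one hτ
  have h0 : 0 < 1 - ‖nome τ‖ := by linarith
  rw [thetaCoeff, norm_div, norm_mul, norm_pow, norm_pow]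
  have h1 : 1 - ‖nome τ‖ ≤ ‖1 - nome τ ^ (n + 1)‖ := by
    have h2 := norm_sub_norm_le (1 : ℂ) (nome τ ^ (n + 1))
    rw [norm_one, norm_pow] at h2
    have h3 : ‖nome τ‖ ^ (n + 1) ≤ ‖nome τ‖ := pow_le_of_le_one (norm_nonneg _) hq.le (by simp)
    linarith
  have h4 : (1 - ‖nome τ‖) ^ 2 ≤ ‖1 - nome τ ^ (n + 1)‖ ^ 2 := by gcongr
  have h5 : ‖(4 : ℂ)‖ * ‖nome τ‖ ^ (n + 1) = 4 * ‖nome τ‖ * ‖nome τ‖ ^ n := by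
    rw [pow_succ, RCLike.norm_ofNat]
    ring
  rw [div_mul_eq_mul_div, ← h5]
  exact div_le_div_of_nonneg_left (by positivity) (by positivity) h4

lemma summable_thetaCoeff : Summable fun n => ‖thetaCoeff τ n‖ :=
  Summable.of_nonneg_of_le (fun _ => norm_nonneg _) (norm_thetaCoeff_le hτ)
    ((summable_geometric_of_lt_one (norm_nonneg _) (norm_nome_lt_one hτ)).mul_left _)

lemma differentiable_thetaProduct : Differentiable ℂ fun z => thetaProduct z τ :=
  differentiable_sin.mul
    ((differentiable_tprod_one_add_mul (summable_thetaCoeff hτ)).comp (differentiable_sin.pow 2))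

lemma hasDerivAt_thetaProduct_zero : HasDerivAt (fun z => thetaProduct z τ) 1 0 := by
  have h := (hasDerivAt_sin 0).mul ((((differentiable_tprod_one_add_mul
    (summable_thetaCoeff hτ)).comp (differentiable_sin.pow 2)) 0).hasDerivAt)
  refine h.congr_deriv ?_
  simp

/-- The third derivative of the product at the origin. -/
lemma deriv_three_thetaProduct_zero :
    deriv (deriv (deriv fun z => thetaProduct z τ)) 0 = -1 + 6 * ∑' n, thetaCoeff τ n := by
  set F : ℂ → ℂ := fun u => ∏' n, (1 + thetaCoeff τ n * u) with hF
  have hF0 : Differentiable ℂ F := differentiable_tprod_one_add_mul (summable_thetaCoeff hτ)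
  have hF1 : Differentiable ℂ (deriv F) := (hF0.contDiff (n := 2)).differentiable_deriv_two
  have hF2 : Differentiable ℂ (deriv (deriv F)) := (hF1.contDiff (n := 2)).differentiable_deriv_two
  have hs : ∀ z, HasDerivAt (fun z : ℂ => sin z ^ 2) (2 * sin z * cos z) z := fun z =>
    ((hasDerivAt_sin z).pow 2).congr_deriv (by ring)
  have hcomp : ∀ {G : ℂ → ℂ}, Differentiable ℂ G → ∀ z,
      HasDerivAt (fun z => G (sin z ^ 2)) (deriv G (sin z ^ 2) * (2 * sin z * cos z)) z :=
    fun hG z => (hG (sin z ^ 2)).hasDerivAt.comp z (hs z)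
  have d1 : (deriv fun z => thetaProduct z τ) = fun z =>
      cos z * F (sin z ^ 2) + sin z * (deriv F (sin z ^ 2) * (2 * sin z * cos z)) := by
    funext z
    exact ((hasDerivAt_sin z).mul (hcomp hF0 z)).deriv
  have d2 : deriv (deriv fun z => thetaProduct z τ) = fun z => sin z *
      (-F (sin z ^ 2) + deriv F (sin z ^ 2) * (6 * cos z ^ 2 - 2 * sin z ^ 2)
        + 4 * sin z ^ 2 * cos z ^ 2 * deriv (deriv F) (sin z ^ 2)) := by
    rw [d1]
    funext z
    have h1 := ((hasDerivAt_cos z).mul (hcomp hF0 z)).add ((hasDerivAt_sin z).mul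
      ((hcomp hF1 z).mul (((hasDerivAt_sin z).const_mul 2).mul (hasDerivAt_cos z))))
    refine h1.deriv.trans ?_
    simp only [Pi.mul_apply]
    ring
  have hd : DifferentiableAt ℂ (fun z => -F (sin z ^ 2) + deriv F (sin z ^ 2) *
      (6 * cos z ^ 2 - 2 * sin z ^ 2) + 4 * sin z ^ 2 * cos z ^ 2 * deriv (deriv F) (sin z ^ 2))
      0 := by
    have e0 := (hcomp hF0 0).differentiableAt
    have e1 := (hcomp hF1 0).differentiableAt
    have e2 := (hcomp hF2 0).differentiableAt
    fun_prop
  rw [d2]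
  refine ((hasDerivAt_sin 0).mul hd.hasDerivAt).deriv.trans ?_
  have h3 : deriv F 0 = ∑' n, thetaCoeff τ n :=
    (hasDerivAt_tprod_one_add_mul_zero (summable_thetaCoeff hτ)).deriv
  have h4 : F 0 = 1 := tprod_one_add_mul_zero
  simp [h3, h4]
  ring

omit hτ in
lemma thetaProduct_zero : thetaProduct 0 τ = 0 := by simp [thetaProduct]

omit hτ in
lemma thetaProduct_neg (z : ℂ) : thetaProduct (-z) τ = -thetaProduct z τ := by
  simp [thetaProduct]

omit hτ in
lemma thetaProduct_add_pi (z : ℂ) : thetaProduct (z + Real.pi) τ = -thetaProduct z τ := by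
  simp [thetaProduct, sin_add_pi]

/-- The product `∏ (1 - qⁿx)`, `n ≥ 1`. -/
def nomeProduct (τ x : ℂ) : ℂ := ∏' n : ℕ, (1 - nome τ ^ (n + 1) * x)

omit hτ in
lemma two_I_mul_sin (z : ℂ) : 2 * I * sin z = exp (I * z) - exp (-(I * z)) := by
  rw [sin, show -z * I = -(I * z) by ring, show z * I = I * z by ring]
  linear_combination (exp (-(I * z)) - exp (I * z)) * I_mul_I

omit hτ in
lemma four_mul_sin_sq (z : ℂ) : 4 * sin z ^ 2 = 2 - exp (2 * I * z) - exp (-(2 * I * z)) := by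
  have h := congrArg (· ^ 2) (two_I_mul_sin z)
  have e1 : exp (2 * I * z) = exp (I * z) ^ 2 := by rw [← exp_nat_mul]; congr 1; ring
  have e2 : exp (-(2 * I * z)) = exp (-(I * z)) ^ 2 := by rw [← exp_nat_mul]; congr 1; ring
  have e3 : exp (I * z) * exp (-(I * z)) = 1 := by rw [← exp_add]; simp
  simp only [mul_pow, I_sq] at h
  rw [e1, e2]
  linear_combination -h + 2 * e3

lemma one_add_thetaCoeff_mul (n : ℕ) (z : ℂ) :
    (1 - nome τ ^ (n + 1)) ^ 2 * (1 + thetaCoeff τ n * sin z ^ 2) =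
      (1 - nome τ ^ (n + 1) * exp (2 * I * z)) * (1 - nome τ ^ (n + 1) * exp (-(2 * I * z))) := by
  have h1 := one_sub_nome_pow_ne_zero hτ n
  have e : exp (2 * I * z) * exp (-(2 * I * z)) = 1 := by rw [← exp_add]; simp
  rw [thetaCoeff]
  generalize nome τ ^ (n + 1) = Q at *
  field_simp
  linear_combination Q * four_mul_sin_sq z - Q ^ 2 * e

lemma multipliable_nomeProduct (x : ℂ) : Multipliable fun n : ℕ => 1 - nome τ ^ (n + 1) * x := by
  have h : Summable fun n : ℕ => ‖-(nome τ ^ (n + 1) * x)‖ := by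
    simp only [norm_neg, norm_mul, norm_pow, pow_succ]
    exact ((summable_geometric_of_lt_one (norm_nonneg _) (norm_nome_lt_one hτ)).mul_right _).mul_right _
  simpa [sub_eq_add_neg] using multipliable_one_add_of_summable h

lemma nomeProduct_eq (x : ℂ) : nomeProduct τ x = (1 - nome τ * x) * nomeProduct τ (nome τ * x) := by
  have e : (fun n : ℕ => 1 - nome τ ^ (n + 1) * (nome τ * x)) =
      fun n => 1 - nome τ ^ (n + 1 + 1) * x := by
    funext n
    ring
  have h := multipliable_nomeProduct hτ (nome τ * x)
  rw [e] at h
  have h2 := tprod_eq_zero_mul' (f := fun n : ℕ => 1 - nome τ ^ (n + 1) * x) h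
  rw [← e] at h2
  refine h2.trans ?_
  rw [zero_add, pow_one, nomeProduct]

/-- Multiplying by the factors `(1 - qⁿ)²` gives Jacobi's form of the product, in which `z ↦ z + πτ`
multiplies `e^{2iz}` by `q` and so only shifts the index. The form in `sin² z` in turn makes the
Taylor coefficients at the origin accessible. -/
lemma thetaProduct_eq_nomeProduct (z : ℂ) :
    nomeProduct τ 1 ^ 2 * (2 * I * thetaProduct z τ) = (exp (I * z) - exp (-(I * z))) *
      (nomeProduct τ (exp (2 * I * z)) * nomeProduct τ (exp (-(2 * I * z)))) := by
  have m1 := multipliable_nomeProduct hτ 1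
  simp only [mul_one] at m1
  have m2 : Multipliable fun n => 1 + thetaCoeff τ n * sin z ^ 2 := by
    refine multipliable_one_add_of_summable ?_
    simpa [norm_mul, norm_pow] using (summable_thetaCoeff hτ).mul_right (‖sin z‖ ^ 2)
  have h1 : nomeProduct τ 1 ^ 2 * ∏' n, (1 + thetaCoeff τ n * sin z ^ 2) =
      nomeProduct τ (exp (2 * I * z)) * nomeProduct τ (exp (-(2 * I * z))) := by
    simp only [nomeProduct, mul_one]
    rw [sq, ← m1.tprod_mul m1, ← (m1.mul m1).tprod_mul m2,
      ← (multipliable_nomeProduct hτ _).tprod_mul (multipliable_nomeProduct hτ _)]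
    refine tprod_congr fun n => ?_
    rw [← one_add_thetaCoeff_mul hτ n z]
    ring
  rw [← two_I_mul_sin, ← h1, thetaProduct]
  ring

lemma nomeProduct_one_ne_zero : nomeProduct τ 1 ≠ 0 := by
  have h : Summable fun n : ℕ => ‖-(nome τ ^ (n + 1) * 1)‖ := by
    simp only [norm_neg, norm_mul, norm_pow, pow_succ]
    exact ((summable_geometric_of_lt_one (norm_nonneg _) (norm_nome_lt_one hτ)).mul_right _).mul_right _
  have := tprod_one_add_ne_zero_of_summable (f := fun n : ℕ => -(nome τ ^ (n + 1) * 1))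
    (fun n => by simpa [← sub_eq_add_neg] using one_sub_nome_pow_ne_zero hτ n) h
  simpa [nomeProduct, sub_eq_add_neg] using this

lemma thetaProduct_add_pi_mul (z : ℂ) :
    thetaProduct (z + Real.pi * τ) τ = -exp (-2 * I * z - Real.pi * I * τ) * thetaProduct z τ := by
  have h0 : nomeProduct τ 1 ^ 2 * (2 * I) ≠ 0 :=
    mul_ne_zero (pow_ne_zero _ (nomeProduct_one_ne_zero hτ)) (by simp)
  refine mul_left_cancel₀ h0 ?_
  have h1 := thetaProduct_eq_nomeProduct hτ (z + Real.pi * τ)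
  have h2 := thetaProduct_eq_nomeProduct hτ z
  have e1 : exp (2 * I * (z + Real.pi * τ)) = nome τ * exp (2 * I * z) := by
    rw [nome, ← exp_add]; congr 1; ring
  have e2 : nome τ * exp (-(2 * I * (z + Real.pi * τ))) = exp (-(2 * I * z)) := by
    rw [nome, ← exp_add]; congr 1; ring
  rw [nomeProduct_eq hτ (exp (-(2 * I * (z + Real.pi * τ)))), e2, e1] at h1
  rw [nomeProduct_eq hτ (exp (2 * I * z))] at h2
  have e3 : (exp (I * (z + Real.pi * τ)) - exp (-(I * (z + Real.pi * τ)))) *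
      (1 - exp (-(2 * I * z))) = -exp (-2 * I * z - Real.pi * I * τ) *
      ((exp (I * z) - exp (-(I * z))) * (1 - nome τ * exp (2 * I * z))) := by
    simp only [nome, mul_sub, sub_mul, mul_one, ← exp_add, neg_mul]
    ring_nf
  linear_combination h1 + exp (-2 * I * z - Real.pi * I * τ) * h2 +
    (nomeProduct τ (nome τ * exp (2 * I * z)) * nomeProduct τ (exp (-(2 * I * z)))) * e3

end ThetaProduct

/-! ### Liouville's theorem for elliptic functions -/

section Liouville

open Filter Topology Complex

lemma countable_lattice (L : PeriodPair) : (L.lattice : Set ℂ).Countable := by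
  have : Countable L.lattice := L.latticeEquivProd.injective.countable
  exact Set.to_countable _

lemma dense_compl_lattice (L : PeriodPair) : Dense ((L.lattice : Set ℂ)ᶜ) :=
  (countable_lattice L).dense_compl ℝ

lemma isOpen_compl_lattice (L : PeriodPair) : IsOpen ((L.lattice : Set ℂ)ᶜ) :=
  L.isClosed_lattice.isOpen_compl

lemma lattice_periodic {α : Type*} {L : PeriodPair} {f : ℂ → α}
    (h1 : ∀ z, f (z + L.ω₁) = f z) (h2 : ∀ z, f (z + L.ω₂) = f z) {l : ℂ} (hl : l ∈ L.lattice)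
    (z : ℂ) : f (z + l) = f z := by
  obtain ⟨m, n, rfl⟩ := PeriodPair.mem_lattice.1 hl
  exact ((Function.Periodic.int_mul h1 m).add_period (Function.Periodic.int_mul h2 n)) z

lemma add_mem_lattice_iff {L : PeriodPair} {l z : ℂ} (hl : l ∈ L.lattice) :
    z + l ∈ L.lattice ↔ z ∈ L.lattice := Submodule.add_mem_iff_left _ hl

/-- Liouville's theorem: an elliptic function which extends analytically to the origin, and has no
poles outside the lattice, is constant. -/
lemma eq_const_of_elliptic {L : PeriodPair} {f e : ℂ → ℂ}
    (h1 : ∀ z ∉ L.lattice, f (z + L.ω₁) = f z) (h2 : ∀ z ∉ L.lattice, f (z + L.ω₂) = f z)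
    (hf : DifferentiableOn ℂ f (L.lattice : Set ℂ)ᶜ) (he : AnalyticAt ℂ e 0)
    (hfe : ∀ᶠ z in 𝓝 0, z ∉ L.lattice → f z = e z) {z : ℂ} (hz : z ∉ L.lattice) : f z = e 0 := by
  classical
  -- Filling in the value `e 0` at all lattice points gives an entire doubly periodic function,
  -- which is bounded since its range is compact.
  set F : ℂ → ℂ := fun z => if z ∈ L.lattice then e 0 else f z with hF
  have per : ∀ κ ∈ L.lattice, (∀ z ∉ L.lattice, f (z + κ) = f z) → ∀ z, F (z + κ) = F z := by
    intro κ hκ h z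
    by_cases hz : z ∈ L.lattice
    · simp [hF, hz, (add_mem_lattice_iff hκ).2 hz]
    · simp [hF, hz, (add_mem_lattice_iff hκ).not.2 hz, h z hz]
  have hper : ∀ l ∈ L.lattice, ∀ z, F (z + l) = F z := fun l hl z =>
    lattice_periodic (per _ L.ω₁_mem_lattice h1) (per _ L.ω₂_mem_lattice h2) hl z
  have h0 : F =ᶠ[𝓝 0] e := by
    have hU := L.compl_lattice_sdiff_singleton_mem_nhds 0
    filter_upwards [hfe, hU] with z hz hz'
    by_cases hzl : z ∈ L.lattice
    · have : z = 0 := by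
        by_contra h
        exact hz' ⟨hzl, h⟩
      subst this
      simp [hF]
    · simp [hF, hzl, hz hzl]
  have hd : Differentiable ℂ F := by
    intro z
    by_cases hz : z ∈ L.lattice
    · have h3 : DifferentiableAt ℂ F (z + -z) := by
        rw [add_neg_cancel]
        exact he.differentiableAt.congr_of_eventuallyEq h0
      have h4 : F = fun t => F (t + -z) := by
        funext t
        exact (hper _ (neg_mem hz) t).symm
      rw [h4]
      exact DifferentiableAt.comp (f := fun t => t + -z) z h3 (by fun_prop)
    · have hU := (isOpen_compl_lattice L).mem_nhds hz
      refine ((hf z hz).differentiableAt hU).congr_of_eventuallyEq ?_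
      filter_upwards [hU] with t ht
      simp only [hF]
      exact if_neg ht
  have h5 := hd.apply_eq_apply_of_bounded (IsZLattice.isCompact_range_of_periodic L.lattice F
    hd.continuous fun z w hw => hper w hw z).isBounded z 0
  rw [h0.self_of_nhds] at h5
  rw [← h5]
  simp only [hF]
  rw [if_neg hz]

end Liouville

/-! ### Zeros of the product, and its determination by quasi-periodicity -/

section ThetaLattice

open Filter Topology Complex

/-- The period pair `(π, πτ)` of a point `τ` of the upper half-plane. -/
def thetaLattice (τ : ℂ) (hτ : τ ∈ upperHalf) : PeriodPair where
  ω₁ := Real.pi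
  ω₂ := Real.pi * τ
  indep := by
    rw [LinearIndependent.pair_iff]
    intro s t h
    have h1 : (s : ℂ) + t * τ = 0 := by
      have hpi : (Real.pi : ℂ) ≠ 0 := by exact_mod_cast Real.pi_ne_zero
      simp only [real_smul] at h
      refine (mul_eq_zero.1 (?_ : (Real.pi : ℂ) * _ = 0)).resolve_left hpi
      linear_combination h
    have h2 := congrArg Complex.im h1
    simp only [add_im, ofReal_im, mul_im, ofReal_re, zero_mul, add_zero, zero_add, zero_im] at h2
    have ht : t = 0 := (mul_eq_zero.1 h2).resolve_right (ne_of_gt hτ)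
    subst ht
    simpa using h1

variable {τ : ℂ} (hτ : τ ∈ upperHalf)

@[simp] lemma thetaLattice_one : (thetaLattice τ hτ).ω₁ = Real.pi := rfl
@[simp] lemma thetaLattice_two : (thetaLattice τ hτ).ω₂ = Real.pi * τ := rfl

/-- A vanishing factor means that `z ∈ πℤ` or `qⁿ e^{±2iz} = 1` for some `n ≥ 1`, so `z` is a
lattice point. Conversely the zero at the origin is carried to all lattice points, because the
multipliers do not vanish. -/
lemma thetaProduct_eq_zero_iff (z : ℂ) :
    thetaProduct z τ = 0 ↔ z ∈ (thetaLattice τ hτ).lattice := by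
  constructor
  · intro h
    rw [thetaProduct, mul_eq_zero] at h
    have hpi : (Real.pi : ℂ) ≠ 0 := by exact_mod_cast Real.pi_ne_zero
    have key : ∀ m n : ℤ, 2 * Real.pi * I * τ * n + 2 * I * z = m * (2 * Real.pi * I) →
        z ∈ (thetaLattice τ hτ).lattice := by
      intro m n h
      rw [PeriodPair.mem_lattice]
      refine ⟨m, -n, ?_⟩
      have h2 : (2 * I : ℂ) ≠ 0 := by simp
      refine mul_left_cancel₀ h2 ?_
      push_cast
      rw [thetaLattice_one, thetaLattice_two]
      linear_combination -h
    rcases h with h | h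
    · obtain ⟨k, hk⟩ := sin_eq_zero_iff.1 h
      refine key k 0 ?_
      rw [hk]
      push_cast
      ring
    · obtain ⟨n, hn⟩ : ∃ n, 1 + thetaCoeff τ n * sin z ^ 2 = 0 := by
        by_contra! hne
        exact tprod_one_add_mul_ne_zero (summable_thetaCoeff hτ) hne h
      have h1 := one_add_thetaCoeff_mul hτ n z
      rw [hn, mul_zero, eq_comm, mul_eq_zero] at h1
      rw [nome, ← exp_nat_mul, ← exp_add, ← exp_add, sub_eq_zero, sub_eq_zero, eq_comm,
        exp_eq_one_iff, eq_comm, exp_eq_one_iff] at h1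
      rcases h1 with ⟨m, hm⟩ | ⟨m, hm⟩
      · refine key m (n + 1) ?_
        rw [← hm]
        push_cast
        ring
      · refine key (-m) (-(n + 1)) ?_
        push_cast
        push_cast at hm
        linear_combination -hm
  · intro h
    have h1 := lattice_periodic (L := thetaLattice τ hτ) (f := fun z => thetaProduct z τ = 0)
      (fun z => by simp [thetaProduct_add_pi]) (fun z => by simp [thetaProduct_add_pi_mul hτ]) h 0
    rw [zero_add] at h1
    simpa [thetaProduct_zero] using h1

-- `f` and the product have the same multipliers, so their quotient is elliptic. The zeros of the
-- product are confined to the lattice, and at the origin `f(0) = 0` removes the simple pole: there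
-- the quotient is the ratio of the `dslope`s. Liouville's theorem makes it constant.
include hτ in
lemma eq_smul_thetaProduct {f : ℂ → ℂ} (hf : Differentiable ℂ f) (h0 : f 0 = 0)
    (h1 : ∀ z, f (z + Real.pi) = -f z)
    (h2 : ∀ z, f (z + Real.pi * τ) = -exp (-2 * I * z - Real.pi * I * τ) * f z) (z : ℂ) :
    f z = deriv f 0 * thetaProduct z τ := by
  set P : ℂ → ℂ := fun z => thetaProduct z τ with hP
  have hPd : Differentiable ℂ P := differentiable_thetaProduct hτ
  have hP0 : ∀ {z}, z ∉ (thetaLattice τ hτ).lattice → P z ≠ 0 := fun {z} hz h =>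
    hz ((thetaProduct_eq_zero_iff hτ z).1 h)
  have ana : ∀ {g : ℂ → ℂ}, Differentiable ℂ g → AnalyticAt ℂ (dslope g 0) 0 := by
    intro g hg
    have : DifferentiableOn ℂ (dslope g 0) Set.univ :=
      (differentiableOn_dslope univ_mem).2 hg.differentiableOn
    exact this.analyticAt univ_mem
  have hd0 : dslope P 0 0 = 1 := by
    rw [dslope_same, (hasDerivAt_thetaProduct_zero hτ).deriv]
  have main : ∀ z ∉ (thetaLattice τ hτ).lattice, f z / P z = dslope f 0 0 / dslope P 0 0 := by
    intro z hz
    refine eq_const_of_elliptic (L := thetaLattice τ hτ) (f := fun z => f z / P z)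
      (e := fun z => dslope f 0 z / dslope P 0 z) ?_ ?_ ?_ ?_ ?_ hz
    · intro z _
      simp only [hP, thetaLattice_one, h1, thetaProduct_add_pi, neg_div_neg_eq]
    · intro z _
      simp only [hP, thetaLattice_two, h2, thetaProduct_add_pi_mul hτ]
      exact mul_div_mul_left _ _ (by simp)
    · exact fun z hz => ((hf z).div (hPd z) (hP0 hz)).differentiableWithinAt
    · exact (ana hf).div (ana hPd) (by rw [hd0]; exact one_ne_zero)
    · refine Eventually.of_forall fun z hz => ?_
      have hz0 : z ≠ 0 := fun h => hz (h ▸ zero_mem _)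
      have hp : P 0 = 0 := thetaProduct_zero
      rw [dslope_of_ne _ hz0, dslope_of_ne _ hz0, slope_def_field, slope_def_field, h0, hp,
        sub_zero, sub_zero, sub_zero, div_div_div_cancel_right₀ hz0]
  rw [hd0, dslope_same, div_one] at main
  have hc1 : Continuous fun z => deriv f 0 * P z := (continuous_const.mul hPd.continuous)
  refine congrFun (hf.continuous.ext_on (dense_compl_lattice (thetaLattice τ hτ)) hc1 ?_) z
  intro z hz
  have := main z hz
  rw [div_eq_iff (hP0 hz)] at this
  exact this

include hτ

lemma differentiable_jacobiThetaOne : Differentiable ℂ fun z => jacobiThetaOne z τ := fun _ =>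
  (smoothOn_jacobiThetaOne.hasDerivAt_fst isOpen_univ_prod_upperHalf
    ⟨trivial, hτ⟩).differentiableAt

lemma jacobiThetaOne_eq_mul_thetaProduct (z : ℂ) :
    jacobiThetaOne z τ = pb jacobiThetaOne 0 τ * thetaProduct z τ :=
  eq_smul_thetaProduct hτ (differentiable_jacobiThetaOne hτ) (jacobiThetaOne_zero τ)
    (fun z => jacobiThetaOne_add_pi z τ) (fun z => jacobiThetaOne_add_pi_mul z hτ) z

end ThetaLattice

/-! ### The values `θ₁'(0)`, `η`, `Δ` and `E₂` -/

section ThetaNull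

open Filter Topology ModularForm
open Complex hiding eta

/-- The function `E(τ) = -1 + 24 ∑ qⁿ / (1 - qⁿ)²`. -/
def thetaE (τ : ℂ) : ℂ := -1 + 6 * ∑' n, thetaCoeff τ n

variable {τ : ℂ}

/-- The Lambert series `∑ qⁿ/(1 - qⁿ)² = ∑ σ₁(n) qⁿ`. -/
lemma tsum_thetaCoeff (hτ : τ ∈ upperHalf) : ∑' n, thetaCoeff τ n =
    4 * ∑' n : ℕ, (ArithmeticFunction.sigma 1 (n + 1) : ℂ) * nome τ ^ (n + 1) := by
  have hq := norm_nome_lt_one hτ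
  have h1 := tsum_prod_pow_eq_tsum_sigma 1 hq
  rw [tsum_pnat_eq_tsum_succ (f := fun d : ℕ => ∑' c : ℕ+, (c : ℂ) ^ 1 * nome τ ^ (d * c : ℕ)),
    tsum_pnat_eq_tsum_succ (f := fun e : ℕ => (ArithmeticFunction.sigma 1 e : ℂ) * nome τ ^ e)] at h1
  rw [← h1, ← tsum_mul_left]
  refine tsum_congr fun n => ?_
  have h2 : ‖nome τ ^ (n + 1)‖ < 1 := by
    rw [norm_pow]
    exact pow_lt_one₀ (norm_nonneg _) hq (by simp)
  have h3 := tsum_coe_mul_geometric_of_norm_lt_one h2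
  have h4 : ∑' c : ℕ+, (c : ℂ) ^ 1 * nome τ ^ ((n + 1) * c : ℕ) =
      nome τ ^ (n + 1) / (1 - nome τ ^ (n + 1)) ^ 2 := by
    rw [← h3, ← tsum_zero_pnat_eq_tsum_nat]
    · simp [pow_mul]
    · simpa using! (summable_pow_mul_geometric_of_norm_lt_one 1 h2)
  rw [h4, thetaCoeff]
  ring

lemma thetaE_eq (hτ : τ ∈ upperHalf) : thetaE τ = -(1 - 24 * ∑' n : ℕ,
    (ArithmeticFunction.sigma 1 (n + 1) : ℂ) * exp (2 * Real.pi * I * τ) ^ (n + 1)) := by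
  rw [thetaE, tsum_thetaCoeff hτ, nome]
  ring

lemma thetaE_eq_neg_E2 (hτ : τ ∈ upperHalf) : thetaE τ = -EisensteinSeries.E2 ⟨τ, hτ⟩ := by
  rw [thetaE_eq hτ, EisensteinSeries.E2_eq_tsum_cexp, tsum_pnat_eq_tsum_succ
    (f := fun e : ℕ => (ArithmeticFunction.sigma 1 e : ℂ) * exp (2 * Real.pi * I * τ) ^ e)]

lemma hasDerivAt_eta (hτ : τ ∈ upperHalf) :
    HasDerivAt eta (-(Real.pi * I / 12) * thetaE τ * eta τ) τ := by
  have h1 := logDeriv_eta_eq_E2 ⟨τ, hτ⟩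
  have h2 := (differentiableAt_eta_of_mem_upperHalfPlaneSet (z := τ) hτ).hasDerivAt
  refine h2.congr_deriv ?_
  rw [logDeriv_apply, div_eq_iff (eta_ne_zero (z := τ) hτ)] at h1
  rw [thetaE_eq_neg_E2 hτ]
  exact h1.trans (by ring)

/-- The heat equation turns the `τ`-derivative of `θ₁'(0)` into `-(πi/4) θ₁'''(0)`, and the product
formula gives `θ₁'''(0) = E θ₁'(0)`. -/
lemma hasDerivAt_pb_jacobiThetaOne_zero (hτ : τ ∈ upperHalf) :
    HasDerivAt (fun τ => pb jacobiThetaOne 0 τ)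
      (-(Real.pi * I / 4) * thetaE τ * pb jacobiThetaOne 0 τ) τ := by
  have hs := smoothOn_jacobiThetaOne
  have hΩ := isOpen_univ_prod_upperHalf
  have hm : ((0 : ℂ), τ) ∈ Set.univ ×ˢ upperHalf := ⟨trivial, hτ⟩
  refine ((hs.smoothOn_pb hΩ).hasDerivAt_snd hΩ hm).congr_deriv ?_
  rw [← hs.pb_pc hΩ hm]
  have e1 : (fun z => pc jacobiThetaOne z τ) =
      fun z => -(Real.pi * I / 4) * pb (pb jacobiThetaOne) z τ := by
    funext z
    exact pc_jacobiThetaOne z hτ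
  have e2 : deriv (fun z => pb (pb jacobiThetaOne) z τ) 0 = pb jacobiThetaOne 0 τ * thetaE τ := by
    have e3 : (fun z => jacobiThetaOne z τ) =
      fun z => pb jacobiThetaOne 0 τ * thetaProduct z τ :=
      funext fun z => jacobiThetaOne_eq_mul_thetaProduct hτ z
    have e4 : (fun z => pb (pb jacobiThetaOne) z τ) =
        fun z => pb jacobiThetaOne 0 τ * deriv (deriv (fun z => thetaProduct z τ)) z := by
      change deriv (deriv (fun z => jacobiThetaOne z τ)) = _
      rw [e3]
      funext z
      rw [show deriv (fun z => pb jacobiThetaOne 0 τ * thetaProduct z τ) =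
        fun z => pb jacobiThetaOne 0 τ * deriv (fun z => thetaProduct z τ) z from
          funext fun z => deriv_const_mul_field _]
      exact deriv_const_mul_field _
    rw [e4, deriv_const_mul_field, deriv_three_thetaProduct_zero hτ, thetaE]
  rw [pb, e1, deriv_const_mul_field, e2]
  ring

lemma isPreconnected_upperHalf : IsPreconnected upperHalf :=
  (convex_halfSpace_im_gt 0).isPreconnected

lemma I_mul_mem_upperHalf {y : ℝ} (hy : 0 < y) : I * y ∈ upperHalf := by
  simpa [upperHalf] using hy

lemma nome_I_mul (y : ℝ) : nome (I * y) = Real.exp (-(2 * Real.pi * y)) := by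
  rw [nome, ofReal_exp]
  congr 1
  push_cast
  linear_combination (2 * Real.pi * y : ℂ) * I_mul_I

lemma tendsto_norm_nome : Tendsto (fun y : ℝ => ‖nome (I * y)‖) atTop (𝓝 0) := by
  simp only [nome_I_mul, norm_real, Real.norm_eq_abs, Real.abs_exp]
  exact Real.tendsto_exp_neg_atTop_nhds_zero.comp
    (tendsto_id.const_mul_atTop (by positivity))

lemma tendsto_thetaProduct :
    Tendsto (fun y : ℝ => thetaProduct (Real.pi / 2) (I * y)) atTop (𝓝 1) := by
  have hs : sin (Real.pi / 2 : ℂ) = 1 := sin_pi_div_two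
  simp only [thetaProduct, hs, one_mul, one_pow, mul_one]
  have hy : ∀ᶠ y : ℝ in atTop, 0 < y ∧ ‖nome (I * y)‖ ≤ 1 / 2 :=
    (eventually_gt_atTop 0).and (tendsto_norm_nome.eventually_le_const (by norm_num))
  have hb : ∀ᶠ y : ℝ in atTop, ∀ n, ‖thetaCoeff (I * y) n‖ ≤ 16 * ‖nome (I * y)‖ * (1 / 2) ^ n := by
    filter_upwards [hy] with y hy n
    refine (norm_thetaCoeff_le (I_mul_mem_upperHalf hy.1) n).trans ?_
    have h1 : (1 / 4 : ℝ) ≤ (1 - ‖nome (I * y)‖) ^ 2 := by nlinarith [hy.2]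
    have h2 : 4 * ‖nome (I * y)‖ / (1 - ‖nome (I * y)‖) ^ 2 ≤ 16 * ‖nome (I * y)‖ := by
      rw [div_le_iff₀ (by linarith)]
      nlinarith [norm_nonneg (nome (I * y))]
    gcongr
    exact hy.2
  have := tendsto_tprod_one_add_of_dominated_convergence (𝓕 := atTop) (g := fun _ : ℕ => (0 : ℂ))
    (f := fun (y : ℝ) n => thetaCoeff (I * y) n) (bound := fun n => 8 * (1 / 2 : ℝ) ^ n)
    ((summable_geometric_of_abs_lt_one (by norm_num [abs_of_pos])).mul_left _) ?_ ?_
  · simpa using this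
  · intro n
    refine squeeze_zero_norm' (hb.mono fun y hy => hy n) ?_
    simpa using (tendsto_norm_nome.const_mul 16).mul_const ((1 / 2 : ℝ) ^ n)
  · filter_upwards [hb, hy] with y h1 h2 n
    refine (h1 n).trans ?_
    gcongr
    linarith [h2.2]

/-- The leading exponential is split off by `(n + 1/2)² = n(n + 1) + 1/4`. -/
lemma jacobiThetaOne_pi_div_two (y : ℝ) :
    jacobiThetaOne (Real.pi / 2) (I * y) = Real.exp (-(Real.pi * y / 4)) * (2 * ∑' n : ℕ,
      (-1) ^ n * (Real.exp (-(Real.pi * y * (n * (n + 1)))) : ℂ) *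
        sin ((2 * n + 1) * (Real.pi / 2))) := by
  rw [jacobiThetaOne, mul_left_comm (Real.exp (-(Real.pi * y / 4)) : ℂ)]
  refine congrArg (2 * ·) (Eq.trans (tsum_congr fun n => ?_) tsum_mul_left)
  have : exp (Real.pi * I * (I * y) * (n + 1 / 2) ^ 2) = (Real.exp (-(Real.pi * y / 4)) : ℂ) *
      (Real.exp (-(Real.pi * y * (n * (n + 1)))) : ℂ) := by
    rw [ofReal_exp, ofReal_exp, ← exp_add]
    congr 1
    push_cast
    linear_combination (Real.pi * y * (n + 1 / 2) ^ 2 : ℂ) * I_mul_I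
  rw [this]
  ring

lemma tendsto_jacobiThetaOne : Tendsto (fun y : ℝ => jacobiThetaOne (Real.pi / 2) (I * y) /
    Real.exp (-(Real.pi * y / 4))) atTop (𝓝 2) := by
  have e : ∀ y : ℝ, jacobiThetaOne (Real.pi / 2) (I * y) / Real.exp (-(Real.pi * y / 4)) =
      2 * ∑' n : ℕ, (-1) ^ n * (Real.exp (-(Real.pi * y * (n * (n + 1)))) : ℂ) *
        sin ((2 * n + 1) * (Real.pi / 2)) := by
    intro y
    rw [jacobiThetaOne_pi_div_two, mul_div_cancel_left₀ _ (by simp)]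
  simp only [e]
  have key : Tendsto (fun y : ℝ => ∑' n : ℕ,
      (-1) ^ n * (Real.exp (-(Real.pi * y * (n * (n + 1)))) : ℂ) *
        sin ((2 * n + 1) * (Real.pi / 2))) atTop (𝓝 (∑' n : ℕ, if n = 0 then (1 : ℂ) else 0)) := by
    have hsin : ∀ n : ℕ, ‖sin ((2 * n + 1) * (Real.pi / 2) : ℂ)‖ ≤ 1 := by
      intro n
      have : ((2 * n + 1) * (Real.pi / 2) : ℂ) = (((2 * n + 1) * (Real.pi / 2) : ℝ) : ℂ) := by
        push_cast; ring
      rw [this, ← ofReal_sin, norm_real]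
      exact Real.abs_sin_le_one _
    have hb : ∀ (y : ℝ) (n : ℕ), ‖(-1) ^ n * (Real.exp (-(Real.pi * y * (n * (n + 1)))) : ℂ) *
        sin ((2 * n + 1) * (Real.pi / 2))‖ ≤ Real.exp (-(Real.pi * y * (n * (n + 1)))) := by
      intro y n
      rw [norm_mul, norm_mul, norm_pow, norm_neg, norm_one, one_pow, one_mul, norm_real,
        Real.norm_eq_abs, Real.abs_exp]
      exact mul_le_of_le_one_right (Real.exp_pos _).le (hsin n)
    refine tendsto_tsum_of_dominated_convergence (bound := fun n : ℕ => Real.exp (-1) ^ n)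
      (summable_geometric_of_lt_one (Real.exp_pos _).le (by simp)) ?_ ?_
    · intro n
      rcases Nat.eq_zero_or_pos n with rfl | hn
      · simp
      · rw [if_neg hn.ne']
        refine squeeze_zero_norm (fun y => hb y n) ?_
        refine Real.tendsto_exp_neg_atTop_nhds_zero.comp ?_
        have : (0 : ℝ) < n := by exact_mod_cast hn
        exact (tendsto_id.const_mul_atTop Real.pi_pos).atTop_mul_const (by positivity)
    · filter_upwards [eventually_ge_atTop 1] with y hy n
      refine (hb y n).trans ?_
      rw [← Real.exp_nat_mul]
      refine Real.exp_le_exp.2 ?_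
      have h1 : (1 : ℝ) ≤ Real.pi * y := by nlinarith [Real.pi_gt_three]
      have h2 : (0 : ℝ) ≤ n := Nat.cast_nonneg n
      nlinarith [mul_nonneg h2 h2, mul_nonneg (sub_nonneg.2 h1) (mul_nonneg h2 (by linarith : (0 : ℝ) ≤ n + 1))]
  rw [tsum_ite_eq] at key
  simpa using key.const_mul 2

lemma tendsto_eta : Tendsto (fun y : ℝ => eta (I * y) ^ 3 / Real.exp (-(Real.pi * y / 4)))
    atTop (𝓝 1) := by
  have e : ∀ y : ℝ, eta (I * y) ^ 3 / Real.exp (-(Real.pi * y / 4)) =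
      (∏' n : ℕ, (1 + -nome (I * y) ^ (n + 1))) ^ 3 := by
    intro y
    have h1 : Function.Periodic.qParam 24 (I * y) ^ 3 = Real.exp (-(Real.pi * y / 4)) := by
      rw [Function.Periodic.qParam, ← exp_nat_mul, ofReal_exp]
      congr 1
      push_cast
      linear_combination (Real.pi * y / 4 : ℂ) * I_mul_I
    rw [eta, mul_pow, h1, mul_div_cancel_left₀ _ (by simp)]
    simp only [eta_q_eq_pow, nome, sub_eq_add_neg]
  simp only [e]
  have hy : ∀ᶠ y : ℝ in atTop, ‖nome (I * y)‖ ≤ 1 / 2 :=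
    tendsto_norm_nome.eventually_le_const (by norm_num)
  have := tendsto_tprod_one_add_of_dominated_convergence (𝓕 := atTop) (g := fun _ : ℕ => (0 : ℂ))
    (f := fun (y : ℝ) n => -nome (I * y) ^ (n + 1)) (bound := fun n => (1 / 2 : ℝ) ^ n)
    (summable_geometric_of_abs_lt_one (by norm_num [abs_of_pos])) ?_ ?_
  · simpa using this.pow 3
  · intro n
    have h := (tendsto_zero_iff_norm_tendsto_zero.2 tendsto_norm_nome).pow (n + 1)
    simpa using h.neg
  · filter_upwards [hy] with y h2 n
    rw [norm_neg, norm_pow, pow_succ]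
    have h3 : ‖nome (I * y)‖ ^ n ≤ (1 / 2) ^ n := by gcongr
    have h4 : ‖nome (I * y)‖ ≤ 1 := by linarith
    exact (mul_le_of_le_one_right (by positivity) h4).trans h3

/-- Jacobi's derivative formula `θ₁'(0) = 2η³`. -/
lemma pb_jacobiThetaOne_zero (hτ : τ ∈ upperHalf) : pb jacobiThetaOne 0 τ = 2 * eta τ ^ 3 := by
  have hopen : IsOpen upperHalf := isOpen_upperHalf
  have hη : ∀ {τ : ℂ}, τ ∈ upperHalf → eta τ ≠ 0 := fun {τ} hτ => eta_ne_zero (z := τ) hτ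
  -- `θ₁'(0)` and `η³` have the same logarithmic derivative `-(πi/4)E`, so their ratio is constant
  -- on the half-plane.
  have hd : ∀ τ ∈ upperHalf, HasDerivAt (fun τ => pb jacobiThetaOne 0 τ / eta τ ^ 3) 0 τ := by
    intro τ hτ
    refine ((hasDerivAt_pb_jacobiThetaOne_zero hτ).div ((hasDerivAt_eta hτ).pow 3)
      (pow_ne_zero _ (hη hτ))).congr_deriv ?_
    rw [div_eq_zero_iff]
    left
    simp only [Nat.cast_ofNat, Nat.add_one_sub_one, Pi.pow_apply]
    ring
  have hI : I ∈ upperHalf := by simp [upperHalf]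
  have hc : ∀ τ ∈ upperHalf, pb jacobiThetaOne 0 τ / eta τ ^ 3 = pb jacobiThetaOne 0 I / eta I ^ 3 :=
    fun τ hτ => hopen.is_const_of_deriv_eq_zero isPreconnected_upperHalf
      (fun τ hτ => (hd τ hτ).differentiableAt.differentiableWithinAt)
      (fun τ hτ => (hd τ hτ).deriv) hτ hI
  -- The constant is found at `i∞`: `θ₁'(0)` equals `θ₁(π/2)` divided by the product at `π/2`, the
  -- product tends to 1, and both `θ₁(π/2)` and `η³` have the leading exponential `e^{-πy/4}`, with
  -- coefficients 2 and 1.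
  have hlim : Tendsto (fun y : ℝ => pb jacobiThetaOne 0 (I * y) / eta (I * y) ^ 3) atTop (𝓝 2) := by
    have h := (tendsto_jacobiThetaOne.div tendsto_thetaProduct one_ne_zero).div tendsto_eta one_ne_zero
    rw [div_one, div_one] at h
    refine h.congr' ?_
    filter_upwards [eventually_gt_atTop 0,
      tendsto_thetaProduct.eventually_ne one_ne_zero] with y hy hP
    have hτ := I_mul_mem_upperHalf hy
    have hE : (Real.exp (-(Real.pi * y / 4)) : ℂ) ≠ 0 := by simp
    have h3 := hη hτ
    simp only [Pi.div_apply]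
    rw [jacobiThetaOne_eq_mul_thetaProduct hτ]
    field_simp
  have h2 : pb jacobiThetaOne 0 I / eta I ^ 3 = 2 := by
    refine tendsto_nhds_unique (tendsto_const_nhds.congr' ?_) hlim
    filter_upwards [eventually_gt_atTop 0] with y hy
    exact (hc _ (I_mul_mem_upperHalf hy)).symm
  have := hc τ hτ
  rw [h2, div_eq_iff (pow_ne_zero _ (hη hτ))] at this
  exact this

lemma jacobiThetaOne_eq_eta (hτ : τ ∈ upperHalf) (z : ℂ) :
    jacobiThetaOne z τ = 2 * eta τ ^ 3 * thetaProduct z τ := by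
  rw [jacobiThetaOne_eq_mul_thetaProduct hτ, pb_jacobiThetaOne_zero hτ]

lemma modularDisc_eq (hτ : τ ∈ upperHalf) : modularDisc τ = (2 * Real.pi) ^ 12 * eta τ ^ 24 := by
  have h := discriminant_eq_q_prod ⟨τ, hτ⟩
  rw [discriminant] at h
  have h' : eta τ ^ 24 = _ := h
  rw [h', modularDisc, mul_assoc]
  simp [Function.Periodic.qParam, eta_q_eq_pow]

/-- `Δ` is a constant times `η²⁴`, so `Δ'/(2Δ) = 12 η'/η`. -/
lemma ellipticChazy_eq (hτ : τ ∈ upperHalf) : ellipticChazy τ = -(Real.pi * I) * thetaE τ := by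
  have hη : eta τ ≠ 0 := eta_ne_zero (z := τ) hτ
  have h1 : HasDerivAt modularDisc ((2 * Real.pi) ^ 12 *
      (24 * eta τ ^ 23 * (-(Real.pi * I / 12) * thetaE τ * eta τ))) τ := by
    refine (((hasDerivAt_eta hτ).pow 24).const_mul _).congr_of_eventuallyEq ?_
    filter_upwards [isOpen_upperHalf.mem_nhds hτ] with t ht
    exact modularDisc_eq ht
  have hπ : (Real.pi : ℂ) ≠ 0 := by exact_mod_cast Real.pi_ne_zero
  rw [ellipticChazy, h1.deriv, modularDisc_eq hτ]
  field_simp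
  ring

end ThetaNull

/-! ### The Weierstrass product of the sigma function -/

section Sigma

open Filter Topology Complex

/-- Two entire functions equal to `1` at the origin coincide if their logarithms have the same
derivative at the origin and the same second derivative near the origin. -/
lemma eq_of_deriv_logDeriv_eq {f g : ℂ → ℂ} (hf : Differentiable ℂ f) (hg : Differentiable ℂ g)
    (f0 : f 0 = 1) (g0 : g 0 = 1) (h0 : logDeriv f 0 = logDeriv g 0)
    (h : ∀ᶠ z in 𝓝 0, deriv (logDeriv f) z = deriv (logDeriv g) z) : f = g := by
  have hne : ∀ {f : ℂ → ℂ}, Differentiable ℂ f → f 0 = 1 → ∀ᶠ z in 𝓝 0, f z ≠ 0 := fun hf f0 =>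
    hf.continuous.continuousAt.eventually_ne (by rw [f0]; exact one_ne_zero)
  obtain ⟨r, hr, H⟩ := Metric.eventually_nhds_iff_ball.1 ((hne hf f0).and ((hne hg g0).and h))
  have h0B : (0 : ℂ) ∈ Metric.ball (0 : ℂ) r := Metric.mem_ball_self hr
  have hB : IsPreconnected (Metric.ball (0 : ℂ) r) := (convex_ball _ _).isPreconnected
  have dlog : ∀ {f : ℂ → ℂ}, Differentiable ℂ f → ∀ {z}, f z ≠ 0 →
      HasDerivAt (logDeriv f) (deriv (logDeriv f) z) z := fun {f} hf {z} hz =>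
    (((hf.contDiff (n := 2)).differentiable_deriv_two z).div (hf z) hz :
      DifferentiableAt ℂ (logDeriv f) z).hasDerivAt
  have key : ∀ z ∈ Metric.ball (0 : ℂ) r,
      HasDerivAt (fun z => logDeriv f z - logDeriv g z) 0 z := fun z hz =>
    ((dlog hf (H z hz).1).sub (dlog hg (H z hz).2.1)).congr_deriv
      (sub_eq_zero.2 (H z hz).2.2)
  have hlog : Set.EqOn (logDeriv f) (logDeriv g) (Metric.ball (0 : ℂ) r) := by
    intro z hz
    have h1 := Metric.isOpen_ball.is_const_of_deriv_eq_zero hB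
      (fun z hz => (key z hz).differentiableAt.differentiableWithinAt)
      (fun z hz => (key z hz).deriv) hz h0B
    simp only [h0, sub_self] at h1
    exact sub_eq_zero.1 h1
  obtain ⟨c, -, hc⟩ := (logDeriv_eqOn_iff hf.differentiableOn hg.differentiableOn
    Metric.isOpen_ball hB (fun z hz => (H z hz).2.1) (fun z hz => (H z hz).1)).1 hlog
  have hc1 : c = 1 := by
    have := hc h0B
    simpa [f0, g0] using this.symm
  refine AnalyticOnNhd.eq_of_eventuallyEq (z₀ := 0) (fun z _ => hf.analyticAt z)
    (fun z _ => hg.analyticAt z) ?_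
  filter_upwards [Metric.isOpen_ball.mem_nhds h0B] with z hz
  rw [hc hz, hc1, one_smul]

/-- The canonical factor `(1 - x) e^{x + x²/2}`. -/
def sigmaFactor (x : ℂ) : ℂ := (1 - x) * exp (x + x ^ 2 / 2)

lemma hasDerivAt_sigmaFactor (x : ℂ) :
    HasDerivAt sigmaFactor (-x ^ 2 * exp (x + x ^ 2 / 2)) x := by
  have h1 : HasDerivAt (fun x : ℂ => x + x ^ 2 / 2) (1 + x) x :=
    ((hasDerivAt_id x).add (((hasDerivAt_id x).pow 2).div_const 2)).congr_deriv (by simp)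
  exact (((hasDerivAt_id x).const_sub 1).mul h1.cexp).congr_deriv (by simp only [id]; ring)

/-- The derivative `-x² e^{x + x²/2}` is of second order, so the mean value inequality gives a third
order bound; `3/2` bounds `|x + x²/2|` on the unit disc. -/
lemma norm_sigmaFactor_sub_one_le {x : ℂ} (hx : ‖x‖ ≤ 1) :
    ‖sigmaFactor x - 1‖ ≤ Real.exp (3 / 2) * ‖x‖ ^ 3 := by
  have h := (convex_closedBall (0 : ℂ) ‖x‖).norm_image_sub_le_of_norm_hasDerivWithin_le
    (f := sigmaFactor) (C := Real.exp (3 / 2) * ‖x‖ ^ 2)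
    (fun y _ => (hasDerivAt_sigmaFactor y).hasDerivWithinAt) (fun y hy => ?_)
    (x := 0) (y := x) (by simp) (by simp)
  · rw [sub_zero] at h
    have h0 : sigmaFactor 0 = 1 := by simp [sigmaFactor]
    rw [h0] at h
    exact h.trans (le_of_eq (by ring))
  · rw [mem_closedBall_zero_iff] at hy
    rw [norm_mul, norm_neg, norm_pow, norm_exp, mul_comm]
    gcongr
    refine (re_le_norm _).trans ((norm_add_le _ _).trans ?_)
    rw [norm_div, norm_pow, RCLike.norm_ofNat]
    nlinarith [norm_nonneg y]

variable (L : PeriodPair)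

/-- The product `σ(z) / z` of the canonical factors. -/
def sigmaProduct (z : ℂ) : ℂ := ∏' l : L.lattice, sigmaFactor (z / l)

lemma latticeSigma_eq (z : ℂ) : latticeSigma L z = z * sigmaProduct L z := by
  rw [latticeSigma, sigmaProduct]
  congr 2
  funext l
  rw [sigmaFactor, div_pow, div_div, mul_comm (2 : ℂ)]

/-- The factors are `1 + O(|l|⁻³)`, which is summable over a lattice of rank two. The estimate
requires `|z| ≤ |l|`, true for all but finitely many `l`. -/
lemma multipliableLocallyUniformlyOn_sigmaFactor (R : ℝ) :
    MultipliableLocallyUniformlyOn (fun (l : L.lattice) z => sigmaFactor (z / l))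
      (Metric.ball 0 R) := by
  have hu : Summable fun l : L.lattice => Real.exp (3 / 2) * (R ^ 3 * ‖l‖ ^ (-3 : ℝ)) :=
    ((ZLattice.summable_norm_rpow _ _ (by simp; norm_num)).mul_left _).mul_left _
  have h := hu.multipliableLocallyUniformlyOn_one_add
    (f := fun (l : L.lattice) z => sigmaFactor (z / l) - 1)
    (Metric.isOpen_ball (x := (0 : ℂ)) (ε := R)) ?_ ?_
  · simpa using h
  · have h1 : ∀ᶠ l : L.lattice in cofinite, R + 1 ≤ ‖l‖ ∧ 1 ≤ ‖l‖ := by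
      rw [← cocompact_eq_cofinite]
      exact ((tendsto_norm_cocompact_atTop (E := L.lattice)).eventually_ge_atTop _).and
        ((tendsto_norm_cocompact_atTop (E := L.lattice)).eventually_ge_atTop _)
    filter_upwards [h1] with l hl z hz
    rw [mem_ball_zero_iff] at hz
    have hl0 : 0 < ‖(l : ℂ)‖ := lt_of_lt_of_le one_pos hl.2
    have hle : ‖z / (l : ℂ)‖ ≤ R / ‖(l : ℂ)‖ := by
      rw [norm_div]
      gcongr
    have hle1 : R / ‖(l : ℂ)‖ ≤ 1 := by
      rw [div_le_one hl0]
      have := hl.1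
      rw [Submodule.coe_norm] at this
      linarith
    refine (norm_sigmaFactor_sub_one_le (hle.trans hle1)).trans ?_
    gcongr
    refine (pow_le_pow_left₀ (norm_nonneg _) hle 3).trans (le_of_eq ?_)
    rw [Real.rpow_neg (norm_nonneg _), div_pow, div_eq_mul_inv, Submodule.coe_norm]
    norm_cast
  · intro l
    simp only [sigmaFactor]
    fun_prop

lemma differentiable_sigmaFactor_div (l : ℂ) : Differentiable ℂ fun z => sigmaFactor (z / l) := by
  simp only [sigmaFactor]
  fun_prop

lemma differentiable_sigmaProduct : Differentiable ℂ (sigmaProduct L) := by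
  intro u
  have hu : u ∈ Metric.ball (0 : ℂ) (‖u‖ + 1) := by simp
  refine DifferentiableOn.differentiableAt (s := Metric.ball (0 : ℂ) (‖u‖ + 1)) ?_
    (Metric.isOpen_ball.mem_nhds hu)
  exact (multipliableLocallyUniformlyOn_sigmaFactor L _).hasProdLocallyUniformlyOn.differentiableOn
    (.of_forall fun _ => by simpa [Finset.prod_fn] using
      DifferentiableOn.finsetProd (fun l _ => (differentiable_sigmaFactor_div _).differentiableOn))
    Metric.isOpen_ball

lemma sigmaProduct_zero : sigmaProduct L 0 = 1 := by simp [sigmaProduct, sigmaFactor]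

lemma exists_lattice_gap : ∃ r > 0, ∀ l ∈ L.lattice, l ≠ 0 → 2 * r ≤ ‖l‖ := by
  obtain ⟨ε, hε, h⟩ := Metric.mem_nhds_iff.1 (L.compl_lattice_sdiff_singleton_mem_nhds 0)
  refine ⟨ε / 2, half_pos hε, fun l hl hl0 => ?_⟩
  by_contra hlt
  exact h (mem_ball_zero_iff.2 (by linarith)) ⟨hl, hl0⟩

/-- For `l = 0` both sides are zero because division by zero gives zero, so the lattice sums need no
exceptional term. -/
lemma logDeriv_sigmaFactor_div {l z : ℂ} (h : l ≠ 0 → ‖z‖ < ‖l‖) :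
    logDeriv (fun z => sigmaFactor (z / l)) z = z ^ 2 / (l ^ 2 * (z - l)) := by
  by_cases hl : l = 0
  · simp [hl, logDeriv_apply]
  · have h2 : z - l ≠ 0 := by
      intro h3
      have := h hl
      rw [sub_eq_zero.1 h3] at this
      exact lt_irrefl _ this
    have h3 : l - z ≠ 0 := by rwa [← neg_sub, neg_ne_zero]
    have h1 : HasDerivAt (fun z => sigmaFactor (z / l))
        (-(z / l) ^ 2 * exp (z / l + (z / l) ^ 2 / 2) * (1 / l)) z :=
      HasDerivAt.comp (h := fun z => z / l) z (hasDerivAt_sigmaFactor (z / l))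
        ((hasDerivAt_id z).div_const l)
    rw [logDeriv_apply, h1.deriv, sigmaFactor]
    have h4 := exp_ne_zero (z / l + (z / l) ^ 2 / 2)
    generalize exp (z / l + (z / l) ^ 2 / 2) = e at *
    have h5 : 1 - z / l ≠ 0 := by
      rw [one_sub_div hl]
      exact div_ne_zero h3 hl
    rw [div_eq_div_iff (mul_ne_zero h5 h4) (mul_ne_zero (pow_ne_zero _ hl) h2)]
    field_simp
    ring

lemma hasDerivAt_logDeriv_sigmaFactor {l z : ℂ} (h : l ≠ 0 → z ≠ l) :
    HasDerivAt (fun z => z ^ 2 / (l ^ 2 * (z - l)))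
      (-(if l = 0 then 0 else 1 / (z - l) ^ 2 - 1 / l ^ 2)) z := by
  by_cases hl : l = 0
  · simpa [hl] using hasDerivAt_const z (0 : ℂ)
  · rw [if_neg hl]
    have h2 : z - l ≠ 0 := sub_ne_zero.2 (h hl)
    refine (((hasDerivAt_id z).pow 2).div (((hasDerivAt_id z).sub_const l).const_mul (l ^ 2))
      (mul_ne_zero (pow_ne_zero _ hl) h2)).congr_deriv ?_
    simp only [id, Pi.pow_apply]
    field_simp
    ring

/-- Near the origin `(ln (σ(z) / z))'' = 1/z² - ℘(z)`. -/
lemma hasDerivAt_logDeriv_sigmaProduct : ∃ r > 0, logDeriv (sigmaProduct L) 0 = 0 ∧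
    ∀ z ∈ Metric.ball (0 : ℂ) r, sigmaProduct L z ≠ 0 ∧
      HasDerivAt (logDeriv (sigmaProduct L)) (-L.weierstrassPExcept 0 z) z := by
  -- The gap `2r` is what the estimate `weierstrassP_bound` requires for points of the ball of
  -- radius `r`.
  obtain ⟨r, hr, hgap⟩ := exists_lattice_gap L
  set B := Metric.ball (0 : ℂ) r with hB
  have hlt : ∀ l ∈ L.lattice, ∀ z ∈ B, l ≠ 0 → ‖z‖ < ‖l‖ := by
    intro l hl z hz hl0
    have h1 := hgap l hl hl0
    rw [hB, mem_ball_zero_iff] at hz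
    linarith
  have hne : ∀ l ∈ L.lattice, ∀ z ∈ B, l ≠ 0 → z ≠ l := by
    intro l hl z hz hl0 h
    have := hlt l hl z hz hl0
    rw [h] at this
    exact lt_irrefl _ this
  have hu : Summable fun l : L.lattice => 10 * r * ‖l‖ ^ (-3 : ℝ) :=
    (ZLattice.summable_norm_rpow _ _ (by simp; norm_num)).mul_left _
  have hbd : ∀ (l : L.lattice), ∀ y ∈ B,
      ‖-(if (l : ℂ) = 0 then 0 else 1 / (y - l) ^ 2 - 1 / (l : ℂ) ^ 2)‖ ≤
        10 * r * ‖l‖ ^ (-3 : ℝ) := by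
    intro l y hy
    rw [norm_neg]
    split_ifs with h
    · rw [norm_zero]
      positivity
    · exact PeriodPair.weierstrassP_bound r hr y (mem_ball_zero_iff.1 hy) l (hgap l l.2 h)
  have hder : ∀ z ∈ B, HasDerivAt (fun z => ∑' l : L.lattice, z ^ 2 / ((l : ℂ) ^ 2 * (z - l)))
      (∑' l : L.lattice, -(if (l : ℂ) = 0 then 0 else 1 / (z - l) ^ 2 - 1 / (l : ℂ) ^ 2)) z := by
    intro z hz
    exact hasDerivAt_tsum_of_isPreconnected
      (g := fun (l : L.lattice) (z : ℂ) => z ^ 2 / ((l : ℂ) ^ 2 * (z - l)))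
      (g' := fun (l : L.lattice) (z : ℂ) =>
        -(if (l : ℂ) = 0 then 0 else 1 / (z - l) ^ 2 - 1 / (l : ℂ) ^ 2))
      (t := B) (y₀ := 0) (y := z) hu Metric.isOpen_ball
      (convex_ball (0 : ℂ) r).isPreconnected
      (fun l y hy => hasDerivAt_logDeriv_sigmaFactor (hne l l.2 y hy)) hbd
      (Metric.mem_ball_self hr) (by simp) hz
  have hsum : ∀ z ∈ B, Summable fun l : L.lattice => z ^ 2 / ((l : ℂ) ^ 2 * (z - l)) := by
    intro z hz
    exact summable_of_summable_hasDerivAt_of_isPreconnected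
      (g := fun (l : L.lattice) (z : ℂ) => z ^ 2 / ((l : ℂ) ^ 2 * (z - l)))
      (g' := fun (l : L.lattice) (z : ℂ) =>
        -(if (l : ℂ) = 0 then 0 else 1 / (z - l) ^ 2 - 1 / (l : ℂ) ^ 2))
      (t := B) (y₀ := 0) (y := z) hu Metric.isOpen_ball
      (convex_ball (0 : ℂ) r).isPreconnected
      (fun l y hy => hasDerivAt_logDeriv_sigmaFactor (hne l l.2 y hy)) hbd
      (Metric.mem_ball_self hr) (by simp) hz
  have hfac : ∀ z ∈ B, ∀ l : L.lattice, sigmaFactor (z / l) ≠ 0 := by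
    intro z hz l h
    rw [sigmaFactor, mul_eq_zero] at h
    have h1 := h.resolve_right (exp_ne_zero _)
    by_cases hl : (l : ℂ) = 0
    · simp [hl] at h1
    · rw [one_sub_div hl, div_eq_zero_iff] at h1
      exact hne l l.2 z hz hl (sub_eq_zero.1 (h1.resolve_right hl)).symm
  obtain ⟨ρ, hρ, hρS⟩ := Metric.eventually_nhds_iff_ball.1
    ((differentiable_sigmaProduct L).continuous.continuousAt.eventually_ne
      (y := 0) (x := 0) (by rw [sigmaProduct_zero]; exact one_ne_zero))
  have hlog : ∀ z ∈ Metric.ball (0 : ℂ) (min r ρ),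
      logDeriv (sigmaProduct L) z = ∑' l : L.lattice, z ^ 2 / ((l : ℂ) ^ 2 * (z - l)) := by
    intro z hz
    have hzB : z ∈ B := Metric.ball_subset_ball (min_le_left _ _) hz
    have e : ∀ l : L.lattice, logDeriv (fun z => sigmaFactor (z / l)) z =
        z ^ 2 / ((l : ℂ) ^ 2 * (z - l)) := fun l => logDeriv_sigmaFactor_div (hlt l l.2 z hzB)
    have h := logDeriv_tprod_eq_tsum (f := fun (l : L.lattice) z => sigmaFactor (z / l))
      Metric.isOpen_ball hzB (hfac z hzB)
      (fun l => (differentiable_sigmaFactor_div _).differentiableOn)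
      (by simpa only [e] using hsum z hzB) (multipliableLocallyUniformlyOn_sigmaFactor L r)
      (hρS z (Metric.ball_subset_ball (min_le_right _ _) hz))
    simp only [e] at h
    exact h
  refine ⟨min r ρ, lt_min hr hρ, ?_, fun z hz => ?_⟩
  · rw [hlog 0 (Metric.mem_ball_self (lt_min hr hρ))]
    simp
  · refine ⟨hρS z (Metric.ball_subset_ball (min_le_right _ _) hz), ?_⟩
    have h := hder z (Metric.ball_subset_ball (min_le_left _ _) hz)
    rw [tsum_neg] at h
    refine (h.congr_of_eventuallyEq ?_)
    filter_upwards [Metric.isOpen_ball.mem_nhds hz] with t ht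
    exact hlog t ht

end Sigma

/-! ### Theta functions as sigma functions -/

section ThetaModel

open Filter Topology Complex

/-- An entire odd function with simple zeros at the points of a lattice, quasi-periodic with
exponential multipliers, and normalized by `P'(0) = 1`, `P'''(0) = E`. -/
structure ThetaModel (L : PeriodPair) (P : ℂ → ℂ) (E : ℂ) : Prop where
  differentiable : Differentiable ℂ P
  eq_zero_iff : ∀ z, P z = 0 ↔ z ∈ L.lattice
  odd : ∀ z, P (-z) = -P z
  deriv_zero : deriv P 0 = 1
  deriv_three : deriv (deriv (deriv P)) 0 = E
  quasi_one : ∃ a b, ∀ z, P (z + L.ω₁) = exp (a * z + b) * P z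
  quasi_two : ∃ a b, ∀ z, P (z + L.ω₂) = exp (a * z + b) * P z

lemma thetaModel_thetaProduct {τ : ℂ} (hτ : τ ∈ upperHalf) :
    ThetaModel (thetaLattice τ hτ) (fun z => thetaProduct z τ) (thetaE τ) where
  differentiable := differentiable_thetaProduct hτ
  eq_zero_iff := thetaProduct_eq_zero_iff hτ
  odd z := thetaProduct_neg z
  deriv_zero := (hasDerivAt_thetaProduct_zero hτ).deriv
  deriv_three := deriv_three_thetaProduct_zero hτ
  quasi_one := ⟨0, Real.pi * I, fun z => by
    rw [thetaLattice_one, thetaProduct_add_pi, zero_mul, zero_add, exp_pi_mul_I, neg_one_mul]⟩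
  quasi_two := ⟨-2 * I, -(Real.pi * I * τ) + Real.pi * I, fun z => by
    rw [thetaLattice_two, thetaProduct_add_pi_mul hτ, ← add_assoc, exp_add _ (Real.pi * I),
      exp_pi_mul_I, mul_neg_one, ← sub_eq_add_neg]⟩

/-- The period pair `(ω₁ / κ, ω₂ / κ)`. -/
def scaleLattice (L : PeriodPair) (κ : ℂ) (hκ : κ ≠ 0) : PeriodPair where
  ω₁ := L.ω₁ / κ
  ω₂ := L.ω₂ / κ
  indep := by
    have h := L.indep
    rw [LinearIndependent.pair_iff] at h ⊢
    intro s t hst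
    refine h s t ?_
    simp only [real_smul] at hst ⊢
    have : (s : ℂ) * L.ω₁ + t * L.ω₂ = κ * (s * (L.ω₁ / κ) + t * (L.ω₂ / κ)) := by
      field_simp
    rw [this, hst, mul_zero]

lemma mem_scaleLattice {L : PeriodPair} {κ : ℂ} (hκ : κ ≠ 0) {z : ℂ} :
    z ∈ (scaleLattice L κ hκ).lattice ↔ κ * z ∈ L.lattice := by
  rw [PeriodPair.mem_lattice, PeriodPair.mem_lattice]
  refine exists_congr fun m => exists_congr fun n => ?_
  simp only [scaleLattice]
  rw [← mul_right_inj' hκ]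
  have : κ * (m * (L.ω₁ / κ) + n * (L.ω₂ / κ)) = m * L.ω₁ + n * L.ω₂ := by field_simp
  rw [this]

lemma deriv_comp_mul_left_div (P : ℂ → ℂ) (κ c : ℂ) :
    deriv (fun z => P (κ * z) / c) = fun z => κ * deriv P (κ * z) / c := by
  funext z
  rw [deriv_div_const, deriv_comp_mul_left, smul_eq_mul]

variable {L : PeriodPair} {P : ℂ → ℂ} {E : ℂ}

lemma ThetaModel.scale (h : ThetaModel L P E) {κ : ℂ} (hκ : κ ≠ 0) :
    ThetaModel (scaleLattice L κ hκ) (fun z => P (κ * z) / κ) (κ ^ 2 * E) where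
  differentiable := (h.differentiable.comp (differentiable_id.const_mul κ)).div_const κ
  eq_zero_iff z := by
    rw [div_eq_zero_iff, h.eq_zero_iff, mem_scaleLattice]
    simp [hκ]
  odd z := by rw [mul_neg, h.odd, neg_div]
  deriv_zero := by
    rw [deriv_comp_mul_left_div]
    simp only [mul_zero, h.deriv_zero, mul_one, div_self hκ]
  deriv_three := by
    have e1 : deriv (fun z => P (κ * z) / κ) = fun z => deriv P (κ * z) / 1 := by
      rw [deriv_comp_mul_left_div]
      funext z
      field_simp
    have e2 : deriv (fun z => deriv P (κ * z) / 1) = fun z => deriv (deriv P) (κ * z) / κ⁻¹ := by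
      rw [deriv_comp_mul_left_div]
      funext z
      field_simp
    rw [e1, e2, deriv_comp_mul_left_div]
    simp only [mul_zero, h.deriv_three]
    field_simp
  quasi_one := by
    obtain ⟨a, b, hab⟩ := h.quasi_one
    refine ⟨a * κ, b, fun z => ?_⟩
    rw [show κ * (z + (scaleLattice L κ hκ).ω₁) = κ * z + L.ω₁ by
      simp only [scaleLattice]; field_simp, hab, mul_div_assoc, mul_assoc a]
  quasi_two := by
    obtain ⟨a, b, hab⟩ := h.quasi_two
    refine ⟨a * κ, b, fun z => ?_⟩
    rw [show κ * (z + (scaleLattice L κ hκ).ω₂) = κ * z + L.ω₂ by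
      simp only [scaleLattice]; field_simp, hab, mul_div_assoc, mul_assoc a]

namespace ThetaModel

variable (h : ThetaModel L P E)
include h

lemma apply_zero : P 0 = 0 := (h.eq_zero_iff 0).2 (zero_mem _)

lemma eq_mul_dslope (z : ℂ) : P z = z * dslope P 0 z := by
  have := sub_smul_dslope P 0 z
  rw [h.apply_zero, sub_zero, sub_zero, smul_eq_mul] at this
  exact this.symm

lemma differentiable_dslope : Differentiable ℂ (dslope P 0) := fun _ =>
  ((Complex.differentiableOn_dslope univ_mem).2 h.differentiable.differentiableOn).differentiableAt
    univ_mem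

lemma dslope_zero : dslope P 0 0 = 1 := by rw [dslope_same, h.deriv_zero]

lemma dslope_neg (z : ℂ) : dslope P 0 (-z) = dslope P 0 z := by
  rcases eq_or_ne z 0 with rfl | hz
  · simp
  · have h1 := h.eq_mul_dslope (-z)
    rw [h.odd, h.eq_mul_dslope z, neg_mul, neg_inj] at h1
    exact (mul_left_cancel₀ hz h1).symm

lemma deriv_dslope_zero : deriv (dslope P 0) 0 = 0 := by
  have h1 : deriv (fun z => dslope P 0 (-z)) 0 = -deriv (dslope P 0) (-0) := deriv_comp_neg _ _
  simp only [h.dslope_neg, neg_zero] at h1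
  exact self_eq_neg.1 h1

/-- From `P = z p` one has `P''' = 3p'' + z p'''`. -/
lemma deriv_deriv_dslope_zero : deriv (deriv (dslope P 0)) 0 = E / 3 := by
  set p := dslope P 0 with hp
  have d0 : Differentiable ℂ p := h.differentiable_dslope
  have d1 : Differentiable ℂ (deriv p) := (d0.contDiff (n := 2)).differentiable_deriv_two
  have d2 : Differentiable ℂ (deriv (deriv p)) := (d1.contDiff (n := 2)).differentiable_deriv_two
  have e1 : deriv P = fun z => p z + z * deriv p z := by
    funext z
    have : P = fun z => z * p z := funext h.eq_mul_dslope
    rw [this]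
    exact (((hasDerivAt_id z).mul (d0 z).hasDerivAt).congr_deriv (by simp)).deriv
  have e2 : deriv (deriv P) = fun z => 2 * deriv p z + z * deriv (deriv p) z := by
    funext z
    rw [e1]
    exact (((d0 z).hasDerivAt.add ((hasDerivAt_id z).mul (d1 z).hasDerivAt)).congr_deriv
      (by simp; ring)).deriv
  have e3 : deriv (deriv (deriv P)) 0 = 3 * deriv (deriv p) 0 := by
    rw [e2]
    exact ((((d1 0).hasDerivAt.const_mul 2).add
      ((hasDerivAt_id 0).mul (d2 0).hasDerivAt)).congr_deriv (by simp; ring)).deriv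
  rw [← h.deriv_three, e3]
  ring

lemma analyticAt_logDeriv_dslope : AnalyticAt ℂ (logDeriv (dslope P 0)) 0 := by
  have h1 : AnalyticAt ℂ (dslope P 0) 0 := h.differentiable_dslope.analyticAt 0
  exact h1.deriv.div h1 (by rw [h.dslope_zero]; exact one_ne_zero)

lemma logDeriv_dslope_zero : logDeriv (dslope P 0) 0 = 0 := by
  rw [logDeriv_apply, h.deriv_dslope_zero, zero_div]

lemma deriv_logDeriv_dslope_zero : deriv (logDeriv (dslope P 0)) 0 = E / 3 := by
  have d0 : Differentiable ℂ (dslope P 0) := h.differentiable_dslope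
  have d1 : Differentiable ℂ (deriv (dslope P 0)) :=
    (d0.contDiff (n := 2)).differentiable_deriv_two
  have := ((d1 0).hasDerivAt.div (d0 0).hasDerivAt
    (by rw [h.dslope_zero]; exact one_ne_zero)).deriv
  rw [h.deriv_deriv_dslope_zero, h.deriv_dslope_zero, h.dslope_zero] at this
  simpa [logDeriv] using this

lemma logDeriv_eq {z : ℂ} (hz : z ≠ 0) (hp : dslope P 0 z ≠ 0) :
    logDeriv P z = z⁻¹ + logDeriv (dslope P 0) z := by
  have h1 : P = fun z => z * dslope P 0 z := funext h.eq_mul_dslope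
  rw [h1]
  have h2 := logDeriv_mul (f := fun z => z) (g := dslope P 0) z hz hp differentiableAt_id
    (h.differentiable_dslope z)
  rw [← h1]
  rw [← h1] at h2
  rw [h2, logDeriv_apply, deriv_id'', one_div]

lemma deriv_logDeriv_eq {z : ℂ} (hz : z ≠ 0) (hp : dslope P 0 z ≠ 0) :
    deriv (logDeriv P) z = -1 / z ^ 2 + deriv (logDeriv (dslope P 0)) z := by
  have h1 : logDeriv P =ᶠ[𝓝 z] fun z => z⁻¹ + logDeriv (dslope P 0) z := by
    filter_upwards [isOpen_ne.mem_nhds hz,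
      h.differentiable_dslope.continuous.continuousAt.eventually_ne hp] with t ht1 ht2
    exact h.logDeriv_eq ht1 ht2
  have d0 : Differentiable ℂ (dslope P 0) := h.differentiable_dslope
  have d1 : Differentiable ℂ (deriv (dslope P 0)) :=
    (d0.contDiff (n := 2)).differentiable_deriv_two
  have d2 : DifferentiableAt ℂ (logDeriv (dslope P 0)) z := (d1 z).div (d0 z) hp
  rw [h1.deriv_eq]
  exact (((hasDerivAt_inv hz).add d2.hasDerivAt).congr_deriv (by ring)).deriv

/-- A multiplier `e^{az+b}` contributes an affine summand to the logarithm, which two derivatives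
remove. -/
lemma deriv_logDeriv_add {κ : ℂ} (hκ : ∃ a b, ∀ z, P (z + κ) = exp (a * z + b) * P z) {z : ℂ}
    (hz : z ∉ L.lattice) : deriv (logDeriv P) (z + κ) = deriv (logDeriv P) z := by
  obtain ⟨a, b, hab⟩ := hκ
  have h1 : (fun t => logDeriv P (t + κ)) =ᶠ[𝓝 z] fun t => a + logDeriv P t := by
    filter_upwards [(isOpen_compl_lattice L).mem_nhds hz] with t ht
    have ht0 : P t ≠ 0 := fun h0 => ht ((h.eq_zero_iff t).1 h0)
    have e1 : deriv (fun t => P (t + κ)) t = deriv P (t + κ) := deriv_comp_add_const _ _ _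
    have e2 : HasDerivAt (fun t => exp (a * t + b)) (exp (a * t + b) * a) t :=
      ((((hasDerivAt_id t).const_mul a).add_const b).cexp).congr_deriv (by simp)
    simp only [hab] at e1
    have e3 : HasDerivAt (fun t => exp (a * t + b) * P t) _ t :=
      e2.mul (h.differentiable t).hasDerivAt
    rw [e3.deriv] at e1
    rw [logDeriv_apply, logDeriv_apply, ← e1, hab]
    field_simp [exp_ne_zero]
  rw [← deriv_comp_add_const, h1.deriv_eq, deriv_const_add]

lemma eventually_ne : ∀ᶠ z in 𝓝 (0 : ℂ), dslope P 0 z ≠ 0 :=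
  h.differentiable_dslope.continuous.continuousAt.eventually_ne
    (by rw [h.dslope_zero]; exact one_ne_zero)

omit h in
lemma weierstrassPExcept_zero_eq (L : PeriodPair) (z : ℂ) :
    L.weierstrassPExcept 0 z = L.weierstrassP z - 1 / z ^ 2 := by
  have := L.weierstrassPExcept_def 0 z
  simp only [ZeroMemClass.coe_zero, sub_zero] at this
  rw [this]
  simp [sub_eq_add_neg]

/-- `-(ln P)'' = ℘ - E/3`. -/
lemma neg_deriv_logDeriv {z : ℂ} (hz : z ∉ L.lattice) :
    -deriv (logDeriv P) z = L.weierstrassP z - E / 3 := by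
  have hcoe := L.periodic_weierstrassP
  -- The double poles cancel: near the origin the difference is `-(ln (P/z))'' - (℘ - 1/z²)`, which
  -- continues analytically with the value `-E/3`.
  have main := eq_const_of_elliptic (L := L)
    (f := fun z => -deriv (logDeriv P) z - L.weierstrassP z)
    (e := fun z => -deriv (logDeriv (dslope P 0)) z - L.weierstrassPExcept 0 z) ?_ ?_ ?_ ?_ ?_ hz
  · simp only [h.deriv_logDeriv_dslope_zero, weierstrassPExcept_zero_eq,
      PeriodPair.weierstrassP_zero] at main
    norm_num at main
    linear_combination main
  · intro z hz
    rw [h.deriv_logDeriv_add h.quasi_one hz, hcoe ⟨_, L.ω₁_mem_lattice⟩ z]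
  · intro z hz
    rw [h.deriv_logDeriv_add h.quasi_two hz, hcoe ⟨_, L.ω₂_mem_lattice⟩ z]
  · have h1 : DifferentiableOn ℂ (logDeriv P) (L.lattice : Set ℂ)ᶜ := fun z hz =>
      (((h.differentiable.contDiff (n := 2)).differentiable_deriv_two z).div (h.differentiable z)
        fun h0 => hz ((h.eq_zero_iff z).1 h0)).differentiableWithinAt
    exact (h1.deriv (isOpen_compl_lattice L)).neg.sub L.differentiableOn_weierstrassP
  · exact h.analyticAt_logDeriv_dslope.deriv.neg.sub (L.analyticAt_weierstrassPExcept 0)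
  · filter_upwards [h.eventually_ne] with z hp hz
    have hz0 : z ≠ 0 := fun h0 => hz (h0 ▸ zero_mem _)
    rw [h.deriv_logDeriv_eq hz0 hp, weierstrassPExcept_zero_eq]
    ring

lemma eventually_deriv_logDeriv : ∀ᶠ z in 𝓝 (0 : ℂ),
    deriv (logDeriv (dslope P 0)) z = E / 3 - L.weierstrassPExcept 0 z := by
  filter_upwards [h.eventually_ne, L.compl_lattice_sdiff_singleton_mem_nhds 0] with z hp hz
  rcases eq_or_ne z 0 with rfl | hz0
  · rw [h.deriv_logDeriv_dslope_zero, weierstrassPExcept_zero_eq]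
    simp
  · have hzl : z ∉ L.lattice := fun hl => hz ⟨hl, hz0⟩
    have h1 := h.neg_deriv_logDeriv hzl
    rw [h.deriv_logDeriv_eq hz0 hp] at h1
    rw [weierstrassPExcept_zero_eq]
    linear_combination -h1

/-- `P(z) = σ(z) e^{E z² / 6}`. -/
lemma eq_latticeSigma (z : ℂ) : P z = latticeSigma L z * exp (z ^ 2 * E / 6) := by
  obtain ⟨r, hr, hS0, hS⟩ := hasDerivAt_logDeriv_sigmaProduct L
  have dx : ∀ z : ℂ, HasDerivAt (fun z : ℂ => z ^ 2 * E / 6) (E / 3 * z) z := fun z =>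
    ((((hasDerivAt_id z).pow 2).mul_const E).div_const 6).congr_deriv (by simp; ring)
  have dS := differentiable_sigmaProduct L
  set Q : ℂ → ℂ := fun z => sigmaProduct L z * exp (z ^ 2 * E / 6) with hQ
  have hlQ : ∀ z ∈ Metric.ball (0 : ℂ) r,
      logDeriv Q z = logDeriv (sigmaProduct L) z + E / 3 * z := by
    intro z hz
    rw [hQ, logDeriv_mul (g := fun z => exp (z ^ 2 * E / 6)) z (hS z hz).1 (exp_ne_zero _) (dS z)
      (dx z).cexp.differentiableAt, logDeriv_apply (fun z => exp (z ^ 2 * E / 6)),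
      (dx z).cexp.deriv, mul_div_cancel_left₀ _ (exp_ne_zero _)]
  have h0B : (0 : ℂ) ∈ Metric.ball (0 : ℂ) r := Metric.mem_ball_self hr
  -- `P/z` and `(σ/z) e^{Ez²/6}` both equal 1 at the origin, have logarithmic derivative 0 there,
  -- and share the second logarithmic derivative `E/3 - (℘ - 1/z²)` near it.
  have heq : dslope P 0 = Q := by
    refine eq_of_deriv_logDeriv_eq h.differentiable_dslope
      (dS.mul fun z => (dx z).cexp.differentiableAt) h.dslope_zero
      (by simp [hQ, sigmaProduct_zero]) ?_ ?_
    · rw [h.logDeriv_dslope_zero, hlQ 0 h0B, hS0]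
      simp
    · filter_upwards [h.eventually_deriv_logDeriv, Metric.isOpen_ball.mem_nhds h0B] with z h1 hz
      have h2 : logDeriv Q =ᶠ[𝓝 z] fun z => logDeriv (sigmaProduct L) z + E / 3 * z := by
        filter_upwards [Metric.isOpen_ball.mem_nhds hz] with t ht using hlQ t ht
      have h3 : HasDerivAt (fun z => logDeriv (sigmaProduct L) z + E / 3 * z) _ z :=
        (hS z hz).2.add ((hasDerivAt_id z).const_mul (E / 3))
      rw [h1, h2.deriv_eq, h3.deriv]
      ring
  rw [h.eq_mul_dslope, heq, latticeSigma_eq, mul_assoc]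

end ThetaModel

end ThetaModel

/-! ### The cubic of `℘`, and sigma as a function of the invariants -/

section Weierstrass

open Filter Topology Complex

lemma half_notMem_lattice (L : PeriodPair) : L.ω₁ / 2 ∉ L.lattice := L.ω₁_div_two_notMem_lattice

/-- The `℘`-function is onto. -/
lemma exists_weierstrassP_eq (L : PeriodPair) (X : ℂ) : ∃ z ∉ L.lattice, L.weierstrassP z = X := by
  by_contra! hX
  have hcoe := L.periodic_weierstrassP
  have hden : ∀ z : ℂ, z ≠ 0 → L.weierstrassP z - X =
      (z ^ 2 * L.weierstrassPExcept 0 z + 1 - X * z ^ 2) / z ^ 2 := by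
    intro z hz
    rw [ThetaModel.weierstrassPExcept_zero_eq]
    field_simp
    ring
  have ha : AnalyticAt ℂ (fun z : ℂ => z ^ 2 * L.weierstrassPExcept 0 z + 1 - X * z ^ 2) 0 := by
    have := L.analyticAt_weierstrassPExcept 0
    fun_prop
  -- If `℘` omitted the value `X`, then `1/(℘ - X)` would be elliptic without poles and behave like
  -- `z²` at the origin, hence vanish identically.
  have main := eq_const_of_elliptic (L := L) (f := fun z => (L.weierstrassP z - X)⁻¹)
    (e := fun z => z ^ 2 / (z ^ 2 * L.weierstrassPExcept 0 z + 1 - X * z ^ 2))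
    (fun z _ => by simp only [hcoe ⟨_, L.ω₁_mem_lattice⟩ z])
    (fun z _ => by simp only [hcoe ⟨_, L.ω₂_mem_lattice⟩ z])
    (fun z hz => ((L.differentiableOn_weierstrassP z hz).sub_const X).inv
      (sub_ne_zero.2 (hX z hz)))
    ((analyticAt_id.pow 2).div ha (by simp)) ?_ (half_notMem_lattice L)
  · have h1 := sub_ne_zero.2 (hX _ (half_notMem_lattice L))
    simp [h1] at main
  · refine Eventually.of_forall fun z hz => ?_
    have hz0 : z ≠ 0 := fun h => hz (h ▸ zero_mem _)
    rw [hden z hz0, inv_div]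

/-- The functions `℘, ℘'` parametrize the cubic `Y² = 4X³ - g₂X - g₃`. -/
lemma exists_weierstrassP_derivWeierstrassP_eq (L : PeriodPair) {X Y : ℂ}
    (h : Y ^ 2 = 4 * X ^ 3 - L.g₂ * X - L.g₃) :
    ∃ z ∉ L.lattice, L.weierstrassP z = X ∧ L.derivWeierstrassP z = Y := by
  obtain ⟨z, hz, hX⟩ := exists_weierstrassP_eq L X
  have h1 := L.derivWeierstrassP_sq z hz
  rw [hX, ← h] at h1
  rcases sq_eq_sq_iff_eq_or_eq_neg.1 h1 with h2 | h2
  · exact ⟨z, hz, hX, h2⟩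
  · refine ⟨-z, fun h3 => hz (by simpa using neg_mem h3), ?_, ?_⟩
    · rw [L.weierstrassP_neg, hX]
    · rw [L.derivWeierstrassP_neg, h2, neg_neg]

lemma hasDerivAt_weierstrassP (L : PeriodPair) {z : ℂ} (hz : z ∉ L.lattice) :
    HasDerivAt L.weierstrassP (L.derivWeierstrassP z) z := by
  have h := (L.differentiableOn_weierstrassP z hz).differentiableAt
    ((isOpen_compl_lattice L).mem_nhds hz)
  have h2 := h.hasDerivAt
  rwa [L.deriv_weierstrassP] at h2

/-- The equation `℘'' = 6℘² - g₂/2`. -/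
lemma hasDerivAt_derivWeierstrassP (L : PeriodPair) {z : ℂ} (hz : z ∉ L.lattice) :
    HasDerivAt L.derivWeierstrassP (6 * L.weierstrassP z ^ 2 - L.g₂ / 2) z := by
  have hU := (isOpen_compl_lattice L)
  have hd : DifferentiableOn ℂ L.derivWeierstrassP (L.lattice : Set ℂ)ᶜ :=
    L.differentiableOn_derivWeierstrassP
  have hd' : DifferentiableOn ℂ (deriv L.derivWeierstrassP) (L.lattice : Set ℂ)ᶜ := hd.deriv hU
  -- The derivative of `℘'² = 4℘³ - g₂℘ - g₃` has the factor `℘'`. This factor cannot vanish near a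
  -- point: by the identity theorem on the connected complement of the lattice `℘` would be
  -- constant, although it is onto.
  have key : ∀ t ∈ (L.lattice : Set ℂ)ᶜ, L.derivWeierstrassP t *
      (deriv L.derivWeierstrassP t - (6 * L.weierstrassP t ^ 2 - L.g₂ / 2)) = 0 := by
    intro t ht
    have h1 : (fun s => L.derivWeierstrassP s ^ 2) =ᶠ[𝓝 t]
        fun s => 4 * L.weierstrassP s ^ 3 - L.g₂ * L.weierstrassP s - L.g₃ := by
      filter_upwards [hU.mem_nhds ht] with s hs using L.derivWeierstrassP_sq s hs
    have hp := hasDerivAt_weierstrassP L ht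
    have hq := ((hd t ht).differentiableAt (hU.mem_nhds ht)).hasDerivAt
    have h2 := (hq.pow 2).unique (((((hp.pow 3).const_mul 4).sub
      (hp.const_mul L.g₂)).sub_const L.g₃).congr_of_eventuallyEq h1)
    push_cast at h2
    linear_combination h2 / 2
  have := eq_zero_of_mul_eq_zero (𝕜 := ℂ) hU
    (e := fun t => deriv L.derivWeierstrassP t - (6 * L.weierstrassP t ^ 2 - L.g₂ / 2))
    (p := L.derivWeierstrassP)
    (hd'.continuousOn.sub ((continuousOn_const.mul (L.differentiableOn_weierstrassP.continuousOn.pow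
      2)).sub continuousOn_const)) key ?_ hz
  · rw [← sub_eq_zero.1 this]
    exact ((hd z hz).differentiableAt (hU.mem_nhds hz)).hasDerivAt
  · intro t ht h0
    exfalso
    have hconn : IsPreconnected ((L.lattice : Set ℂ)ᶜ) :=
      ((countable_lattice L).isConnected_compl_of_one_lt_rank
        (by rw [rank_real_complex]; exact Nat.one_lt_ofNat)).isPreconnected
    have h1 : Set.EqOn L.derivWeierstrassP 0 (L.lattice : Set ℂ)ᶜ :=
      L.analyticOnNhd_derivWeierstrassP.eqOn_of_preconnected_of_eventuallyEq
        analyticOnNhd_const hconn ht h0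
    have h2 : ∀ s ∉ L.lattice, L.weierstrassP s = L.weierstrassP t := fun s hs =>
      hU.is_const_of_deriv_eq_zero hconn L.differentiableOn_weierstrassP
        (fun u hu => by rw [L.deriv_weierstrassP]; exact h1 hu) hs ht
    obtain ⟨s, hs, hs1⟩ := exists_weierstrassP_eq L (L.weierstrassP t + 1)
    rw [h2 s hs] at hs1
    simp at hs1

/-- The lattice sigma function depends only on the invariants of the lattice. -/
lemma latticeSigma_eq_of_invariants {L M : PeriodPair} (h₂ : L.g₂ = M.g₂) (h₃ : L.g₃ = M.g₃) :
    latticeSigma L = latticeSigma M := by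
  suffices h : sigmaProduct L = sigmaProduct M by
    funext z
    rw [latticeSigma_eq, latticeSigma_eq, h]
  obtain ⟨r, hr, hS0, hS⟩ := hasDerivAt_logDeriv_sigmaProduct L
  obtain ⟨ρ, hρ, hT0, hT⟩ := hasDerivAt_logDeriv_sigmaProduct M
  refine eq_of_deriv_logDeriv_eq (differentiable_sigmaProduct L) (differentiable_sigmaProduct M)
    (sigmaProduct_zero L) (sigmaProduct_zero M) (hS0.trans hT0.symm) ?_
  suffices h : ∀ᶠ z in 𝓝 0, L.weierstrassPExcept 0 z = M.weierstrassPExcept 0 z by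
    filter_upwards [h, Metric.ball_mem_nhds _ hr, Metric.ball_mem_nhds _ hρ] with z hz h1 h2
    rw [(hS z h1).2.deriv, (hT z h2).2.deriv, hz]
  have aL := L.analyticAt_weierstrassPExcept 0
  have aM := M.analyticAt_weierstrassPExcept 0
  by_contra hne
  have hd : ¬∀ᶠ z in 𝓝 0, (L.weierstrassPExcept 0 - M.weierstrassPExcept 0) z = 0 := fun h =>
    hne (h.mono fun z hz => sub_eq_zero.1 hz)
  -- If the regular parts of the two `℘`-functions differed, the difference would be `zⁿ e(z)` with
  -- `e(0) ≠ 0`. In the differential equation for the difference the lowest coefficients then give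
  -- `-4n = 12`, impossible for a natural number.
  obtain ⟨n, e, he, he0, hn⟩ :=
    ((aL.sub aM).exists_eventuallyEq_pow_smul_nonzero_iff).2 hd
  simp only [sub_zero, smul_eq_mul] at hn
  set u := L.weierstrassPExcept 0 with hu
  set v := M.weierstrassPExcept 0 with hv
  -- `d = u - v` satisfies `d' (-4z + z⁴(u' + v')) = d (12 + z²(…))`
  have hode : ∀ᶠ z in 𝓝[≠] (0 : ℂ), (deriv u z - deriv v z) *
      (-4 * z + z ^ 4 * (deriv u z + deriv v z)) = (u z - v z) * (12 + 12 * z ^ 2 * (u z + v z) +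
        z ^ 4 * (4 * (u z ^ 2 + u z * v z + v z ^ 2) - L.g₂)) := by
    -- The cubic equation of `℘` multiplied by `z⁶` and written for `℘ - 1/z²`, so that no poles are
    -- left.
    have near : ∀ N : PeriodPair, ∀ᶠ z in 𝓝[≠] (0 : ℂ),
        (-2 + z ^ 3 * deriv (N.weierstrassPExcept 0) z) ^ 2 =
        4 * (1 + z ^ 2 * N.weierstrassPExcept 0 z) ^ 3 -
          N.g₂ * z ^ 4 * (1 + z ^ 2 * N.weierstrassPExcept 0 z) - N.g₃ * z ^ 6 := by
      intro N
      filter_upwards [nhdsWithin_le_nhds (N.compl_lattice_sdiff_singleton_mem_nhds 0),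
        self_mem_nhdsWithin] with z hz hz0
      have hz0 : z ≠ 0 := hz0
      have hzN : z ∉ N.lattice := fun h => hz ⟨h, hz0⟩
      have h1 := N.derivWeierstrassP_sq z hzN
      have e1 := ThetaModel.weierstrassPExcept_zero_eq N z
      have e2 := N.eqOn_deriv_weierstrassPExcept_derivWeierstrassPExcept 0 hz
      have e3 := N.derivWeierstrassPExcept_def 0 z
      simp only [ZeroMemClass.coe_zero, sub_zero] at e3
      rw [e3] at e2
      rw [e2, e1]
      generalize N.weierstrassP z = X at *
      generalize N.derivWeierstrassP z = Y at *
      have e4 : -2 + z ^ 3 * (Y + 2 / z ^ 3) = z ^ 3 * Y := by field_simp; ring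
      have e5 : 1 + z ^ 2 * (X - 1 / z ^ 2) = z ^ 2 * X := by field_simp; ring
      rw [e4, e5]
      linear_combination z ^ 6 * h1
    filter_upwards [near L, near M, self_mem_nhdsWithin] with z h1 h2 hz0
    have hz0 : z ≠ 0 := hz0
    rw [← hu] at h1
    rw [← hv, ← h₂, ← h₃] at h2
    refine mul_left_cancel₀ (pow_ne_zero 2 hz0) ?_
    linear_combination h1 - h2
  have hdd : ∀ᶠ z in 𝓝 (0 : ℂ), deriv u z - deriv v z =
      n * z ^ (n - 1) * e z + z ^ n * deriv e z := by
    filter_upwards [hn.eventually_nhds, he.eventually_analyticAt, aL.eventually_analyticAt,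
      aM.eventually_analyticAt] with z h1 h2 h3 h4
    have h5 : HasDerivAt (fun z => z ^ n * e z) _ z :=
      (hasDerivAt_pow n z).mul h2.differentiableAt.hasDerivAt
    have h6 := h3.differentiableAt.hasDerivAt.sub h4.differentiableAt.hasDerivAt
    have h7 : u - v =ᶠ[𝓝 z] fun z => z ^ n * e z := h1
    exact h6.unique (h5.congr_of_eventuallyEq h7)
  have hlim : ∀ᶠ z in 𝓝[≠] (0 : ℂ), (n * e z + z * deriv e z) *
      (-4 + z ^ 3 * (deriv u z + deriv v z)) = e z * (12 + 12 * z ^ 2 * (u z + v z) +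
        z ^ 4 * (4 * (u z ^ 2 + u z * v z + v z ^ 2) - L.g₂)) := by
    filter_upwards [hode, nhdsWithin_le_nhds hdd, nhdsWithin_le_nhds hn, self_mem_nhdsWithin]
      with z h1 h2 h3 hz0
    have hz0 : z ≠ 0 := hz0
    rw [Pi.sub_apply] at h3
    rw [h2, h3] at h1
    refine mul_left_cancel₀ (pow_ne_zero n hz0) ?_
    have h4 : (n : ℂ) * z ^ (n - 1) * z = n * z ^ n := by
      rcases n with _ | n
      · simp
      · rw [Nat.add_sub_cancel, mul_assoc, ← pow_succ]
    linear_combination h1 - e z * (-4 + z ^ 3 * (deriv u z + deriv v z)) * h4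
  have c1 : ContinuousAt (fun z => (n * e z + z * deriv e z) *
      (-4 + z ^ 3 * (deriv u z + deriv v z)) - e z * (12 + 12 * z ^ 2 * (u z + v z) +
        z ^ 4 * (4 * (u z ^ 2 + u z * v z + v z ^ 2) - L.g₂))) 0 := by
    have c2 := he.continuousAt
    have c3 := he.deriv.continuousAt
    have c4 := aL.continuousAt
    have c5 := aM.continuousAt
    have c6 := aL.deriv.continuousAt
    have c7 := aM.deriv.continuousAt
    fun_prop
  have h0 := tendsto_nhds_unique (c1.tendsto.mono_left nhdsWithin_le_nhds)
    (tendsto_const_nhds.congr' (hlim.mono fun z hz => (sub_eq_zero.2 hz).symm))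
  have h1 : e 0 * ((-4 * n - 12 : ℤ) : ℂ) = 0 := by
    push_cast
    linear_combination h0
  have h2 := (mul_eq_zero.1 h1).resolve_left he0
  have h3 : (-4 * n - 12 : ℤ) = 0 := by exact_mod_cast h2
  omega

/-- The definition selects some lattice with the given invariants, so the value is meaningful only
because sigma depends on the invariants alone. -/
lemma weierstrassSigma_eq (L : PeriodPair) (z : ℂ) :
    weierstrassSigma z L.g₂ L.g₃ = latticeSigma L z := by
  have h : ∃ M : PeriodPair, M.g₂ = L.g₂ ∧ M.g₃ = L.g₃ := ⟨L, rfl, rfl⟩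
  rw [weierstrassSigma, dif_pos h,
    latticeSigma_eq_of_invariants h.choose_spec.1 h.choose_spec.2]

end Weierstrass

open Filter Topology

/-! ### Compatibility of the heat equation with a general cubic -/

section Coefficients

variable {𝕜 : Type*} [RCLike 𝕜] {Ω : Set (𝕜 × 𝕜)} {b c : 𝕜} {g w v p r : 𝕜 → 𝕜 → 𝕜}
  {h k m : 𝕜 → 𝕜}

/-- The compatibility of the heat equation with the equation `v_b² = 4v³ + 4hv² + 2kv + m`. -/
lemma HeatJet.coefficient_eq (J : HeatJet Ω g w v p r h)
    (hr : ∀ b c, (b, c) ∈ Ω → r b c = 6 * v b c ^ 2 + 4 * h c * v b c + k c)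
    (hp : ∀ b c, (b, c) ∈ Ω →
      p b c ^ 2 = 4 * v b c ^ 3 + 4 * h c * v b c ^ 2 + 2 * k c * v b c + m c)
    {h' k' m' : 𝕜} (hh : HasDerivAt h h' c) (hk : HasDerivAt k k' c) (hm : HasDerivAt m m' c)
    (hx : (b, c) ∈ Ω) :
    k c * v b c ^ 2 + 3 * m c * v b c + 2 * h c * m c - k c ^ 2 / 2 =
      4 * h' * v b c ^ 2 + 2 * k' * v b c + m' := by
  have hs : HasDerivAt (fun t => r t c) ((12 * v b c + 4 * h c) * p b c) b := by
    have h1 := ((((J.vb b c hx).pow 2).const_mul 6).add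
      ((J.vb b c hx).const_mul (4 * h c))).add_const (k c)
    refine (h1.congr_of_eventuallyEq ?_).congr_deriv (by push_cast; ring)
    filter_upwards [eventually_slice_fst J.isOpen hx] with t ht using hr t c ht
  have e : (fun t => p b t ^ 2) =ᶠ[𝓝 c]
      fun t => 4 * v b t ^ 3 + 4 * h t * v b t ^ 2 + 2 * k t * v b t + m t := by
    filter_upwards [eventually_slice_snd J.isOpen hx] with t ht using hp b t ht
  have hv := J.vc hx
  have h2 := ((J.pc hx hs).pow 2).unique ((((((hv.pow 3).const_mul 4).add
    ((hh.const_mul 4).mul (hv.pow 2))).add ((hk.const_mul 2).mul hv)).add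
      hm).congr_of_eventuallyEq e)
  have h3 := hp b c hx
  rw [hr b c hx] at h2
  simp only [Pi.pow_apply] at h2
  push_cast at h2
  generalize p b c = P at *
  generalize v b c = V at *
  generalize w b c = W at *
  -- In the `c`-derivative of the cubic equation the terms with `w` cancel, and `p²` is eliminated
  -- by the cubic; a quadratic polynomial in `v` remains.
  linear_combination h2 - (3 * V + 2 * h c) * h3

end Coefficients

/-! ### Derivatives of `-(ln P)''` -/

section Relation

open Complex

variable {L : PeriodPair} {P : ℂ → ℂ} {E : ℂ}

namespace ThetaModel

variable (h : ThetaModel L P E)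
include h

lemma hasDerivAt_neg_deriv_logDeriv {z : ℂ} (hz : z ∉ L.lattice) :
    HasDerivAt (fun z => -deriv (logDeriv P) z) (L.derivWeierstrassP z) z := by
  refine ((hasDerivAt_weierstrassP L hz).sub_const (E / 3)).congr_of_eventuallyEq ?_
  filter_upwards [(isOpen_compl_lattice L).mem_nhds hz] with t ht using h.neg_deriv_logDeriv ht

lemma hasDerivAt_deriv_neg_deriv_logDeriv {z : ℂ} (hz : z ∉ L.lattice) :
    HasDerivAt (deriv fun z => -deriv (logDeriv P) z) (6 * L.weierstrassP z ^ 2 - L.g₂ / 2) z := by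
  refine (hasDerivAt_derivWeierstrassP L hz).congr_of_eventuallyEq ?_
  filter_upwards [(isOpen_compl_lattice L).mem_nhds hz] with t ht
    using (h.hasDerivAt_neg_deriv_logDeriv ht).deriv

end ThetaModel

end Relation

/-! ### The rescaled theta function and its heat equation -/

section EllipticModel

open Complex

/-- The model `P(κz, sc) / κ`, where `P(z, τ) = θ₁(z, τ) / θ₁'(0, τ)`. -/
def ellipticModel (κ s z c : ℂ) : ℂ := thetaProduct (κ * z) (s * c) / κ

/-- The function `κ² E(sc)`. -/
def ellipticModelChazy (κ s c : ℂ) : ℂ := κ ^ 2 * thetaE (s * c)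

/-- The half-plane of the points `c` with `sc` in the upper half-plane. -/
def modelHalf (s : ℂ) : Set ℂ := {c | s * c ∈ upperHalf}

lemma isOpen_modelHalf (s : ℂ) : IsOpen (modelHalf s) :=
  isOpen_upperHalf.preimage (by fun_prop : Continuous fun c : ℂ => s * c)

lemma isOpen_univ_prod_modelHalf (s : ℂ) : IsOpen ((Set.univ : Set ℂ) ×ˢ modelHalf s) :=
  isOpen_univ.prod (isOpen_modelHalf s)

lemma pb_jacobiThetaOne_zero_ne_zero {τ : ℂ} (hτ : τ ∈ upperHalf) :
    pb jacobiThetaOne 0 τ ≠ 0 := by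
  rw [pb_jacobiThetaOne_zero hτ]
  exact mul_ne_zero two_ne_zero (pow_ne_zero _ (ModularForm.eta_ne_zero (z := τ) hτ))

lemma thetaProduct_eq_div {τ : ℂ} (hτ : τ ∈ upperHalf) (z : ℂ) :
    thetaProduct z τ = jacobiThetaOne z τ / pb jacobiThetaOne 0 τ := by
  rw [jacobiThetaOne_eq_mul_thetaProduct hτ,
    mul_div_cancel_left₀ _ (pb_jacobiThetaOne_zero_ne_zero hτ)]

lemma smoothOn_thetaProduct : SmoothOn (Set.univ ×ˢ upperHalf) thetaProduct := by
  have hs := smoothOn_jacobiThetaOne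
  have h1 : ContDiffOn ℂ ∞ (fun x : ℂ × ℂ => pb jacobiThetaOne 0 x.2) (Set.univ ×ˢ upperHalf) :=
    ContDiffOn.comp (g := fun x : ℂ × ℂ => pb jacobiThetaOne x.1 x.2)
      (f := fun x : ℂ × ℂ => ((0 : ℂ), x.2))
      (hs.smoothOn_pb isOpen_univ_prod_upperHalf)
      (contDiffOn_const.prodMk contDiffOn_snd) fun x hx => ⟨trivial, hx.2⟩
  exact (ContDiffOn.div hs h1 fun x hx => pb_jacobiThetaOne_zero_ne_zero hx.2).congr
    fun x hx => thetaProduct_eq_div hx.2 x.1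

/-- Division by `θ₁'(0)`, with logarithmic derivative `-(πi/4)E`, adds the potential term to the
heat equation of `θ₁`. -/
lemma pc_thetaProduct {τ : ℂ} (hτ : τ ∈ upperHalf) (z : ℂ) : pc thetaProduct z τ =
    -(Real.pi * I / 4) * (pb (pb thetaProduct) z τ - thetaE τ * thetaProduct z τ) := by
  have hA := pb_jacobiThetaOne_zero_ne_zero hτ
  have h1 : (fun t => thetaProduct z t) =ᶠ[𝓝 τ]
      fun t => jacobiThetaOne z t / pb jacobiThetaOne 0 t := by
    filter_upwards [isOpen_upperHalf.mem_nhds hτ] with t ht using thetaProduct_eq_div ht z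
  have h2 := (smoothOn_jacobiThetaOne.hasDerivAt_snd isOpen_univ_prod_upperHalf
    (b := z) (c := τ) ⟨trivial, hτ⟩).div (hasDerivAt_pb_jacobiThetaOne_zero hτ) hA
  have h3 : pb (pb jacobiThetaOne) z τ = pb jacobiThetaOne 0 τ * pb (pb thetaProduct) z τ := by
    have e3 : (fun z => jacobiThetaOne z τ) =
      fun z => pb jacobiThetaOne 0 τ * thetaProduct z τ :=
      funext fun z => jacobiThetaOne_eq_mul_thetaProduct hτ z
    change deriv (deriv (fun z => jacobiThetaOne z τ)) z = _
    rw [e3, show deriv (fun z => pb jacobiThetaOne 0 τ * thetaProduct z τ) =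
        fun z => pb jacobiThetaOne 0 τ * deriv (fun z => thetaProduct z τ) z from
          funext fun z => deriv_const_mul_field _]
    exact deriv_const_mul_field _
  rw [pc, h1.deriv_eq]
  refine h2.deriv.trans ?_
  rw [pc_jacobiThetaOne z hτ, h3, jacobiThetaOne_eq_mul_thetaProduct hτ z]
  field_simp
  ring

variable {κ s : ℂ} (hκ : κ ≠ 0) (hs : κ ^ 2 = -(Real.pi * I * s))

include hκ in
lemma thetaModel_ellipticModel {c : ℂ} (hc : c ∈ modelHalf s) :
    ThetaModel (scaleLattice (thetaLattice (s * c) hc) κ hκ) (fun z => ellipticModel κ s z c)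
      (ellipticModelChazy κ s c) := (thetaModel_thetaProduct hc).scale hκ

lemma smoothOn_ellipticModel : SmoothOn (Set.univ ×ˢ modelHalf s) (ellipticModel κ s) := by
  have h1 : ContDiffOn ℂ ∞ (fun x : ℂ × ℂ => thetaProduct (κ * x.1) (s * x.2))
      (Set.univ ×ˢ modelHalf s) :=
    ContDiffOn.comp (g := fun x : ℂ × ℂ => thetaProduct x.1 x.2)
      (f := fun x : ℂ × ℂ => (κ * x.1, s * x.2)) smoothOn_thetaProduct
      (by fun_prop) fun x hx => ⟨trivial, hx.2⟩
  exact h1.div_const κ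

include hκ in
lemma contDiffOn_ellipticModelChazy : ContDiffOn ℂ ∞ (ellipticModelChazy κ s) (modelHalf s) := by
  have hΩ := isOpen_univ_prod_modelHalf s
  have h1 := ((smoothOn_ellipticModel (κ := κ) (s := s)).smoothOn_pb hΩ).smoothOn_pb hΩ
  have h2 : ContDiffOn ℂ ∞ (fun c => pb (pb (pb (ellipticModel κ s))) 0 c) (modelHalf s) :=
    ContDiffOn.comp (g := fun x : ℂ × ℂ => pb (pb (pb (ellipticModel κ s))) x.1 x.2)
      (f := fun c : ℂ => ((0 : ℂ), c)) (h1.smoothOn_pb hΩ)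
      (contDiffOn_const.prodMk contDiffOn_id) fun x hx => ⟨trivial, hx⟩
  exact h2.congr fun c hc => (thetaModel_ellipticModel hκ hc).deriv_three.symm

-- The relation `κ² = -πis` is what converts the coefficient `-πi/4` into `1/4`.
include hκ hs in
lemma pc_ellipticModel {c : ℂ} (hc : c ∈ modelHalf s) (z : ℂ) : pc (ellipticModel κ s) z c =
    1 / 4 * (pb (pb (ellipticModel κ s)) z c -
      ellipticModelChazy κ s c * ellipticModel κ s z c) := by
  have h1 : pc (ellipticModel κ s) z c = s * pc thetaProduct (κ * z) (s * c) / κ :=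
    congrFun (deriv_comp_mul_left_div (fun t => thetaProduct (κ * z) t) s κ) c
  have h2 : pb (pb (ellipticModel κ s)) z c = κ * pb (pb thetaProduct) (κ * z) (s * c) := by
    have e1 : deriv (fun z => ellipticModel κ s z c) =
        fun z => κ * deriv (fun z => thetaProduct z (s * c)) (κ * z) / κ :=
      deriv_comp_mul_left_div (fun t => thetaProduct t (s * c)) κ κ
    have e2 : (fun z => κ * deriv (fun z => thetaProduct z (s * c)) (κ * z) / κ) =
        fun z => deriv (fun z => thetaProduct z (s * c)) (κ * z) := by
      funext z
      field_simp
    change deriv (deriv (fun z => ellipticModel κ s z c)) z = _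
    rw [e1, e2, deriv_comp_mul_left κ (deriv fun z => thetaProduct z (s * c))]
    rfl
  rw [h1, h2, pc_thetaProduct hc, ellipticModelChazy, ellipticModel]
  field_simp
  linear_combination (-(pb (pb thetaProduct) (κ * z) (s * c)) +
    thetaE (s * c) * thetaProduct (κ * z) (s * c)) * hs

/-- The points at which the model does not vanish. -/
def modelDomain (κ s : ℂ) : Set (ℂ × ℂ) :=
  {x | x ∈ Set.univ ×ˢ modelHalf s ∧ ellipticModel κ s x.1 x.2 ≠ 0}

lemma isOpen_modelDomain : IsOpen (modelDomain κ s) :=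
  (smoothOn_ellipticModel.continuousOn).isOpen_inter_preimage (isOpen_univ_prod_modelHalf s)
    isOpen_ne

include hκ hs in
lemma heatJet_ellipticModel : HeatJet (modelDomain κ s) (ellipticModel κ s)
    (logB (ellipticModel κ s)) (negLogDerivTwo (ellipticModel κ s))
    (pb (negLogDerivTwo (ellipticModel κ s))) (pb (pb (negLogDerivTwo (ellipticModel κ s))))
    (ellipticModelChazy κ s) :=
  (smoothOn_ellipticModel.mono fun _ hx => hx.1).heatJet isOpen_modelDomain
    (fun _ _ hx => hx.2) fun b _ hx => pc_ellipticModel hκ hs hx.1.2 b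

section Fiber

variable {c : ℂ} {L : PeriodPair}
  (hL : ThetaModel L (fun z => ellipticModel κ s z c) (ellipticModelChazy κ s c))
include hL

lemma notMem_of_ne {b : ℂ} (hb : ellipticModel κ s b c ≠ 0) : b ∉ L.lattice :=
  fun h => hb ((hL.eq_zero_iff b).2 h)

lemma negLogDerivTwo_ellipticModel {b : ℂ} (hb : b ∉ L.lattice) :
    negLogDerivTwo (ellipticModel κ s) b c = L.weierstrassP b - ellipticModelChazy κ s c / 3 :=
  hL.neg_deriv_logDeriv hb

lemma pb_negLogDerivTwo_ellipticModel {b : ℂ} (hb : b ∉ L.lattice) :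
    pb (negLogDerivTwo (ellipticModel κ s)) b c = L.derivWeierstrassP b :=
  (hL.hasDerivAt_neg_deriv_logDeriv hb).deriv

lemma pb_pb_negLogDerivTwo_ellipticModel {b : ℂ} (hb : b ∉ L.lattice) :
    pb (pb (negLogDerivTwo (ellipticModel κ s))) b c = 6 * L.weierstrassP b ^ 2 - L.g₂ / 2 :=
  (hL.hasDerivAt_deriv_neg_deriv_logDeriv hb).deriv

end Fiber

end EllipticModel

/-! ### Invariants of the model, Chazy equation and integrability -/

section EllipticModelInvariants

open Complex Filter Topology

variable {κ s : ℂ} (hκ : κ ≠ 0) (hs : κ ^ 2 = -(Real.pi * I * s)) {c : ℂ}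

/-- The lattice of the zeros of the model. -/
def modelLattice (hκ : κ ≠ 0) (hc : c ∈ modelHalf s) : PeriodPair :=
  scaleLattice (thetaLattice (s * c) hc) κ hκ

/-- The lattice depends on a proof of `c ∈ modelHalf s`; a total choice makes its invariants
functions of `c` that can be differentiated. -/
lemma exists_modelLattice : ∃ L : ℂ → PeriodPair, ∀ c, ∀ hc : c ∈ modelHalf s,
    L c = modelLattice hκ hc := by
  classical
  refine ⟨fun c => if hc : c ∈ modelHalf s then modelLattice hκ hc else
    scaleLattice (thetaLattice I (by simp [upperHalf])) κ hκ, fun c hc => dif_pos hc⟩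

-- Since `v = ℘ - h/3`, the equation of `℘` is a cubic `p² = 4v³ + 4hv² + 2kv + m`. Its
-- compatibility with the heat equation is quadratic in `v`, and `v` takes all values, so the
-- coefficients agree: `k = 4h'`, `3m = 2k'`, `m' = 2hm - k²/2`. The first two give the invariants,
-- the last is the Chazy equation.
include hs in
lemma modelLattice_invariants (hc : c ∈ modelHalf s) :
    (modelLattice hκ hc).g₂ = invTwo (ellipticModelChazy κ s) c ∧
    (modelLattice hκ hc).g₃ = invThree (ellipticModelChazy κ s) c ∧
    ChazyAt (ellipticModelChazy κ s) c := by
  obtain ⟨L, hL⟩ := exists_modelLattice (s := s) hκ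
  have hM : ∀ c ∈ modelHalf s, ThetaModel (L c) (fun z => ellipticModel κ s z c)
      (ellipticModelChazy κ s c) := fun c hc => hL c hc ▸ thetaModel_ellipticModel hκ hc
  set h := ellipticModelChazy κ s with hh_def
  set k : ℂ → ℂ := fun c => 2 / 3 * h c ^ 2 - (L c).g₂ / 2 with hk_def
  set m : ℂ → ℂ := fun c => 4 / 27 * h c ^ 3 - (L c).g₂ * h c / 3 - (L c).g₃ with hm_def
  have J := heatJet_ellipticModel hκ hs
  rw [← hh_def] at J
  set v := negLogDerivTwo (ellipticModel κ s)
  have hv : ∀ {b c}, c ∈ modelHalf s → b ∉ (L c).lattice →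
      v b c = (L c).weierstrassP b - h c / 3 := fun hc hb =>
    negLogDerivTwo_ellipticModel (hM _ hc) hb
  have hr : ∀ b c, (b, c) ∈ modelDomain κ s →
      pb (pb v) b c = 6 * v b c ^ 2 + 4 * h c * v b c + k c := by
    intro b c hx
    have hb : b ∉ (L c).lattice := notMem_of_ne (hM c hx.1.2) hx.2
    rw [pb_pb_negLogDerivTwo_ellipticModel (hM c hx.1.2) hb, hv hx.1.2 hb]
    ring
  have hp : ∀ b c, (b, c) ∈ modelDomain κ s → pb v b c ^ 2 =
      4 * v b c ^ 3 + 4 * h c * v b c ^ 2 + 2 * k c * v b c + m c := by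
    intro b c hx
    have hb : b ∉ (L c).lattice := notMem_of_ne (hM c hx.1.2) hx.2
    rw [pb_negLogDerivTwo_ellipticModel (hM c hx.1.2) hb, hv hx.1.2 hb,
      (L c).derivWeierstrassP_sq b hb]
    ring
  have hmem : ∀ c ∈ modelHalf s, ∀ X : ℂ, ∃ b, (b, c) ∈ modelDomain κ s ∧ v b c = X := by
    intro c hc X
    obtain ⟨b, hb, hX⟩ := exists_weierstrassP_eq (L c) (X + h c / 3)
    refine ⟨b, ⟨⟨trivial, hc⟩, fun h0 => hb (((hM c hc).eq_zero_iff b).1 h0)⟩, ?_⟩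
    rw [hv hc hb, hX]
    ring
  have hd : ∀ {c}, c ∈ modelHalf s → HasDerivAt h (deriv h c) c := fun hc =>
    contDiffOn_hasDerivAt (isOpen_modelHalf s) (contDiffOn_ellipticModelChazy hκ) hc
  have hd₁ : ∀ {c}, c ∈ modelHalf s → HasDerivAt (deriv h) (deriv (deriv h) c) c := fun hc =>
    contDiffOn_hasDerivAt (isOpen_modelHalf s) (contDiffOn_deriv (isOpen_modelHalf s)
      (contDiffOn_ellipticModelChazy hκ)) hc
  -- The lattice is chosen pointwise, so the differentiability of its invariants is read off from
  -- the smooth functions `v`, `v_b`, `v_bb` at a fixed `b`.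
  have hkd : ∀ {c}, c ∈ modelHalf s → HasDerivAt k (deriv k c) c := by
    intro c hc
    obtain ⟨b, hb, -⟩ := hmem c hc 0
    have h1 := J.smooth_r.hasDerivAt_snd J.isOpen hb
    have h2 := J.smooth_v.hasDerivAt_snd J.isOpen hb
    refine (((h1.sub ((h2.pow 2).const_mul 6)).sub
      (((hd hc).const_mul 4).mul h2)).congr_of_eventuallyEq ?_).differentiableAt.hasDerivAt
    filter_upwards [eventually_slice_snd J.isOpen hb] with t ht
    simp only [Pi.sub_apply, Pi.mul_apply, Pi.pow_apply]
    rw [hr b t ht]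
    ring
  have hmd : ∀ {c}, c ∈ modelHalf s → HasDerivAt m (deriv m c) c := by
    intro c hc
    obtain ⟨b, hb, -⟩ := hmem c hc 0
    have h1 := J.smooth_p.hasDerivAt_snd J.isOpen hb
    have h2 := J.smooth_v.hasDerivAt_snd J.isOpen hb
    refine (((((h1.pow 2).sub ((h2.pow 3).const_mul 4)).sub
      (((hd hc).const_mul 4).mul (h2.pow 2))).sub
        (((hkd hc).const_mul 2).mul h2)).congr_of_eventuallyEq ?_).differentiableAt.hasDerivAt
    filter_upwards [eventually_slice_snd J.isOpen hb] with t ht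
    simp only [Pi.sub_apply, Pi.mul_apply, Pi.pow_apply]
    rw [hp b t ht]
    ring
  have key : ∀ {c}, c ∈ modelHalf s → ∀ X : ℂ,
      k c * X ^ 2 + 3 * m c * X + 2 * h c * m c - k c ^ 2 / 2 =
        4 * deriv h c * X ^ 2 + 2 * deriv k c * X + deriv m c := by
    intro c hc X
    obtain ⟨b, hb, rfl⟩ := hmem c hc X
    exact J.coefficient_eq hr hp (hd hc) (hkd hc) (hmd hc) hb
  -- Coefficients are compared by evaluating the identity at `X = 1, -1, 0`.
  have hk : ∀ {c}, c ∈ modelHalf s → k c = 4 * deriv h c := by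
    intro c hc
    linear_combination (key hc 1 + key hc (-1)) / 2 - key hc 0
  have hk' : ∀ {c}, c ∈ modelHalf s → deriv k c = 4 * deriv (deriv h) c := by
    intro c hc
    exact ((hd₁ hc).const_mul 4 |>.congr_of_eventuallyEq (by
      filter_upwards [(isOpen_modelHalf s).mem_nhds hc] with t ht using hk ht)).deriv
  have hm : ∀ {c}, c ∈ modelHalf s → m c = 8 / 3 * deriv (deriv h) c := by
    intro c hc
    linear_combination (key hc 1 - key hc (-1)) / 6 + 2 / 3 * hk' hc
  have h2 : (L c).g₂ = invTwo h c := by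
    rw [invTwo]
    linear_combination (-2) * hk hc
  refine ⟨hL c hc ▸ h2, hL c hc ▸ ?_, ?_⟩
  · rw [invThree, iteratedDeriv_two]
    rw [invTwo] at h2
    linear_combination -hm hc - h c / 3 * h2
  · rw [chazyAt_iff_hasDerivAt (isOpen_modelHalf s) (contDiffOn_ellipticModelChazy hκ) hc]
    refine (((hmd hc).const_mul (3 / 8)).congr_of_eventuallyEq ?_).congr_deriv ?_
    · filter_upwards [(isOpen_modelHalf s).mem_nhds hc] with t ht
      rw [hm ht]
      ring
    · linear_combination (-3 / 8) * key hc 0 + 3 / 4 * h c * hm hc -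
        3 / 16 * (k c + 4 * deriv h c) * hk hc

include hκ hs in
lemma chazyAt_ellipticModelChazy (hc : c ∈ modelHalf s) : ChazyAt (ellipticModelChazy κ s) c :=
  (modelLattice_invariants hκ hs hc).2.2

include hκ hs in
lemma ellipticModel_eq_weierstrassSigma (hc : c ∈ modelHalf s) (z : ℂ) : ellipticModel κ s z c =
    weierstrassSigma z (invTwo (ellipticModelChazy κ s) c) (invThree (ellipticModelChazy κ s) c) *
      exp (z ^ 2 * ellipticModelChazy κ s c / 6) := by
  obtain ⟨h2, h3, -⟩ := modelLattice_invariants hκ hs hc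
  rw [← h2, ← h3, weierstrassSigma_eq]
  exact (thetaModel_ellipticModel hκ hc).eq_latticeSigma z

include hκ hs in
lemma pb_pb_negLogDerivTwo_ellipticModel_eq {b : ℂ} (hx : (b, c) ∈ modelDomain κ s) :
    pb (pb (negLogDerivTwo (ellipticModel κ s))) b c =
      6 * negLogDerivTwo (ellipticModel κ s) b c ^ 2 +
        4 * ellipticModelChazy κ s c * negLogDerivTwo (ellipticModel κ s) b c +
        4 * deriv (ellipticModelChazy κ s) c := by
  obtain ⟨h2, -, -⟩ := modelLattice_invariants hκ hs hx.1.2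
  have hM := thetaModel_ellipticModel hκ hx.1.2
  have hb : b ∉ _ := notMem_of_ne hM hx.2
  rw [invTwo, modelLattice] at h2
  rw [pb_pb_negLogDerivTwo_ellipticModel hM hb, negLogDerivTwo_ellipticModel hM hb]
  linear_combination (-1 / 2) * h2

include hκ hs in
lemma pb_negLogDerivTwo_ellipticModel_sq {b : ℂ} (hx : (b, c) ∈ modelDomain κ s) :
    pb (negLogDerivTwo (ellipticModel κ s)) b c ^ 2 =
      4 * negLogDerivTwo (ellipticModel κ s) b c ^ 3 +
        4 * ellipticModelChazy κ s c * negLogDerivTwo (ellipticModel κ s) b c ^ 2 +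
        8 * deriv (ellipticModelChazy κ s) c * negLogDerivTwo (ellipticModel κ s) b c +
        8 / 3 * deriv (deriv (ellipticModelChazy κ s)) c := by
  obtain ⟨h2, h3, -⟩ := modelLattice_invariants hκ hs hx.1.2
  have hM := thetaModel_ellipticModel hκ hx.1.2
  have hb : b ∉ _ := notMem_of_ne hM hx.2
  rw [invTwo, modelLattice] at h2
  rw [invThree, iteratedDeriv_two, modelLattice] at h3
  rw [pb_negLogDerivTwo_ellipticModel hM hb, negLogDerivTwo_ellipticModel hM hb,
    PeriodPair.derivWeierstrassP_sq _ b hb]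
  linear_combination (-PeriodPair.weierstrassP _ b) * h2 - h3

include hκ hs in
/-- Every point of the cubic is attained by the model. -/
lemma exists_mem_modelDomain (hc : c ∈ modelHalf s) {X Y : ℂ}
    (h : Y ^ 2 = 4 * X ^ 3 + 4 * ellipticModelChazy κ s c * X ^ 2 +
      8 * deriv (ellipticModelChazy κ s) c * X +
        8 / 3 * deriv (deriv (ellipticModelChazy κ s)) c) :
    ∃ z, (z, c) ∈ modelDomain κ s ∧ negLogDerivTwo (ellipticModel κ s) z c = X ∧
      pb (negLogDerivTwo (ellipticModel κ s)) z c = Y := by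
  obtain ⟨h2, h3, -⟩ := modelLattice_invariants hκ hs hc
  have hM : ThetaModel (modelLattice hκ hc) _ _ := thetaModel_ellipticModel hκ hc
  rw [invTwo] at h2
  rw [invThree, iteratedDeriv_two] at h3
  obtain ⟨z, hz, hX, hY⟩ := exists_weierstrassP_derivWeierstrassP_eq (modelLattice hκ hc)
    (X := X + ellipticModelChazy κ s c / 3) (Y := Y) (by rw [h2, h3, h]; ring)
  refine ⟨z, ⟨⟨trivial, hc⟩, fun h0 => hz ((hM.eq_zero_iff z).1 h0)⟩, ?_, ?_⟩
  · rw [negLogDerivTwo_ellipticModel hM hz, hX]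
    ring
  · rw [pb_negLogDerivTwo_ellipticModel hM hz, hY]

include hκ hs in
lemma isJet_ellipticModel : IsJet (modelDomain κ s) (ellipticModel κ s)
    (logB (ellipticModel κ s)) (negLogDerivTwo (ellipticModel κ s))
    (pb (negLogDerivTwo (ellipticModel κ s))) (ellipticModelChazy κ s)
    (deriv (ellipticModelChazy κ s)) :=
  (heatJet_ellipticModel hκ hs).isJet fun _ _ hx => pb_pb_negLogDerivTwo_ellipticModel_eq hκ hs hx

include hκ in
lemma mem_closure_modelDomain {b : ℂ} (hc : c ∈ modelHalf s) :
    (b, c) ∈ closure (modelDomain κ s) := by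
  have hM := thetaModel_ellipticModel hκ hc
  have h1 : b ∈ closure {z : ℂ | (z, c) ∈ modelDomain κ s} := by
    have := dense_compl_lattice (scaleLattice (thetaLattice (s * c) hc) κ hκ) b
    refine closure_mono (fun z hz => ?_) this
    exact ⟨⟨trivial, hc⟩, fun h0 => hz ((hM.eq_zero_iff z).1 h0)⟩
  exact map_mem_closure (f := fun z => (z, c)) (by fun_prop) h1 fun z hz => hz

-- Off the zeros the conditions come from the jet equations; they extend to the zeros by continuity,
-- as the complement of a lattice is dense.
include hκ hs in
lemma expIntegrableAt_ellipticModel (hc : c ∈ modelHalf s) (b : ℂ) :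
    ExpIntegrableAt (ellipticModel κ s) b c := by
  have hO := isOpen_modelHalf s
  have hC := contDiffOn_ellipticModelChazy (s := s) hκ
  refine expIntegrableAt_of_dense smoothOn_ellipticModel (isOpen_univ_prod_modelHalf s)
    (D := modelDomain κ s) (fun x hx => ?_) (fun b c _ hx => ?_) (show (b, c) ∈ _ from ⟨trivial, hc⟩)
  · rw [Set.inter_eq_right.2 fun _ h => h.1]
    exact mem_closure_modelDomain hκ hx.2
  · exact (heatJet_ellipticModel hκ hs).expIntegrableAt
      (fun _ _ hx => pb_pb_negLogDerivTwo_ellipticModel_eq hκ hs hx)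
      (fun _ _ hx => pb_negLogDerivTwo_ellipticModel_sq hκ hs hx)
      (fun _ _ hx => contDiffOn_hasDerivAt hO hC hx.1.2)
      (fun _ _ hx => contDiffOn_hasDerivAt hO (contDiffOn_deriv hO hC) hx.1.2) hx

end EllipticModelInvariants

/-! ### Classification of the elliptic solutions, over `ℝ` and `ℂ` alike -/

section EllipticClassification

open Complex Filter Topology

variable {𝕜 : Type*} [RCLike 𝕜]

lemma IsJet.congr {F : Type*} [RCLike F] [NormedAlgebra 𝕜 F] {Ω : Set (𝕜 × 𝕜)}
    {g g' w v p : 𝕜 → 𝕜 → F} {h h' h₁ h₁' : 𝕜 → F} (J : IsJet Ω g w v p h h₁)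
    (hg : ∀ b c, (b, c) ∈ Ω → g' b c = g b c) (hh : ∀ b c, (b, c) ∈ Ω → h' c = h c)
    (hh₁ : ∀ b c, (b, c) ∈ Ω → h₁' c = h₁ c) : IsJet Ω g' w v p h' h₁' where
  isOpen := J.isOpen
  dg b c hx := by
    rw [hg b c hx, hh b c hx]
    refine (J.dg b c hx).congr_of_eventuallyEq ?_
    filter_upwards [J.isOpen.mem_nhds hx] with x hx using hg x.1 x.2 hx
  dw := J.dw
  dv b c hx := by
    rw [hh b c hx, hh₁ b c hx]
    exact J.dv b c hx
  dp b c hx := by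
    rw [hh b c hx, hh₁ b c hx]
    exact J.dp b c hx

variable [NormedAlgebra 𝕜 ℂ] {B C : Set 𝕜}

/-- Chain rule along the embedding of `𝕜` in `ℂ`; it lets one argument serve both `h_ell` and the
real function `H`. -/
lemma algebraMap_deriv_eq {k : 𝕜 → 𝕜} {K : ℂ → ℂ} (hC : IsOpen C)
    (hk : ContDiffOn 𝕜 ∞ k C) (e : ∀ c ∈ C, algebraMap 𝕜 ℂ (k c) = K (algebraMap 𝕜 ℂ c))
    (hK : ∀ c ∈ C, DifferentiableAt ℂ K (algebraMap 𝕜 ℂ c)) :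
    ∀ c ∈ C, algebraMap 𝕜 ℂ (deriv k c) = deriv K (algebraMap 𝕜 ℂ c) := by
  intro c hc
  have h1 : HasDerivAt (fun t => algebraMap 𝕜 ℂ (k t)) (algebraMap 𝕜 ℂ (deriv k c)) c :=
    (algebraMapCLM 𝕜 ℂ).hasFDerivAt.comp_hasDerivAt c (contDiffOn_hasDerivAt hC hk hc)
  have h2 : HasDerivAt (fun t => K (algebraMap 𝕜 ℂ t)) (deriv K (algebraMap 𝕜 ℂ c)) c := by
    have h3 := HasFDerivAt.comp_hasDerivAt c ((hK c hc).hasDerivAt.hasFDerivAt.restrictScalars 𝕜)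
      ((algebraMapCLM 𝕜 ℂ).hasDerivAt (x := c))
    exact h3.congr_deriv (by simp)
  exact h1.unique (h2.congr_of_eventuallyEq (by
    filter_upwards [hC.mem_nhds hc] with t ht using e t ht))

variable {κ s : ℂ} (hκ : κ ≠ 0) (hs : κ ^ 2 = -(Real.pi * I * s)) {h : 𝕜 → 𝕜} (hC : IsOpen C)
  (hCs : ∀ c ∈ C, algebraMap 𝕜 ℂ c ∈ modelHalf s) (hh : ContDiffOn 𝕜 ∞ h C)
  (e : ∀ c ∈ C, algebraMap 𝕜 ℂ (h c) = ellipticModelChazy κ s (algebraMap 𝕜 ℂ c))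

include hκ hC hCs hh e

lemma algebraMap_deriv_ellipticModelChazy : ∀ c ∈ C, algebraMap 𝕜 ℂ (deriv h c) =
    deriv (ellipticModelChazy κ s) (algebraMap 𝕜 ℂ c) :=
  algebraMap_deriv_eq hC hh e fun c hc =>
    (contDiffOn_hasDerivAt (isOpen_modelHalf s) (contDiffOn_ellipticModelChazy hκ)
      (hCs c hc)).differentiableAt

lemma algebraMap_deriv_deriv_ellipticModelChazy : ∀ c ∈ C, algebraMap 𝕜 ℂ (deriv (deriv h) c) =
    deriv (deriv (ellipticModelChazy κ s)) (algebraMap 𝕜 ℂ c) :=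
  algebraMap_deriv_eq hC (contDiffOn_deriv hC hh)
    (algebraMap_deriv_ellipticModelChazy hκ hC hCs hh e) fun c hc =>
      (contDiffOn_hasDerivAt (isOpen_modelHalf s) (contDiffOn_deriv (isOpen_modelHalf s)
        (contDiffOn_ellipticModelChazy hκ)) (hCs c hc)).differentiableAt

lemma invTwo_of_ellipticModelChazy {c : 𝕜} (hc : c ∈ C) : algebraMap 𝕜 ℂ (invTwo h c) =
    invTwo (ellipticModelChazy κ s) (algebraMap 𝕜 ℂ c) := by
  simp only [invTwo, map_mul, map_sub, map_pow, map_div₀, map_ofNat, e c hc,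
    algebraMap_deriv_ellipticModelChazy hκ hC hCs hh e c hc]

lemma invThree_of_ellipticModelChazy {c : 𝕜} (hc : c ∈ C) : algebraMap 𝕜 ℂ (invThree h c) =
    invThree (ellipticModelChazy κ s) (algebraMap 𝕜 ℂ c) := by
  simp only [invThree, iteratedDeriv_two, map_mul, map_sub, map_add, map_neg, map_pow, map_div₀,
    map_ofNat, e c hc, algebraMap_deriv_ellipticModelChazy hκ hC hCs hh e c hc,
    algebraMap_deriv_deriv_ellipticModelChazy hκ hC hCs hh e c hc]

include hs

lemma chazyAt_of_ellipticModelChazy : ∀ c ∈ C, ChazyAt h c := by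
  intro c hc
  have hO := isOpen_modelHalf s
  have hE := contDiffOn_ellipticModelChazy (s := s) hκ
  have h1 := algebraMap_deriv_ellipticModelChazy hκ hC hCs hh e
  have h2 := algebraMap_deriv_deriv_ellipticModelChazy hκ hC hCs hh e
  have h3 := algebraMap_deriv_eq hC (contDiffOn_deriv hC (contDiffOn_deriv hC hh)) h2 fun c hc =>
    (contDiffOn_hasDerivAt hO (contDiffOn_deriv hO (contDiffOn_deriv hO hE))
      (hCs c hc)).differentiableAt
  have h4 := chazyAt_ellipticModelChazy hκ hs (hCs c hc)
  rw [ChazyAt, iteratedDeriv_succ, iteratedDeriv_two] at h4 ⊢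
  refine (algebraMap 𝕜 ℂ).injective ?_
  simp only [map_mul, map_sub, map_pow, map_ofNat]
  rw [h3 c hc, h4, h2 c hc, h1 c hc, e c hc]

lemma isJet_of_ellipticModel (hB : IsOpen B) (μ ν K : ℂ) :
    ContinuousOn (fun x : 𝕜 × 𝕜 => K * exp (2 * μ * algebraMap 𝕜 ℂ x.1 +
      μ ^ 2 * algebraMap 𝕜 ℂ x.2) * ellipticModel κ s (algebraMap 𝕜 ℂ x.1 +
        μ * algebraMap 𝕜 ℂ x.2 + ν) (algebraMap 𝕜 ℂ x.2)) (B ×ˢ C) ∧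
    IsJet {x ∈ B ×ˢ C | K * exp (2 * μ * algebraMap 𝕜 ℂ x.1 +
      μ ^ 2 * algebraMap 𝕜 ℂ x.2) * ellipticModel κ s (algebraMap 𝕜 ℂ x.1 +
        μ * algebraMap 𝕜 ℂ x.2 + ν) (algebraMap 𝕜 ℂ x.2) ≠ 0}
      (fun b c => K * exp (2 * μ * algebraMap 𝕜 ℂ b + μ ^ 2 * algebraMap 𝕜 ℂ c) *
        ellipticModel κ s (algebraMap 𝕜 ℂ b + μ * algebraMap 𝕜 ℂ c + ν) (algebraMap 𝕜 ℂ c))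
      (fun b c => 2 * μ + logB (ellipticModel κ s)
        (algebraMap 𝕜 ℂ b + μ * algebraMap 𝕜 ℂ c + ν) (algebraMap 𝕜 ℂ c))
      (fun b c => negLogDerivTwo (ellipticModel κ s)
        (algebraMap 𝕜 ℂ b + μ * algebraMap 𝕜 ℂ c + ν) (algebraMap 𝕜 ℂ c))
      (fun b c => pb (negLogDerivTwo (ellipticModel κ s))
        (algebraMap 𝕜 ℂ b + μ * algebraMap 𝕜 ℂ c + ν) (algebraMap 𝕜 ℂ c))
      (fun c => algebraMap 𝕜 ℂ (h c)) (fun c => algebraMap 𝕜 ℂ (deriv h c)) := by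
  have hι : Continuous (algebraMap 𝕜 ℂ) := continuous_algebraMap 𝕜 ℂ
  have hG : ContinuousOn (fun x : 𝕜 × 𝕜 => K * exp (2 * μ * algebraMap 𝕜 ℂ x.1 +
      μ ^ 2 * algebraMap 𝕜 ℂ x.2) * ellipticModel κ s (algebraMap 𝕜 ℂ x.1 +
        μ * algebraMap 𝕜 ℂ x.2 + ν) (algebraMap 𝕜 ℂ x.2)) (B ×ˢ C) := by
    have h1 : ContinuousOn (fun x : 𝕜 × 𝕜 => ellipticModel κ s (algebraMap 𝕜 ℂ x.1 +
        μ * algebraMap 𝕜 ℂ x.2 + ν) (algebraMap 𝕜 ℂ x.2)) (B ×ˢ C) :=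
      ContinuousOn.comp (g := fun x : ℂ × ℂ => ellipticModel κ s x.1 x.2)
        (f := fun x : 𝕜 × 𝕜 => (algebraMap 𝕜 ℂ x.1 + μ * algebraMap 𝕜 ℂ x.2 + ν,
          algebraMap 𝕜 ℂ x.2)) smoothOn_ellipticModel.continuousOn
        (by fun_prop) fun x hx => ⟨trivial, hCs x.2 hx.2⟩
    exact (Continuous.continuousOn (by fun_prop)).mul h1
  refine ⟨hG, ?_⟩
  have J := ((isJet_ellipticModel hκ hs).galilei μ ν K).restrict (𝕜 := 𝕜)
    (hG.isOpen_inter_preimage (hB.prod hC) (isOpen_ne (x := (0 : ℂ)))) (fun b c hx =>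
      show (_, _) ∈ modelDomain κ s from ⟨⟨trivial, hCs c hx.1.2⟩, fun h0 => hx.2 (by
        simp only [h0, mul_zero])⟩)
  refine J.congr (fun b c _ => ?_) (fun b c hx => e c hx.1.2) fun b c hx =>
    algebraMap_deriv_ellipticModelChazy hκ hC hCs hh e c hx.1.2
  rw [exp_eq_exp_ℂ]

variable {g : 𝕜 → 𝕜 → 𝕜}

/-- The solutions of the reduced system of an elliptic solution of the Chazy equation. -/
theorem reducedSystem_iff_ellipticModel (hB : IsOpen B) (hB' : IsConnected B) (hC' : IsConnected C)
    (hg : ContDiffOn 𝕜 ∞ (fun x : 𝕜 × 𝕜 => g x.1 x.2) (B ×ˢ C))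
    (h0 : ∀ b ∈ B, ∀ c ∈ C, g b c ≠ 0) : ReducedSystem B C g h ↔
      ∃ μ ν K : ℂ, ∀ b ∈ B, ∀ c ∈ C, algebraMap 𝕜 ℂ (g b c) =
        K * exp (2 * μ * algebraMap 𝕜 ℂ b + μ ^ 2 * algebraMap 𝕜 ℂ c) *
        ellipticModel κ s (algebraMap 𝕜 ℂ b + μ * algebraMap 𝕜 ℂ c + ν) (algebraMap 𝕜 ℂ c) := by
  have e₁ := algebraMap_deriv_ellipticModelChazy hκ hC hCs hh e
  have e₂ := algebraMap_deriv_deriv_ellipticModelChazy hκ hC hCs hh e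
  constructor
  · intro R
    obtain ⟨b₀, hb₀⟩ := hB'.nonempty
    obtain ⟨c₀, hc₀⟩ := hC'.nonempty
    have h1 := congrArg (algebraMap 𝕜 ℂ) (R.sq_eq ⟨hb₀, hc₀⟩)
    simp only [map_mul, map_add, map_pow, map_div₀, map_ofNat] at h1
    rw [e c₀ hc₀, e₁ c₀ hc₀, e₂ c₀ hc₀] at h1
    -- The parameters are read off at the base point: a point `z` over `(v, p)` gives `ν`, then `w`
    -- gives `μ` and `g` gives `K`.
    obtain ⟨z, hz, hX, hY⟩ := exists_mem_modelDomain hκ hs (hCs c₀ hc₀) h1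
    obtain ⟨μ, hμ⟩ : ∃ μ : ℂ, 2 * μ = algebraMap 𝕜 ℂ (logB g b₀ c₀) -
        logB (ellipticModel κ s) z (algebraMap 𝕜 ℂ c₀) :=
      ⟨(algebraMap 𝕜 ℂ (logB g b₀ c₀) - logB (ellipticModel κ s) z (algebraMap 𝕜 ℂ c₀)) / 2,
        by ring⟩
    obtain ⟨ν, hν⟩ : ∃ ν : ℂ, algebraMap 𝕜 ℂ b₀ + μ * algebraMap 𝕜 ℂ c₀ + ν = z :=
      ⟨z - algebraMap 𝕜 ℂ b₀ - μ * algebraMap 𝕜 ℂ c₀, by ring⟩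
    have hne : exp (2 * μ * algebraMap 𝕜 ℂ b₀ + μ ^ 2 * algebraMap 𝕜 ℂ c₀) *
        ellipticModel κ s z (algebraMap 𝕜 ℂ c₀) ≠ 0 := mul_ne_zero (exp_ne_zero _) hz.2
    obtain ⟨K, hK⟩ : ∃ K : ℂ, K * (exp (2 * μ * algebraMap 𝕜 ℂ b₀ + μ ^ 2 * algebraMap 𝕜 ℂ c₀) *
        ellipticModel κ s z (algebraMap 𝕜 ℂ c₀)) = algebraMap 𝕜 ℂ (g b₀ c₀) :=
      ⟨_, div_mul_cancel₀ _ hne⟩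
    obtain ⟨hG, J⟩ := isJet_of_ellipticModel hκ hs hC hCs hh e hB μ ν K
    refine ⟨μ, ν, K, fun b hb c hc => ?_⟩
    refine R.eq_of_isJet (F := ℂ) (G := fun b c => K * exp (2 * μ * algebraMap 𝕜 ℂ b +
      μ ^ 2 * algebraMap 𝕜 ℂ c) * ellipticModel κ s (algebraMap 𝕜 ℂ b +
        μ * algebraMap 𝕜 ℂ c + ν) (algebraMap 𝕜 ℂ c)) hB hC hg h0 hh hB'.isPreconnected
      hC'.isPreconnected (chazyAt_of_ellipticModelChazy hκ hs hC hCs hh e) hG J hb₀ hc₀ ?_ ?_ ?_ ?_ hb hc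
    · rw [hν, mul_assoc, hK]
    · rw [hν, hμ, sub_add_cancel]
    · rw [hν, hX]
    · rw [hν, hY]
  · rintro ⟨μ, ν, K, H⟩
    obtain ⟨-, J⟩ := isJet_of_ellipticModel hκ hs hC hCs hh e hB μ ν K
    have hne : ∀ b ∈ B, ∀ c ∈ C, K * exp (2 * μ * algebraMap 𝕜 ℂ b + μ ^ 2 * algebraMap 𝕜 ℂ c) *
        ellipticModel κ s (algebraMap 𝕜 ℂ b + μ * algebraMap 𝕜 ℂ c + ν)
          (algebraMap 𝕜 ℂ c) ≠ 0 :=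
      fun b hb c hc => H b hb c hc ▸ (map_ne_zero _).2 (h0 b hb c hc)
    have J' := (J.mono (hB.prod hC) fun x hx => ⟨hx, hne x.1 hx.1 x.2 hx.2⟩).congr
      (g' := fun b c => algebraMap 𝕜 ℂ (g b c)) (fun b c hx => H b hx.1 c hx.2)
      (fun _ _ _ => rfl) fun _ _ _ => rfl
    refine reducedSystem_of_isJet hB hC hg h0 J' fun b hb c hc => ?_
    rw [e c hc, e₁ c hc, e₂ c hc]
    exact pb_negLogDerivTwo_ellipticModel_sq hκ hs
      ⟨⟨trivial, hCs c hc⟩, right_ne_zero_of_mul (hne b hb c hc)⟩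

end EllipticClassification

/-! ### Values of `(E₄ : E₆)` -/

section ModularInvariant

open Filter Topology UpperHalfPlane ModularForm ModularFormClass MatrixGroups EisensteinSeries
  SlashInvariantForm SlashInvariantFormClass
open scoped Manifold

lemma tendsto_E_atImInfty {k : ℕ} (hk : 3 ≤ k) (hk' : Even k) :
    Tendsto (E hk) atImInfty (𝓝 1) := by
  have h1 : valueAtInfty (E hk) = 1 := by
    rw [← E_qExpansion_coeff_zero hk hk']
    exact (qExpansion_coeff_zero one_pos
      (ModularFormClass.analyticAt_cuspFunction_zero (E hk) one_pos one_mem_strictPeriods_SL)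
      (periodic_comp_ofComplex (E hk) one_mem_strictPeriods_SL)).symm
  obtain ⟨c, hc, h2⟩ := exp_decay_sub_atImInfty' (E hk)
  have h3 : Tendsto (fun τ : ℍ => Real.exp (-c * τ.im)) atImInfty (𝓝 0) := by
    refine Real.tendsto_exp_atBot.comp ?_
    exact (tendsto_comap (f := UpperHalfPlane.im)).const_mul_atTop_of_neg (neg_neg_of_pos hc)
  have h4 := (h2.trans_tendsto h3).add_const (valueAtInfty (E hk))
  simpa [h1] using h4

/-- A modular form of positive weight and level one that does not vanish at infinity has a zero. -/
lemma exists_eq_zero_of_tendsto {k : ℕ} (hk : 0 < k) (F : ModularForm 𝒮ℒ k) {D : ℂ} (hD : D ≠ 0)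
    (hF : Tendsto F atImInfty (𝓝 D)) : ∃ z, F z = 0 := by
  by_contra! h
  have hs : ∀ γ : SL(2, ℤ), (⇑(1 : ModularForm 𝒮ℒ 0) / ⇑F) ∣[(0 - k : ℤ)] γ =
      ⇑(1 : ModularForm 𝒮ℒ 0) / ⇑F := by
    intro γ
    have hγ : (γ : GL (Fin 2) ℝ) ∈ 𝒮ℒ := ⟨γ, rfl⟩
    simp_rw [div_slash_SL2, SL_slash, slash_action_eqn _ _ hγ]
  -- Without zeros, `1/F` is a modular form of weight `-k`, bounded at the cusps because `F` tends
  -- to `D ≠ 0`. A form of negative weight is zero, but `1/F` is not.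
  let G : ModularForm 𝒮ℒ (0 - k) :=
    { toFun := ⇑(1 : ModularForm 𝒮ℒ 0) / ⇑F
      slash_action_eq' := fun _ ⟨γ, hγ⟩ => hγ ▸ hs γ
      holo' := (1 : ModularForm 𝒮ℒ 0).holo'.div F.holo' h
      bdd_at_cusps' {c} hc := by
        rw [Subgroup.IsArithmetic.isCusp_iff_isCusp_SL2Z] at hc
        rw [OnePoint.isBoundedAt_iff_forall_SL2Z hc]
        intro γ _
        rw [hs γ, IsBoundedAtImInfty, BoundedAtFilter]
        have := (tendsto_const_nhds (x := (1 : ℂ))).div hF hD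
        exact this.isBigO_one ℝ }
  have h1 := congrFun (levelOne_neg_weight_eq_zero (by lia) G) UpperHalfPlane.I
  have h2 : (1 : ℂ) / F UpperHalfPlane.I = 0 := h1
  simp [h] at h2

/-- The weighted projective point `(E₄ : E₆)` takes all values outside the discriminant. -/
lemma exists_E₄_E₆_eq {A B : ℂ} (hD : A ^ 3 - B ^ 2 ≠ 0) :
    ∃ (z : ℍ) (s : ℂ), s ≠ 0 ∧ E₄ z = s ^ 4 * A ∧ E₆ z = s ^ 6 * B := by
  -- The value of this form at infinity is `A³ - B² ≠ 0`; at a zero of it `(E₄, E₆)` satisfies the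
  -- same weighted relation as `(A, B)`.
  let F : ModularForm 𝒮ℒ 12 := A ^ 3 • (E₆.pow 2).mcast (by norm_num) -
    B ^ 2 • (E₄.pow 3).mcast (by norm_num)
  have hF : ∀ z, F z = A ^ 3 * E₆ z ^ 2 - B ^ 2 * E₄ z ^ 3 := fun z => by
    simp only [F, sub_apply, smul_apply, coe_mcast, coe_pow, smul_eq_mul, Pi.pow_apply]
  obtain ⟨z, hz⟩ := exists_eq_zero_of_tendsto (k := 12) (by norm_num) F hD (by
    have h1 := (((tendsto_E_atImInfty (k := 6) (by norm_num) (by decide)).pow 2).const_mul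
      (A ^ 3)).sub (((tendsto_E_atImInfty (k := 4) (by norm_num) (by decide)).pow 3).const_mul
        (B ^ 2))
    simp only [one_pow, mul_one] at h1
    exact h1.congr fun z => (hF z).symm)
  rw [hF] at hz
  have hW : E₄ z ^ 3 - E₆ z ^ 2 ≠ 0 := by
    have h1 := discriminant_ne_zero z
    rw [discriminant_eq_E₄_cube_sub_E₆_sq] at h1
    exact fun h => h1 (by rw [h, zero_div])
  refine ⟨z, ?_⟩
  generalize E₄ z = e at *
  generalize E₆ z = f at *
  by_cases hA : A = 0
  · have hB : B ≠ 0 := by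
      rintro rfl
      simp [hA] at hD
    have he : e = 0 := by simpa [hA, hB] using hz
    have hf : f ≠ 0 := by
      rintro rfl
      simp [he] at hW
    obtain ⟨s, hs⟩ := IsAlgClosed.exists_pow_nat_eq (f / B) (n := 6) (by norm_num)
    refine ⟨s, ?_, by rw [hA, he, mul_zero], by rw [hs, div_mul_cancel₀ _ hB]⟩
    rintro rfl
    exact div_ne_zero hf hB (by simpa using hs.symm)
  by_cases hB : B = 0
  · have hf : f = 0 := by simpa [hA, hB] using hz
    have he : e ≠ 0 := by
      rintro rfl
      simp [hf] at hW
    obtain ⟨s, hs⟩ := IsAlgClosed.exists_pow_nat_eq (e / A) (n := 4) (by norm_num)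
    refine ⟨s, ?_, by rw [hs, div_mul_cancel₀ _ hA], by rw [hB, hf, mul_zero]⟩
    rintro rfl
    exact div_ne_zero he hA (by simpa using hs.symm)
  have hz' : A ^ 3 * f ^ 2 = B ^ 2 * e ^ 3 := sub_eq_zero.1 hz
  have he : e ≠ 0 := by
    rintro rfl
    have : f = 0 := by simpa [hA] using hz'
    simp [this] at hW
  have hf : f ≠ 0 := by
    rintro rfl
    have : e = 0 := by simpa [hB] using hz'.symm
    exact he this
  -- Dividing the two requirements gives `s² = (f/B)/(e/A)`; each of them then follows from `A³f² =
  -- B²e³`.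
  obtain ⟨s, hs⟩ := IsAlgClosed.exists_pow_nat_eq ((f / B) / (e / A)) (n := 2) (by norm_num)
  refine ⟨s, ?_, ?_, ?_⟩
  · rintro rfl
    exact div_ne_zero (div_ne_zero hf hB) (div_ne_zero he hA) (by simpa using hs.symm)
  · rw [show s ^ 4 = (s ^ 2) ^ 2 by ring, hs]
    field_simp
    linear_combination -hz'
  · rw [show s ^ 6 = (s ^ 2) ^ 3 by ring, hs]
    field_simp
    linear_combination -hz'

end ModularInvariant

/-! ### Lattice invariants as Eisenstein series -/

section LatticeSums

open Complex

lemma G_eq_riemannZeta_mul {τ κ : ℂ} (hτ : τ ∈ upperHalf) (hκ : κ ≠ 0) {k : ℕ} (hk : 3 ≤ k) :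
    (scaleLattice (thetaLattice τ hτ) κ hκ).G k =
      (κ / Real.pi) ^ k * (2 * riemannZeta k * ModularForm.E hk ⟨τ, hτ⟩) := by
  set L := scaleLattice (thetaLattice τ hτ) κ hκ with hL
  have h1 := tsum_eisSummand_eq_riemannZeta_mul_eisensteinSeries hk ⟨τ, hτ⟩
  have h2 : ModularForm.E hk ⟨τ, hτ⟩ =
      1 / 2 * eisensteinSeries (N := 1) 0 k ⟨τ, hτ⟩ := rfl
  rw [h2, show 2 * riemannZeta k * (1 / 2 * eisensteinSeries (N := 1) 0 k ⟨τ, hτ⟩) =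
    riemannZeta k * eisensteinSeries (N := 1) 0 k ⟨τ, hτ⟩ by ring, ← h1, ← tsum_mul_left,
    PeriodPair.G]
  -- The lattice coordinates list the coefficient of `ω₁` first, whereas `eisSummand` lists that of
  -- `τ` first; hence the swap. The zero vector contributes zero on both sides.
  let ε : L.lattice ≃ (Fin 2 → ℤ) := L.latticeEquivProd.toEquiv.trans
    ((Equiv.prodComm ℤ ℤ).trans (finTwoArrowEquiv ℤ).symm)
  rw [← ε.symm.tsum_eq]
  refine tsum_congr fun v => ?_
  have h3 : ((ε.symm v : L.lattice) : ℂ) = v 1 * (Real.pi / κ) + v 0 * (Real.pi * τ / κ) :=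
    L.latticeEquiv_symm_apply (v 1, v 0)
  rw [h3, EisensteinSeries.eisSummand]
  have hpi : (Real.pi : ℂ) ≠ 0 := ofReal_ne_zero.2 Real.pi_ne_zero
  change _ = _ * ((v 0 : ℂ) * τ + v 1) ^ (-(k : ℤ))
  rw [zpow_neg, zpow_natCast, show (v 1 : ℂ) * (Real.pi / κ) + v 0 * (Real.pi * τ / κ) =
    (κ / Real.pi)⁻¹ * ((v 0 : ℂ) * τ + v 1) by field_simp; ring, mul_pow, mul_inv, inv_pow, inv_inv]

lemma riemannZeta_six : riemannZeta 6 = Real.pi ^ 6 / 945 := by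
  have h := riemannZeta_two_mul_nat (k := 3) (by norm_num)
  rw [show bernoulli (2 * 3) = 1 / 42 by decide +kernel] at h
  norm_num [Nat.factorial] at h
  rw [h]
  ring

variable {τ κ : ℂ} (hτ : τ ∈ upperHalf) (hκ : κ ≠ 0) (hs : κ ^ 2 = -(Real.pi * I))
include hs

lemma invariants_scaleLattice_eq :
    (scaleLattice (thetaLattice τ hτ) κ hκ).g₂ =
      -(4 / 3 * Real.pi ^ 2) * ModularForm.E₄ ⟨τ, hτ⟩ ∧
    (scaleLattice (thetaLattice τ hτ) κ hκ).g₃ =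
      8 / 27 * Real.pi ^ 3 * I * ModularForm.E₆ ⟨τ, hτ⟩ := by
  have hpi : (Real.pi : ℂ) ≠ 0 := ofReal_ne_zero.2 Real.pi_ne_zero
  have h4 := G_eq_riemannZeta_mul hτ hκ (k := 4) (by norm_num)
  have h6 := G_eq_riemannZeta_mul hτ hκ (k := 6) (by norm_num)
  have e4 : κ ^ 4 = -(Real.pi : ℂ) ^ 2 := by
    linear_combination (κ ^ 2 - Real.pi * I) * hs + (Real.pi : ℂ) ^ 2 * I_sq
  have e6 : κ ^ 6 = (Real.pi : ℂ) ^ 3 * I := by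
    linear_combination κ ^ 2 * e4 - (Real.pi : ℂ) ^ 2 * hs
  rw [Nat.cast_ofNat, riemannZeta_four, div_pow, e4] at h4
  rw [Nat.cast_ofNat, riemannZeta_six, div_pow, e6] at h6
  rw [PeriodPair.g₂, PeriodPair.g₃, h4, h6]
  constructor
  · field_simp
    ring
  · field_simp
    ring

end LatticeSums

/-! ### Locality of the integrability conditions -/

section ExpIntegrableCongr

open Filter Topology

variable {𝕜 : Type*} [RCLike 𝕜] {Ω : Set (𝕜 × 𝕜)} {f f' g g' : 𝕜 → 𝕜 → 𝕜} {b c : 𝕜}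

/-- Equality of functions of two variables on a set. -/
def AgreeOn (Ω : Set (𝕜 × 𝕜)) (f f' : 𝕜 → 𝕜 → 𝕜) : Prop :=
  ∀ b c, (b, c) ∈ Ω → f b c = f' b c

lemma AgreeOn.pb (h : AgreeOn Ω f f') (hΩ : IsOpen Ω) : AgreeOn Ω (pb f) (pb f') :=
  fun b c hx => Filter.EventuallyEq.deriv_eq (by
    filter_upwards [eventually_slice_fst hΩ hx] with t ht using h t c ht)

lemma AgreeOn.pc (h : AgreeOn Ω f f') (hΩ : IsOpen Ω) : AgreeOn Ω (pc f) (pc f') :=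
  fun b c hx => Filter.EventuallyEq.deriv_eq (by
    filter_upwards [eventually_slice_snd hΩ hx] with t ht using h b t ht)

lemma AgreeOn.mul (h : AgreeOn Ω f f') (h' : AgreeOn Ω g g') : AgreeOn Ω (f * g) (f' * g') :=
  fun b c hx => congrArg₂ (· * ·) (h b c hx) (h' b c hx)

lemma AgreeOn.sub (h : AgreeOn Ω f f') (h' : AgreeOn Ω g g') : AgreeOn Ω (f - g) (f' - g') :=
  fun b c hx => congrArg₂ (· - ·) (h b c hx) (h' b c hx)

lemma AgreeOn.pow (h : AgreeOn Ω f f') (n : ℕ) : AgreeOn Ω (f ^ n) (f' ^ n) :=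
  fun b c hx => congrArg (· ^ n) (h b c hx)

lemma ExpIntegrableAt.congr (H : ExpIntegrableAt g b c) (hg : AgreeOn Ω g g') (hΩ : IsOpen Ω)
    (hx : (b, c) ∈ Ω) : ExpIntegrableAt g' b c := by
  have gb := hg.pb hΩ
  have gc := hg.pc hΩ
  have gbb := gb.pb hΩ
  have gbc := gb.pc hΩ
  have gcc := gc.pc hΩ
  refine ⟨?_, ?_, ?_, ?_, ?_⟩
  · rw [← ((gb.mul gcc).sub (gc.mul gbc)) b c hx, ← ((gbc.mul hg).sub (gb.mul gc)).pc hΩ b c hx]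
    exact H.cond₁
  · rw [← ((hg.mul gcc).sub (gc.pow 2)) b c hx, ← ((hg.mul gbb).sub (gb.pow 2)).pc hΩ b c hx]
    exact H.cond₂
  · rw [← ((hg.mul gcc).sub (gc.pow 2)).pc hΩ b c hx, ← ((gcc.mul gbb).sub (gbc.pow 2)) b c hx]
    exact H.cond₃
  · rw [← ((gbb.mul gcc).sub (gbc.pow 2)).pb hΩ b c hx,
      ← ((gb.mul gcc).sub (gc.mul gbc)).pc hΩ b c hx]
    exact H.cond₄
  · rw [← ((gbb.mul hg).sub (gb.pow 2)).pb hΩ b c hx, ← ((gbc.mul hg).sub (gc.mul gb)) b c hx]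
    exact H.cond₅

end ExpIntegrableCongr

/-! ### The solution `Δ'/(2Δ)` on the upper half-plane -/

section EllipticChazy

open Complex

lemma exists_sq_eq : ∃ κ : ℂ, κ ≠ 0 ∧ κ ^ 2 = -(Real.pi * I) := by
  obtain ⟨κ, hκ⟩ := IsAlgClosed.exists_pow_nat_eq (-(Real.pi * I : ℂ)) (n := 2) two_pos
  refine ⟨κ, ?_, hκ⟩
  rintro rfl
  exact neg_ne_zero.2 (mul_ne_zero (ofReal_ne_zero.2 Real.pi_ne_zero) I_ne_zero)
    (by simpa using hκ.symm)

lemma modelHalf_one : modelHalf 1 = upperHalf := by simp [modelHalf]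

variable {κ : ℂ} (hκ : κ ≠ 0) (hs : κ ^ 2 = -(Real.pi * I))

include hs

lemma sq_eq_mul_one : κ ^ 2 = -(Real.pi * I * 1) := by rw [hs, mul_one]

lemma ellipticChazy_eq_model : ∀ c ∈ upperHalf,
    ellipticChazy c = ellipticModelChazy κ 1 c := by
  intro c hc
  rw [ellipticChazy_eq hc, ellipticModelChazy, hs, one_mul]

include hκ in
lemma contDiffOn_ellipticChazy_of_sq : ContDiffOn ℂ ∞ ellipticChazy upperHalf :=
  (modelHalf_one ▸ contDiffOn_ellipticModelChazy (s := 1) hκ).congr (ellipticChazy_eq_model hs)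

include hκ

lemma invTwo_ellipticChazy {c : ℂ} (hc : c ∈ upperHalf) :
    invTwo ellipticChazy c = invTwo (ellipticModelChazy κ 1) c :=
  invTwo_of_ellipticModelChazy (𝕜 := ℂ) hκ isOpen_upperHalf (fun _ hc => modelHalf_one ▸ hc)
    (contDiffOn_ellipticChazy_of_sq hκ hs) (ellipticChazy_eq_model hs) hc

lemma invThree_ellipticChazy {c : ℂ} (hc : c ∈ upperHalf) :
    invThree ellipticChazy c = invThree (ellipticModelChazy κ 1) c :=
  invThree_of_ellipticModelChazy (𝕜 := ℂ) hκ isOpen_upperHalf (fun _ hc => modelHalf_one ▸ hc)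
    (contDiffOn_ellipticChazy_of_sq hκ hs) (ellipticChazy_eq_model hs) hc

lemma sigmaSolution_eq {c : ℂ} (hc : c ∈ upperHalf) (z : ℂ) :
    sigmaSolution z c = ellipticModel κ 1 z c := by
  rw [ellipticModel_eq_weierstrassSigma hκ (sq_eq_mul_one hs) (modelHalf_one ▸ hc),
    sigmaSolution, invTwo_ellipticChazy hκ hs hc, invThree_ellipticChazy hκ hs hc,
    ellipticChazy_eq_model hs c hc]

lemma invariants_ellipticChazy_eq {c : ℂ} (hc : c ∈ upperHalf) :
    invTwo ellipticChazy c = -(4 / 3 * Real.pi ^ 2) * ModularForm.E₄ ⟨c, hc⟩ ∧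
      invThree ellipticChazy c = 8 / 27 * Real.pi ^ 3 * I * ModularForm.E₆ ⟨c, hc⟩ := by
  have hc' : (1 : ℂ) * c ∈ upperHalf := by rwa [one_mul]
  obtain ⟨h2, h3, -⟩ := modelLattice_invariants (s := 1) (c := c) hκ (sq_eq_mul_one hs) hc'
  obtain ⟨h4, h6⟩ := invariants_scaleLattice_eq hc' hκ hs
  rw [invTwo_ellipticChazy hκ hs hc, invThree_ellipticChazy hκ hs hc, ← h2, ← h3]
  simp only [one_mul] at h4 h6
  simp only [modelLattice, one_mul]
  exact ⟨h4, h6⟩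

omit hκ hs

lemma contDiffOn_ellipticChazy : ContDiffOn ℂ ∞ ellipticChazy upperHalf := by
  obtain ⟨κ, hκ, hs⟩ := exists_sq_eq
  exact contDiffOn_ellipticChazy_of_sq hκ hs

lemma chazyAt_ellipticChazy : ∀ c ∈ upperHalf, ChazyAt ellipticChazy c := by
  obtain ⟨κ, hκ, hs⟩ := exists_sq_eq
  exact chazyAt_of_ellipticModelChazy (𝕜 := ℂ) hκ (sq_eq_mul_one hs) isOpen_upperHalf
    (fun c hc => modelHalf_one ▸ hc) contDiffOn_ellipticChazy (ellipticChazy_eq_model hs)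

lemma exists_periodPair_ellipticChazy {c : ℂ} (hc : c ∈ upperHalf) :
    ∃ L : PeriodPair, L.g₂ = invTwo ellipticChazy c ∧ L.g₃ = invThree ellipticChazy c := by
  obtain ⟨κ, hκ, hs⟩ := exists_sq_eq
  obtain ⟨h2, h3, -⟩ := modelLattice_invariants (s := 1) (c := c) hκ (sq_eq_mul_one hs)
    (modelHalf_one ▸ hc)
  exact ⟨_, h2.trans (invTwo_ellipticChazy hκ hs hc).symm,
    h3.trans (invThree_ellipticChazy hκ hs hc).symm⟩

lemma integrableDensity_sigmaSolution :
    IntegrableDensity (Set.univ ×ˢ Set.univ ×ˢ upperHalf) (expDensity sigmaSolution) := by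
  obtain ⟨κ, hκ, hs⟩ := exists_sq_eq
  rw [integrableDensity_expDensity_iff]
  intro b _ c hc
  exact (expIntegrableAt_ellipticModel hκ (sq_eq_mul_one hs) (modelHalf_one ▸ hc) b).congr
    (fun b c hx => (sigmaSolution_eq hκ hs hx.2 b).symm) isOpen_univ_prod_upperHalf ⟨trivial, hc⟩

lemma reducedSystem_ellipticChazy_iff {B C : Set ℂ} {g : ℂ → ℂ → ℂ} (hB : IsOpen B)
    (hB' : IsConnected B) (hC : IsOpen C) (hC' : IsConnected C) (hCs : C ⊆ upperHalf)
    (hg : ContDiffOn ℂ ∞ (fun p : ℂ × ℂ => g p.1 p.2) (B ×ˢ C))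
    (h0 : ∀ b ∈ B, ∀ c ∈ C, g b c ≠ 0) : ReducedSystem B C g ellipticChazy ↔
      ∃ μ ν K : ℂ, ∀ b ∈ B, ∀ c ∈ C,
        g b c = K * exp (2 * μ * b + μ ^ 2 * c) * sigmaSolution (b + μ * c + ν) c := by
  obtain ⟨κ, hκ, hs⟩ := exists_sq_eq
  rw [reducedSystem_iff_ellipticModel (𝕜 := ℂ) hκ (sq_eq_mul_one hs) hC
    (fun c hc => modelHalf_one ▸ hCs hc) (contDiffOn_ellipticChazy.mono hCs)
    (fun c hc => ellipticChazy_eq_model hs c (hCs hc)) hB hB' hC' hg h0]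
  refine exists_congr fun μ => exists_congr fun ν => exists_congr fun K => forall₂_congr
    fun b _ => forall₂_congr fun c hc => ?_
  rw [sigmaSolution_eq hκ hs (hCs hc)]
  rfl

theorem existsUnique_chazyModel {C : Set ℂ} {h : ℂ → ℂ} (hC : IsOpen C)
    (hh : DifferentiableOn ℂ h C) (hch : ∀ c ∈ C, ChazyAt h c) {c₀ : ℂ} (hc₀ : c₀ ∈ C) :
    ∃! k : Fin 3, ChazyEquivAt (chazyModel k) (chazyModelDomain k) h c₀ := by
  obtain ⟨κ, hκ, hs⟩ := exists_sq_eq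
  have hpi : (Real.pi : ℂ) ≠ 0 := ofReal_ne_zero.2 Real.pi_ne_zero
  refine (ChazyJet.of_chazyAt hC (hh.contDiffOn hC) hch).existsUnique_model hc₀
    (ChazyJet.of_chazyAt isOpen_upperHalf contDiffOn_ellipticChazy chazyAt_ellipticChazy)
    (fun τ hτ h0 => ?_) fun u v huv => ?_
  -- `g₂³ - 27g₃²` equals `-(64/27)π⁶(E₄³ - E₆²)`, a non-zero multiple of the modular discriminant.
  · obtain ⟨h2, h3⟩ := invariants_ellipticChazy_eq hκ hs hτ
    have h1 := ModularForm.discriminant_ne_zero ⟨τ, hτ⟩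
    rw [ModularForm.discriminant_eq_E₄_cube_sub_E₆_sq] at h1
    refine h1 ?_
    rw [h2, h3] at h0
    have h4 : (64 / 27 * (Real.pi : ℂ) ^ 6) * ((ModularForm.E₄ ⟨τ, hτ⟩ : ℂ) ^ 3 -
        ModularForm.E₆ ⟨τ, hτ⟩ ^ 2) = 0 := by
      linear_combination -h0 - (64 / 27 * (Real.pi : ℂ) ^ 6) *
        (ModularForm.E₆ ⟨τ, hτ⟩ : ℂ) ^ 2 * I_sq
    rw [(mul_eq_zero.1 h4).resolve_left (mul_ne_zero (by norm_num)
      (pow_ne_zero _ hpi)), zero_div]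
  -- `A` and `B` are `u` and `v` divided by the constants that relate `g₂, g₃` to `E₄, E₆`.
  · obtain ⟨z, s, hs0, h4, h6⟩ := exists_E₄_E₆_eq (A := u / -(4 / 3 * Real.pi ^ 2))
      (B := v / (8 / 27 * Real.pi ^ 3 * I)) (by
        intro h0
        refine huv ?_
        field_simp at h0
        linear_combination h0 / 1728 + u ^ 3 * I_sq)
    obtain ⟨h2, h3⟩ := invariants_ellipticChazy_eq hκ hs z.2
    refine ⟨z, z.2, s, hs0, ?_, ?_⟩
    · rw [h2]
      refine (congrArg _ h4).trans ?_
      field_simp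
    · rw [h3]
      refine (congrArg _ h6).trans ?_
      field_simp

end EllipticChazy

/-! ### The theta function on the imaginary axis -/

section RealTheta

open Filter Topology ModularForm
open Complex hiding eta

/-- The partial products are real and non-negative, which persists in the limit; `η` has no zeros,
so the limit is positive. -/
lemma exists_eta_I_mul_eq {y : ℝ} (hy : 0 < y) : ∃ r : ℝ, 0 < r ∧ eta (I * y) = r := by
  have h1 : Function.Periodic.qParam 24 (I * y) = Real.exp (-(Real.pi * y / 12)) := by
    rw [Function.Periodic.qParam, ofReal_exp]
    congr 1
    push_cast
    linear_combination (Real.pi * y / 12 : ℂ) * I_mul_I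
  have hS : IsClosed {z : ℂ | 0 ≤ z.re ∧ z.im = 0} :=
    (isClosed_le continuous_const continuous_re).inter (isClosed_eq continuous_im continuous_const)
  have h2 := (multipliable_one_sub_pow (norm_nome_lt_one (I_mul_mem_upperHalf hy))).hasProd
  have h3 := hS.mem_of_tendsto h2 (Eventually.of_forall fun s => by
    have : ∏ n ∈ s, (1 - nome (I * y) ^ (n + 1)) =
        ((∏ n ∈ s, (1 - Real.exp (-(2 * Real.pi * y)) ^ (n + 1)) : ℝ) : ℂ) := by
      rw [nome_I_mul]
      push_cast
      rfl
    refine ⟨?_, by rw [this, ofReal_im]⟩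
    rw [this, ofReal_re]
    refine Finset.prod_nonneg fun n _ => sub_nonneg.2 (pow_le_one₀ (Real.exp_pos _).le ?_)
    exact Real.exp_le_one_iff.2 (by have := Real.pi_pos; nlinarith))
  have h4 : eta (I * y) = ((Real.exp (-(Real.pi * y / 12)) *
      (∏' n : ℕ, (1 - nome (I * y) ^ (n + 1))).re : ℝ) : ℂ) := by
    have h5 : ∏' n : ℕ, (1 - nome (I * y) ^ (n + 1)) =
        ((∏' n : ℕ, (1 - nome (I * y) ^ (n + 1))).re : ℂ) :=
      Complex.ext rfl h3.2
    rw [ofReal_mul, ← h5, eta, h1]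
    simp only [eta_q_eq_pow, nome]
  refine ⟨_, lt_of_le_of_ne (mul_nonneg (Real.exp_pos _).le h3.1) fun h => ?_, h4⟩
  refine eta_ne_zero (z := I * y) (I_mul_mem_upperHalf hy) ?_
  rw [h4, ← h, ofReal_zero]

lemma jacobiThetaOne_ofReal_im (b y : ℝ) : (jacobiThetaOne b (I * y)).im = 0 := by
  have h1 : jacobiThetaOne b (I * y) = ((2 * ∑' n : ℕ, (-1) ^ n *
      Real.exp (-(Real.pi * y * (n + 1 / 2) ^ 2)) * Real.sin ((2 * n + 1) * b) : ℝ) : ℂ) := by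
    rw [jacobiThetaOne]
    push_cast
    refine congrArg (2 * ·) (tsum_congr fun n => ?_)
    congr 3
    linear_combination (Real.pi * y * (n + 1 / 2) ^ 2 : ℂ) * I_mul_I
  rw [h1, ofReal_im]

variable {c : ℝ}

lemma thetaPoint_eq_I_mul (c : ℝ) : thetaPoint c = I * ((c / Real.pi : ℝ) : ℂ) := by
  rw [thetaPoint]
  push_cast
  ring

lemma thetaPoint_eq_mul (c : ℝ) : thetaPoint c = I / Real.pi * c := by
  rw [thetaPoint]
  ring

lemma thetaPoint_mem (hc : 0 < c) : thetaPoint c ∈ upperHalf :=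
  thetaPoint_eq_I_mul c ▸ I_mul_mem_upperHalf (div_pos hc Real.pi_pos)

lemma mem_modelHalf (hc : 0 < c) : (c : ℂ) ∈ modelHalf (I / Real.pi) := by
  change I / Real.pi * c ∈ upperHalf
  exact thetaPoint_eq_mul c ▸ thetaPoint_mem hc

lemma one_sq_eq : (1 : ℂ) ^ 2 = -(Real.pi * I * (I / Real.pi)) := by
  have hpi : (Real.pi : ℂ) ≠ 0 := ofReal_ne_zero.2 Real.pi_ne_zero
  field_simp
  linear_combination I_sq

lemma realChazy_eq (hc : 0 < c) :
    (realChazy c : ℂ) = ellipticModelChazy 1 (I / Real.pi) c := by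
  have hpi : (Real.pi : ℂ) ≠ 0 := ofReal_ne_zero.2 Real.pi_ne_zero
  rw [ellipticModelChazy, ← thetaPoint_eq_mul, thetaE_eq (thetaPoint_mem hc), realChazy]
  push_cast
  have h1 : ∀ n : ℕ, exp (2 * Real.pi * I * thetaPoint c) ^ (n + 1) = exp (-2 * (n + 1) * c) := by
    intro n
    rw [← exp_nat_mul, thetaPoint]
    congr 1
    field_simp
    push_cast
    linear_combination (n + 1 : ℂ) * c * I_sq
  simp only [h1]
  ring

lemma realChazy_eq_ellipticChazy (hc : 0 < c) :
    (realChazy c : ℂ) = I / Real.pi * ellipticChazy (thetaPoint c) := by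
  have hpi : (Real.pi : ℂ) ≠ 0 := ofReal_ne_zero.2 Real.pi_ne_zero
  rw [realChazy_eq hc, ellipticModelChazy, ← thetaPoint_eq_mul, ellipticChazy_eq (thetaPoint_mem hc)]
  field_simp
  linear_combination thetaE (thetaPoint c) * I_sq

lemma contDiffOn_realChazy : ContDiffOn ℝ ∞ realChazy (Set.Ioi 0) := by
  have h1 : ContDiffOn ℝ ∞ (fun c : ℝ => ellipticModelChazy 1 (I / Real.pi) (c : ℂ)) (Set.Ioi 0) :=
    ((contDiffOn_ellipticModelChazy one_ne_zero).restrict_scalars ℝ).comp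
      (ofRealCLM.contDiff.contDiffOn) fun c hc => mem_modelHalf hc
  refine (reCLM.contDiff.comp_contDiffOn h1).congr fun c hc => ?_
  change realChazy c = (ellipticModelChazy 1 (I / Real.pi) (c : ℂ)).re
  rw [← realChazy_eq hc, ofReal_re]

lemma chazyAt_realChazy : ∀ c ∈ Set.Ioi (0 : ℝ), ChazyAt realChazy c :=
  chazyAt_of_ellipticModelChazy (𝕜 := ℝ) one_ne_zero one_sq_eq isOpen_Ioi
    (fun _ hc => mem_modelHalf hc) contDiffOn_realChazy fun _ hc => realChazy_eq hc

lemma exists_modularDisc_eq (hc : 0 < c) : ∃ r : ℝ, 0 < r ∧ eta (thetaPoint c) = r ∧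
    modularDisc (thetaPoint c) = (((2 * Real.pi) ^ 12 * r ^ 24 : ℝ) : ℂ) := by
  obtain ⟨r, hr, h⟩ := exists_eta_I_mul_eq (div_pos hc Real.pi_pos)
  rw [← thetaPoint_eq_I_mul] at h
  refine ⟨r, hr, h, ?_⟩
  rw [modularDisc_eq (thetaPoint_mem hc), h]
  push_cast
  rfl

/-- With `r = η(ic/π)` the factor `Δ^{-1/8}` cancels the `η³` in `θ₁'(0) = 2η³` and leaves
`2(2π)^{-3/2}`. -/
lemma rpow_mul_eq {r : ℝ} (hr : 0 < r) :
    ((2 * Real.pi) ^ 12 * r ^ 24) ^ (-(1 / 8) : ℝ) * (2 * r ^ 3) =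
      1 / Real.sqrt (2 * Real.pi ^ 3) := by
  have hpi := Real.pi_pos
  have h2 : Real.sqrt (2 * Real.pi) ^ 2 = 2 * Real.pi := Real.sq_sqrt (by positivity)
  have hs : 0 < Real.sqrt (2 * Real.pi) := Real.sqrt_pos.2 (by positivity)
  have h3 : (2 * Real.pi) ^ 12 * r ^ 24 = ((Real.sqrt (2 * Real.pi) * r) ^ 3) ^ (8 : ℝ) := by
    rw [show (8 : ℝ) = (8 : ℕ) by norm_num, Real.rpow_natCast]
    rw [show ((Real.sqrt (2 * Real.pi) * r) ^ 3) ^ 8 = (Real.sqrt (2 * Real.pi) ^ 2) ^ 12 * r ^ 24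
      by ring, h2]
  have h4 : Real.sqrt (2 * Real.pi) ^ 3 = 2 * Real.sqrt (2 * Real.pi ^ 3) := by
    refine (pow_left_inj₀ (by positivity) (by positivity) two_ne_zero).1 ?_
    rw [mul_pow, Real.sq_sqrt (by positivity), ← pow_mul, mul_comm 3 2, pow_mul, h2]
    ring
  rw [h3, ← Real.rpow_mul (by positivity), show (8 : ℝ) * (-(1 / 8)) = -1 by norm_num,
    Real.rpow_neg_one, mul_pow, h4]
  field_simp

lemma thetaSolution_eq (hc : 0 < c) (z : ℂ) : thetaSolution z c =
    (1 / Real.sqrt (2 * Real.pi ^ 3) : ℝ) * ellipticModel 1 (I / Real.pi) z c := by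
  obtain ⟨r, hr, h1, h2⟩ := exists_modularDisc_eq hc
  rw [thetaSolution, h2, ofReal_re, jacobiThetaOne_eq_eta (thetaPoint_mem hc), h1, ← rpow_mul_eq hr,
    ellipticModel, ← thetaPoint_eq_mul]
  push_cast
  ring_nf

lemma thetaSolution_ofReal_im (b c : ℝ) : (thetaSolution b c).im = 0 := by
  rw [thetaSolution, thetaPoint_eq_I_mul, im_ofReal_mul, jacobiThetaOne_ofReal_im, mul_zero]

lemma thetaSolution_eq_weierstrassSigma (hc : 0 < c) (z : ℂ) : thetaSolution z c =
    (1 / Real.sqrt (2 * Real.pi ^ 3) : ℝ) *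
      (weierstrassSigma z (invTwo realChazy c : ℝ) (invThree realChazy c : ℝ) *
        exp (z ^ 2 * realChazy c / 6)) := by
  have h2 := invTwo_of_ellipticModelChazy (𝕜 := ℝ) (κ := 1) (s := I / Real.pi) one_ne_zero
    isOpen_Ioi (fun _ hc => mem_modelHalf hc) contDiffOn_realChazy (fun _ hc => realChazy_eq hc) hc
  have h3 := invThree_of_ellipticModelChazy (𝕜 := ℝ) (κ := 1) (s := I / Real.pi) one_ne_zero
    isOpen_Ioi (fun _ hc => mem_modelHalf hc) contDiffOn_realChazy (fun _ hc => realChazy_eq hc) hc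
  rw [thetaSolution_eq hc, ellipticModel_eq_weierstrassSigma one_ne_zero one_sq_eq
    (mem_modelHalf hc), realChazy_eq hc]
  congr 3
  · exact h2.symm
  · exact h3.symm

theorem reducedSystem_realChazy_iff {B C : Set ℝ} {g : ℝ → ℝ → ℝ} (hB : IsOpen B)
    (hB' : IsConnected B) (hC : IsOpen C) (hC' : IsConnected C) (hCs : C ⊆ Set.Ioi 0)
    (hg : ContDiffOn ℝ ∞ (fun p : ℝ × ℝ => g p.1 p.2) (B ×ˢ C))
    (h0 : ∀ b ∈ B, ∀ c ∈ C, g b c ≠ 0) : ReducedSystem B C g realChazy ↔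
      ∃ μ ν K : ℂ, ∀ b ∈ B, ∀ c ∈ C, (g b c : ℂ) =
        K * exp (2 * μ * b + μ ^ 2 * c) * thetaSolution (b + μ * c + ν) c := by
  have hk : ((1 / Real.sqrt (2 * Real.pi ^ 3) : ℝ) : ℂ) ≠ 0 :=
    ofReal_ne_zero.2 (one_div_ne_zero (Real.sqrt_pos.2 (by have := Real.pi_pos; positivity)).ne')
  rw [reducedSystem_iff_ellipticModel (𝕜 := ℝ) one_ne_zero one_sq_eq hC
    (fun c hc => mem_modelHalf (hCs hc)) (contDiffOn_realChazy.mono hCs)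
    (fun c hc => realChazy_eq (hCs hc)) hB hB' hC' hg h0]
  -- `Θ` and the model differ by the constant `1/√(2π³)`, which `K` absorbs.
  refine exists_congr fun μ => exists_congr fun ν => ⟨?_, ?_⟩
  · rintro ⟨K, hK⟩
    refine ⟨K / (1 / Real.sqrt (2 * Real.pi ^ 3) : ℝ), fun b hb c hc => ?_⟩
    refine (hK b hb c hc).trans ?_
    rw [thetaSolution_eq (hCs hc)]
    simp only [coe_algebraMap]
    rw [mul_left_comm, ← mul_assoc, ← mul_assoc, mul_div_cancel₀ _ hk]
  · rintro ⟨K, hK⟩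
    refine ⟨K * (1 / Real.sqrt (2 * Real.pi ^ 3) : ℝ), fun b hb c hc => ?_⟩
    refine (hK b hb c hc).trans ?_
    rw [thetaSolution_eq (hCs hc)]
    simp only [coe_algebraMap]
    rw [mul_left_comm, ← mul_assoc, ← mul_assoc, mul_comm _ K]

lemma smoothOn_thetaSolution :
    SmoothOn (Set.univ ×ˢ Set.Ioi (0 : ℝ)) fun b c : ℝ => (thetaSolution b c).re := by
  have h1 : ContDiffOn ℝ ∞ (fun x : ℝ × ℝ => ellipticModel 1 (I / Real.pi) (x.1 : ℂ) (x.2 : ℂ))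
      (Set.univ ×ˢ Set.Ioi (0 : ℝ)) :=
    ContDiffOn.comp (g := fun x : ℂ × ℂ => ellipticModel 1 (I / Real.pi) x.1 x.2)
      (f := fun x : ℝ × ℝ => ((x.1 : ℂ), (x.2 : ℂ)))
      (ContDiffOn.restrict_scalars ℝ smoothOn_ellipticModel)
      ((ofRealCLM.contDiff.comp contDiff_fst).prodMk
        (ofRealCLM.contDiff.comp contDiff_snd)).contDiffOn
      fun x hx => ⟨trivial, mem_modelHalf hx.2⟩
  refine (reCLM.contDiff.comp_contDiffOn 
    ((contDiffOn_const (c := ((1 / Real.sqrt (2 * Real.pi ^ 3) : ℝ) : ℂ))).mul h1)).congr fun x hx => ?_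
  exact congrArg re (thetaSolution_eq hx.2 x.1)

lemma dense_thetaSolution_ne_zero (hc : 0 < c) :
    Dense {b : ℝ | (thetaSolution b c).re ≠ 0} := by
  have hM := thetaModel_ellipticModel (κ := 1) one_ne_zero (mem_modelHalf hc)
  have h1 : {b : ℝ | (b : ℂ) ∈
      (scaleLattice (thetaLattice _ (mem_modelHalf hc)) 1 one_ne_zero).lattice}.Countable :=
    (countable_lattice _).preimage ofReal_injective
  refine (h1.dense_compl ℝ).mono fun b hb => ?_
  refine fun h0 : (thetaSolution b c).re = 0 => hb ?_
  refine (hM.eq_zero_iff b).1 ?_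
  have h2 : thetaSolution b c = 0 := Complex.ext h0 (thetaSolution_ofReal_im b c)
  rw [thetaSolution_eq hc] at h2
  refine (mul_eq_zero.1 h2).resolve_left (ofReal_ne_zero.2 (one_div_ne_zero ?_))
  exact (Real.sqrt_pos.2 (by have := Real.pi_pos; positivity)).ne'

theorem integrableDensity_thetaSolution :
    IntegrableDensity (Set.univ ×ˢ Set.univ ×ˢ Set.Ioi (0 : ℝ))
      (expDensity fun b c : ℝ => (thetaSolution b c).re) := by
  rw [integrableDensity_expDensity_iff]
  intro b _ c hc
  have hΩ : IsOpen ((Set.univ : Set ℝ) ×ˢ Set.Ioi (0 : ℝ)) := isOpen_univ.prod isOpen_Ioi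
  -- For each `c > 0` the real zeros are countable, so it suffices to treat points where `Θ` does
  -- not vanish.
  refine expIntegrableAt_of_dense smoothOn_thetaSolution hΩ
    (D := {x : ℝ × ℝ | (thetaSolution x.1 x.2).re ≠ 0}) (fun x hx => ?_) (fun b c hx hD => ?_)
    (show (b, c) ∈ _ from ⟨trivial, hc⟩)
  · exact map_mem_closure (f := fun b : ℝ => (b, x.2)) (by fun_prop)
      (dense_thetaSolution_ne_zero hx.2 x.1) fun b hb => ⟨⟨trivial, hx.2⟩, hb⟩
  · have hO : IsOpen ((Set.univ ×ˢ Set.Ioi (0 : ℝ)) ∩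
        (fun x : ℝ × ℝ => (thetaSolution x.1 x.2).re) ⁻¹' {y | y ≠ 0}) :=
      smoothOn_thetaSolution.continuousOn.isOpen_inter_preimage hΩ isOpen_ne
    obtain ⟨ε, hε, hs⟩ := Metric.isOpen_iff.1 hO (b, c) ⟨hx, hD⟩
    rw [← ball_prod_same] at hs
    have hCs : Metric.ball c ε ⊆ Set.Ioi 0 := fun t ht =>
      (hs (show (b, t) ∈ _ from ⟨Metric.mem_ball_self hε, ht⟩)).1.2
    have h0 : ∀ b' ∈ Metric.ball b ε, ∀ c' ∈ Metric.ball c ε, (thetaSolution b' c').re ≠ 0 :=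
      fun b' hb' c' hc' => (hs (show (b', c') ∈ _ from ⟨hb', hc'⟩)).2
    have hg : ContDiffOn ℝ ∞ (fun x : ℝ × ℝ => (thetaSolution x.1 x.2).re)
        (Metric.ball b ε ×ˢ Metric.ball c ε) := smoothOn_thetaSolution.mono fun x hx => (hs hx).1
    have hconn : ∀ t : ℝ, IsConnected (Metric.ball t ε) := fun t =>
      (convex_ball t ε).isConnected ⟨t, Metric.mem_ball_self hε⟩
    -- On a square without zeros `Θ` is itself the member `μ = ν = 0`, `K = 1` of the family, hence
    -- a solution of the reduced system.
    have R := (reducedSystem_realChazy_iff (g := fun b c : ℝ => (thetaSolution b c).re) Metric.isOpen_ball (hconn b) Metric.isOpen_ball (hconn c)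
      hCs hg h0).2 ⟨0, 0, 1, fun b' _ c' _ => by
        have h1 : ((thetaSolution b' c').re : ℂ) = thetaSolution b' c' :=
          Complex.ext rfl (thetaSolution_ofReal_im b' c').symm
        simpa using h1⟩
    exact R.expIntegrableAt Metric.isOpen_ball Metric.isOpen_ball hg h0
      (contDiffOn_realChazy.mono hCs) (fun c hc => chazyAt_realChazy c (hCs hc))
      ⟨Metric.mem_ball_self hε, Metric.mem_ball_self hε⟩

end RealTheta

end SecondOrderLagrangian

end

/-! ### Assembly of the theorem -/

open SecondOrderLagrangian in
theorem mainTheorem7 :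
    -- reduction of the integrability conditions, over `ℝ` and over `ℂ`
    (∀ (𝕜 : Type) [RCLike 𝕜] (B C : Set 𝕜) (g : 𝕜 → 𝕜 → 𝕜),
      IsOpen B → IsConnected B → IsOpen C → IsConnected C →
      ContDiffOn 𝕜 ∞ (fun p : 𝕜 × 𝕜 => g p.1 p.2) (B ×ˢ C) →
      (∀ b ∈ B, ∀ c ∈ C, g b c ≠ 0) →
      -- the integrability conditions
      (IntegrableDensity (Set.univ ×ˢ B ×ˢ C) (expDensity g) ↔
        ∃ h : 𝕜 → 𝕜, ContDiffOn 𝕜 ∞ h C ∧ (∀ c ∈ C, ChazyAt h c) ∧ ReducedSystem B C g h) ∧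
      -- the rational case
      (ReducedSystem B C g (fun _ => 0) ↔
        ∃ μ K L : 𝕜, ∀ b ∈ B, ∀ c ∈ C,
          g b c = NormedSpace.exp (2 * μ * b + μ ^ 2 * c) * (K * (b + μ * c) + L)) ∧
      (ReducedSystem B C g (fun _ => 0) →
        IsDegenerate (Set.univ ×ˢ B ×ˢ C) (expDensity g)) ∧
      -- the trigonometric case
      (ReducedSystem B C g (fun _ => 1) ↔
        ∃ μ K L : 𝕜, ∀ b ∈ B, ∀ c ∈ C,
          g b c = NormedSpace.exp (2 * μ * b + μ ^ 2 * c) *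
            (K * NormedSpace.exp (b + μ * c) + L * NormedSpace.exp (-(b + μ * c)))) ∧
      (ReducedSystem B C g (fun _ => 1) →
        IsDegenerate (Set.univ ×ˢ B ×ˢ C) (expDensity g))) ∧
    -- the three types of solutions of the Chazy equation modulo the `SL(2)`-symmetry
    (∀ (α β γ δ : ℂ) (D : Set ℂ) (h : ℂ → ℂ), α * δ - β * γ = 1 → IsOpen D →
      DifferentiableOn ℂ h D → (∀ c ∈ D, ChazyAt h c) →
      ∀ c : ℂ, γ * c + δ ≠ 0 → (α * c + β) / (γ * c + δ) ∈ D →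
        ChazyAt (chazyTransform α β γ δ h) c) ∧
    (∀ k : Fin 3, ∀ c ∈ chazyModelDomain k, ChazyAt (chazyModel k) c) ∧
    (∀ (C : Set ℂ) (h : ℂ → ℂ), IsOpen C → DifferentiableOn ℂ h C → (∀ c ∈ C, ChazyAt h c) →
      ∀ c₀ ∈ C, ∃! k : Fin 3, ChazyEquivAt (chazyModel k) (chazyModelDomain k) h c₀) ∧
    -- the elliptic case, sigma function representation
    (∀ c ∈ upperHalf, ellipticChazy c = Real.pi * Complex.I *
      (1 - 24 * ∑' n : ℕ, (ArithmeticFunction.sigma 1 (n + 1) : ℂ) *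
        Complex.exp (2 * Real.pi * Complex.I * c) ^ (n + 1))) ∧
    (∀ c ∈ upperHalf, ∃ L : PeriodPair,
      L.g₂ = invTwo ellipticChazy c ∧ L.g₃ = invThree ellipticChazy c) ∧
    IntegrableDensity (Set.univ ×ˢ Set.univ ×ˢ upperHalf) (expDensity sigmaSolution) ∧
    (∀ (B C : Set ℂ) (g : ℂ → ℂ → ℂ),
      IsOpen B → IsConnected B → IsOpen C → IsConnected C → C ⊆ upperHalf →
      ContDiffOn ℂ ∞ (fun p : ℂ × ℂ => g p.1 p.2) (B ×ˢ C) →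
      (∀ b ∈ B, ∀ c ∈ C, g b c ≠ 0) →
      (ReducedSystem B C g ellipticChazy ↔
        ∃ μ ν K : ℂ, ∀ b ∈ B, ∀ c ∈ C,
          g b c = K * Complex.exp (2 * μ * b + μ ^ 2 * c) * sigmaSolution (b + μ * c + ν) c)) ∧
    -- the elliptic case, real-valued representation by the theta function
    (∀ c : ℝ, 0 < c →
      (realChazy c : ℂ) = Complex.I / Real.pi * ellipticChazy (thetaPoint c) ∧
      ChazyAt realChazy c ∧
      0 < (modularDisc (thetaPoint c)).re ∧ (modularDisc (thetaPoint c)).im = 0 ∧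
      (∀ b : ℝ, (thetaSolution b c).im = 0) ∧
      (∀ z : ℂ, thetaSolution z c =
        (1 / Real.sqrt (2 * Real.pi ^ 3) : ℝ) *
          (weierstrassSigma z (invTwo realChazy c : ℝ) (invThree realChazy c : ℝ) *
            Complex.exp (z ^ 2 * realChazy c / 6)))) ∧
    IntegrableDensity (Set.univ ×ˢ Set.univ ×ˢ Set.Ioi (0 : ℝ))
      (expDensity (fun b c : ℝ => (thetaSolution b c).re)) ∧
    (∀ (B C : Set ℝ) (g : ℝ → ℝ → ℝ),
      IsOpen B → IsConnected B → IsOpen C → IsConnected C → C ⊆ Set.Ioi 0 →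
      ContDiffOn ℝ ∞ (fun p : ℝ × ℝ => g p.1 p.2) (B ×ˢ C) →
      (∀ b ∈ B, ∀ c ∈ C, g b c ≠ 0) →
      (ReducedSystem B C g realChazy ↔
        ∃ μ ν K : ℂ, ∀ b ∈ B, ∀ c ∈ C,
          (g b c : ℂ) = K * Complex.exp (2 * μ * b + μ ^ 2 * c) *
            thetaSolution (b + μ * c + ν) c)) := by
  refine ⟨fun 𝕜 _ B C g hB hB' hC hC' hg h0 =>
      ⟨integrableDensity_expDensity_iff_reducedSystem hB hC hg h0 hB',
        reducedSystem_zero_iff hB hC hg h0 hB' hC', fun R => ?_,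
        reducedSystem_one_iff hB hC hg h0 hB' hC', fun R => ?_⟩,
    fun α β γ δ D h hdet hD hh hch c hs hc =>
      ((ChazyJet.of_chazyAt hD (hh.contDiffOn hD) hch).chazyTransform hdet).chazyAt ⟨hs, hc⟩,
    fun k c hc => ?_,
    fun C h hC hh hch c₀ hc₀ => existsUnique_chazyModel hC hh hch hc₀, fun c hc => ?_,
    fun c hc => exists_periodPair_ellipticChazy hc, integrableDensity_sigmaSolution,
    fun B C g hB hB' hC hC' hCs hg h0 =>
      reducedSystem_ellipticChazy_iff hB hB' hC hC' hCs hg h0,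
    fun c hc => ⟨realChazy_eq_ellipticChazy hc, chazyAt_realChazy c hc, ?_, ?_,
      fun b => thetaSolution_ofReal_im b c, fun z => thetaSolution_eq_weierstrassSigma hc z⟩,
    integrableDensity_thetaSolution,
    fun B C g hB hB' hC hC' hCs hg h0 => reducedSystem_realChazy_iff hB hB' hC hC' hCs hg h0⟩
  · obtain ⟨μ, K, L, H⟩ := (reducedSystem_zero_iff hB hC hg h0 hB' hC').1 R
    exact isDegenerate_expDensity (fun t => K * t + L) H
  · obtain ⟨μ, K, L, H⟩ := (reducedSystem_one_iff hB hC hg h0 hB' hC').1 R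
    exact isDegenerate_expDensity
      (fun t => K * NormedSpace.exp t + L * NormedSpace.exp (-t)) H
  · fin_cases k
    · exact chazyAt_const 0 c
    · exact chazyAt_const 1 c
    · exact chazyAt_ellipticChazy c hc
  · rw [ellipticChazy_eq hc, thetaE_eq hc]
    ring
  · obtain ⟨r, hr, -, h⟩ := exists_modularDisc_eq hc
    rw [h, Complex.ofReal_re]
    have := Real.pi_pos
    positivity
  · obtain ⟨r, hr, -, h⟩ := exists_modularDisc_eq hc
    rw [h, Complex.ofReal_im]
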